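/- Let $\mathsf X$ be a Polish space with its Borel $\sigma$-algebra, $\nu$ a $\sigma$-finite measure on it (we write $dx$ for $\nu(dx)$), $\chi$ a probability measure, $m:\mathsf X\times\mathsf X\to[0,\infty)$ a measurable transition density with respect to $\nu$ ($\int m(x,x')\,dx'=1$ for all $x$), and $M(x,dx')=m(x,x')\,dx'$. Let $T\ge 1$ and let $g_0,\dots,g_T$ be measurable likelihood functions on $\mathsf X$ with $g_t>0$ and $\sup_{t\le T}\sup_x g_t(x)<\infty$. Let $\phi_t$ be the filter, $\phi_t=\gamma_t/\gamma_t(1)$ with $\gamma_0(h)=\chi(g_0h)$, $\gamma_{t}(h)=\gamma_{t-1}M(g_{t}h)$, and let $\phi_{0|-1}=\chi$, $\phi_{t|t-1}=\phi_{t-1}M$ be the one-step predictive distribution. *Algorithm.* Let $\rho_0$ be a probability measure with $\chi\ll\rho_0$ and $\frac{d\chi}{d\rho_0}g_0$ essentially bounded. Forward pass with $N$ particles: $\xi_0^1,\dots,\xi_0^N$ are i.i.d. with law $\rho_0$ and $\omega_0^i=\frac{d\chi}{d\rho_0}(\xi_0^i)g_0(\xi_0^i)$. For $t=1,\dots,T$,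 given the particles and weights up to time $t-1$, the pairs $(I_t^i,\xi_t^i)$, $1\le i\le N$, are i.i.d. with law on $\{1,\dots,N\}\times\mathsf X$ proportional to $\omega_{t-1}^{j}\vartheta_t(\xi_{t-1}^{j})p_t(\xi_{t-1}^{j},x')\,dx'$, and $\omega_t^i=m(x,x')g_t(x')/(\vartheta_t(x)p_t(x,x'))$ with $x=\xi_{t-1}^{I_t^i}$, $x'=\xi_t^i$. The *bootstrap filter* takes $\vartheta_t\equiv1$, $p_t=m$; the *fully adapted filter* takes $\vartheta_t(x)=\int m(x,x')g_t(x')\,dx'$ and $p_t(x,x')=m(x,x')g_t(x')/\vartheta_t(x)$. (Draws proportional to weights that all vanish are uniform by convention.) Assume $m(x,x')\le\sigma_+$ for all $x,x'$. Backward pass: given all particles and weights, $J_T^1,\dots,J_T^N$ are i.i.d. with probabilities proportional to $(\omega_T^i)_i$. For $s=T-1,\dots,0$, given the particles, the weights and the indices $J_t^\ell$, $t>s$, the index $J_s^\ell$ is drawn, for each $\ell$, by accept-reject: one trial draws an index $I$ with probabilities proportional to $(\omega_s^i)_i$ and an independent uniform $U$ on $[0,1]$, all trials being independent, and the trials for $\ell$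 are repeated until $U\le m(\xi_s^{I},\xi_{s+1}^{J_{s+1}^\ell})/\sigma_+$, in which case $J_s^\ell=I$. Let $Z_s^N\in[0,\infty]$ be the total number of trials performed at time $s$ for $\ell=1,\dots,N$. *Proposition.* Let $s\in\{0,\dots,T-1\}$. (a) Assume that $\int\phi_s(dx)\,m(x,x')>0$ for $\nu$-almost every $x'$ (for instance $m>0$). Then, for the bootstrap filter, $Z_s^N/N$ converges in probability, as $N\to\infty$, to $$\alpha(s)=\sigma_+\,\phi_{s|s-1}(g_s)\,\frac{\int\cdots\int g_{s+1}(x_{s+1})\,dx_{s+1}\prod_{u=s+2}^{T}m(x_{u-1},x_u)g_u(x_u)\,dx_u}{\int\cdots\int\phi_{s|s-1}(dx_s)\,g_s(x_s)\prod_{u=s+1}^{T}m(x_{u-1},x_u)g_u(x_u)\,dx_u},$$ and, for the fully adapted filter, $Z_s^N/N$ converges in probability to $$\beta(s)=\sigma_+\,\frac{\int\cdots\int g_{s+1}(x_{s+1})\,dx_{s+1}\prod_{u=s+2}^{T}m(x_{u-1},x_u)g_u(x_u)\,dx_u}{\int\cdots\int\phi_{s}(dx_s)\prod_{u=s+1}^{T}m(x_{u-1},x_u)g_u(x_u)\,dx_u}.$$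 Here $\alpha(s),\beta(s)\in[0,\infty]$, and convergence in probability is understood in $[0,\infty]$, so that it means divergence to $\infty$ in probability when the limit is infinite. (b) If $\int g_u(x)\,dx<\infty$ for all $0\le u\le T$, then $\alpha(s)<\infty$ and $\beta(s)<\infty$. -/

import Mathlib

open MeasureTheory Filter Topology
open scoped NNReal ENNReal

noncomputable section

namespace FFBSi

/-! ### The state space model and its filter -/

/-- A fully dominated hidden Markov model on `X` with a fixed observation record: `ν` is the
reference measure, `χ` the initial law, `m x x'` the density (with respect to `ν`) of the
transition kernel `M`, and `g t` the likelihood function `x ↦ g(x, y_t)` of the state at time `t`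
given the observation `y_t`. -/
structure StateSpaceModel (X : Type*) [MeasurableSpace X] where
  ν : Measure X
  sigmaFinite_ν : SigmaFinite ν
  χ : Measure X
  isProbabilityMeasure_χ : IsProbabilityMeasure χ
  m : X → X → ℝ≥0
  measurable_m : Measurable (Function.uncurry m)
  lintegral_m : ∀ x, ∫⁻ x', (m x x' : ℝ≥0∞) ∂ν = 1
  g : ℕ → X → ℝ≥0
  measurable_g : ∀ t, Measurable (g t)

section Filtering

variable {X : Type*} [MeasurableSpace X] (H : StateSpaceModel X)

/-- The measure `μ M`, i.e. `∫ μ(dx) m(x, x') ν(dx')`. -/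
def StateSpaceModel.push (μ : Measure X) : Measure X :=
  H.ν.withDensity fun x' => ∫⁻ x, (H.m x x' : ℝ≥0∞) ∂μ

/-- The unnormalized filter: `γ_0(h) = χ(g_0 h)` and `γ_{t+1}(h) = γ_t M(g_{t+1} h)`. -/
def StateSpaceModel.unnormFilter : ℕ → Measure X
  | 0 => H.χ.withDensity fun x => (H.g 0 x : ℝ≥0∞)
  | t + 1 => (H.push (StateSpaceModel.unnormFilter t)).withDensity fun x => (H.g (t + 1) x : ℝ≥0∞)

/-- The filter distribution `φ_t = γ_t / γ_t(1)`. -/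
def StateSpaceModel.filter (t : ℕ) : Measure X :=
  (H.unnormFilter t Set.univ)⁻¹ • H.unnormFilter t

/-- The one-step predictive distribution `φ_{t|t-1}`: `φ_{0|-1} = χ` and
`φ_{t+1|t} = φ_t M`. -/
def StateSpaceModel.predictive : ℕ → Measure X
  | 0 => H.χ
  | t + 1 => H.push (H.filter t)

/-- `H.backward n t x` is
`∫ ⋯ ∫ ∏_{u = t+1}^{t+n} m(x_{u-1}, x_u) g_u(x_u) ν(dx_u)` with `x_t = x`. -/
def StateSpaceModel.backward : ℕ → ℕ → X → ℝ≥0∞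
  | 0, _, _ => 1
  | n + 1, t, x =>
      ∫⁻ x', (H.m x x' : ℝ≥0∞) * H.g (t + 1) x' * StateSpaceModel.backward n (t + 1) x' ∂H.ν

/-- The integral
`∫ g_{s+1}(x_{s+1}) dx_{s+1} ∏_{u = s+2}^T ∫ m(x_{u-1}, x_u) g_u(x_u) dx_u` (for `s < T`). -/
def StateSpaceModel.limitNumerator (T s : ℕ) : ℝ≥0∞ :=
  ∫⁻ x, (H.g (s + 1) x : ℝ≥0∞) * H.backward (T - (s + 1)) (s + 1) x ∂H.ν

/-- The limit for the bootstrap filter. -/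
def StateSpaceModel.alpha (σ : ℝ≥0) (T s : ℕ) : ℝ≥0∞ :=
  σ * (∫⁻ x, (H.g s x : ℝ≥0∞) ∂H.predictive s) *
    (H.limitNumerator T s /
      ∫⁻ x, (H.g s x : ℝ≥0∞) * H.backward (T - s) s x ∂H.predictive s)

/-- The limit for the fully adapted filter. -/
def StateSpaceModel.beta (σ : ℝ≥0) (T s : ℕ) : ℝ≥0∞ :=
  σ * (H.limitNumerator T s / ∫⁻ x, H.backward (T - s) s x ∂H.filter s)

/-! ### Auxiliary particle filters -/

/-- The ingredients of an auxiliary particle filter: for the move to time `t ≥ 1`, adjustment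
multiplier weights `adj t x` and a proposal density `prop t x x'` with respect to `ν`. -/
structure AuxFilter (X : Type*) where
  adj : ℕ → X → ℝ≥0
  prop : ℕ → X → X → ℝ≥0

/-- The bootstrap filter: unit adjustment weights, proposal density `m`. -/
def bootstrap : AuxFilter X where
  adj _ _ := 1
  prop _ := H.m

/-- The fully adapted filter: adjustment weights `∫ m(x, x') g_t(x') dx'` and proposal density
`m(x, x') g_t(x')` divided by this integral. -/
def fullyAdapted : AuxFilter X where
  adj t x := (∫⁻ x', (H.m x x' : ℝ≥0∞) * H.g t x' ∂H.ν).toNNReal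
  prop t x x' :=
    H.m x x' * H.g t x' / (∫⁻ z, (H.m x z : ℝ≥0∞) * H.g t z ∂H.ν).toNNReal

end Filtering

/-! ### Sampling -/

/-- Weights normalized to sum to one. (If all weights vanish, so that sampling proportionally to
them is meaningless, the uniform weights are used by convention.) -/
def normWeight {N : ℕ} (a : Fin N → ℝ≥0) (i : Fin N) : ℝ≥0 :=
  if ∑ j, a j = 0 then (N : ℝ≥0)⁻¹ else a i / ∑ j, a j

/-- The law on the index set that is proportional to the weights `a`. -/
def categorical {N : ℕ} (a : Fin N → ℝ≥0) : Measure (Fin N) :=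
  ∑ i, (normWeight a i : ℝ≥0∞) • Measure.dirac i

/-- Conditionally on the σ-algebra `𝓕`, the random variables `V i` are independent and `V i` has
law `q ω` for every `i` (where `q` is an `𝓕`-measurable random probability measure). -/
def CondIID {Ω E ι : Type*} [MeasurableSpace Ω] [MeasurableSpace E] (P : Measure Ω)
    (𝓕 : MeasurableSpace Ω) (V : ι → Ω → E) (q : Ω → Measure E) : Prop :=
  ∀ (F : Finset ι) (A : ι → Set E), (∀ i, MeasurableSet (A i)) →
    ∀ S : Set Ω, MeasurableSet[𝓕] S →
      P (S ∩ ⋂ i ∈ F, V i ⁻¹' A i) = ∫⁻ ω in S, ∏ i ∈ F, q ω (A i) ∂P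

/-- Convergence in probability of `[0, ∞]`-valued random variables to a constant in `[0, ∞]`. -/
def TendstoInProb {Ω : Type*} [MeasurableSpace Ω] (P : Measure Ω)
    (Z : ℕ → Ω → ℝ≥0∞) (a : ℝ≥0∞) : Prop :=
  ∀ U ∈ 𝓝 a, Tendsto (fun N => P {ω | Z N ω ∉ U}) atTop (𝓝 0)

/-! ### The forward filtering backward simulation algorithm -/

/-- The random variables of one execution of the algorithm with `N` particles:
`ξ t i` is the `i`-th particle at time `t` and `anc t i` (for `t ≥ 1`) the index, at time `t - 1`,
that was drawn together with it; `J t ℓ` is the time-`t` component of the `ℓ`-th backward index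
path; `prop s k ℓ` and `U s k ℓ` are the index proposal and the uniform variable of the trial for
path `ℓ` in the `k`-th pass of the while loop at time `s` (used only if that path is still waiting
for an acceptance in this pass). -/
structure Vars (X Ω : Type*) (N : ℕ) where
  ξ : ℕ → Fin N → Ω → X
  anc : ℕ → Fin N → Ω → Fin N
  J : ℕ → Fin N → Ω → Fin N
  prop : ℕ → ℕ → Fin N → Ω → Fin N
  U : ℕ → ℕ → Fin N → Ω → ℝ

namespace Vars

variable {X Ω : Type*} [MeasurableSpace X] {N : ℕ} (V : Vars X Ω N)
  (H : StateSpaceModel X) (K : AuxFilter X) (ρ₀ : Measure X) (σ : ℝ≥0)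

/-- The importance weights: `ω_0 = (dχ/dρ₀)(ξ_0) g_0(ξ_0)`, and
`ω_{t+1} = m(x, x') g_{t+1}(x') / (adj_{t+1}(x) prop_{t+1}(x, x'))`, where `x'` is the new particle
and `x` its ancestor. -/
def weight : ℕ → Fin N → Ω → ℝ≥0
  | 0, i, ω => (H.χ.rnDeriv ρ₀ (V.ξ 0 i ω)).toNNReal * H.g 0 (V.ξ 0 i ω)
  | t + 1, i, ω =>
      let x := V.ξ t (V.anc (t + 1) i ω) ω
      let x' := V.ξ (t + 1) i ω
      H.m x x' * H.g (t + 1) x' / (K.adj (t + 1) x * K.prop (t + 1) x x')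

/-- The instrumental law of a pair (ancestor index, new particle) at time `t + 1`, proportional to
`ω_t^i adj_{t+1}(ξ_t^i) prop_{t+1}(ξ_t^i, x') ν(dx')`. -/
def instrumental (t : ℕ) (ω : Ω) : Measure (Fin N × X) :=
  ∑ i, (normWeight (fun j => V.weight H K ρ₀ t j ω * K.adj (t + 1) (V.ξ t j ω)) i : ℝ≥0∞) •
    (H.ν.withDensity fun x' => (K.prop (t + 1) (V.ξ t i ω) x' : ℝ≥0∞)).map (Prod.mk i)

/-- The σ-algebra `𝓕_t^N` generated by the particles and weights up to time `t`. -/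
abbrev forwardσ (t : ℕ) : MeasurableSpace Ω :=
  ⨆ r ∈ Set.Iic t, ⨆ i : Fin N,
    MeasurableSpace.comap (V.ξ r i) inferInstance ⊔
      MeasurableSpace.comap (V.weight H K ρ₀ r i) inferInstance

/-- The σ-algebra `𝓖_s^N` generated by `𝓕_T^N` and the backward indices at times `s, …, T`. -/
abbrev backwardσ (T s : ℕ) : MeasurableSpace Ω :=
  V.forwardσ H K ρ₀ T ⊔
    ⨆ r ∈ Set.Icc s T, ⨆ ℓ : Fin N, MeasurableSpace.comap (V.J r ℓ) inferInstance

/-- The trial of path `ℓ` in pass `k` at time `s` is accepted. -/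
def Accept (s k : ℕ) (ℓ : Fin N) (ω : Ω) : Prop :=
  V.U s k ℓ ω ≤
    (H.m (V.ξ s (V.prop s k ℓ ω) ω) (V.ξ (s + 1) (V.J (s + 1) ℓ ω) ω) : ℝ) / (σ : ℝ)

open Classical in
/-- The list `L` of the paths still waiting at the beginning of pass `k` of the while loop. -/
def active (s : ℕ) (ω : Ω) : ℕ → Finset (Fin N)
  | 0 => Finset.univ
  | k + 1 => (active s ω k).filter fun ℓ => ¬ V.Accept H σ s k ℓ ω

/-- The number `Z_s^N` of simulations (trials) performed at time `s`: each pass of the while loop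
performs one trial for every path in the current list. -/
def simCount (s : ℕ) (ω : Ω) : ℝ≥0∞ :=
  ∑' k, ((V.active H σ s ω k).card : ℝ≥0∞)

/-- `V` is an execution of the algorithm on the probability space `(Ω, P)`: a forward pass by the
auxiliary particle filter `K` with initial instrumental law `ρ₀`, followed by the backward
simulation of `N` index paths by accept-reject with the bound `σ`. -/
structure IsRun [MeasurableSpace Ω] (P : Measure Ω) (T : ℕ) : Prop where
  measurable_ξ : ∀ t i, Measurable (V.ξ t i)
  measurable_anc : ∀ t i, Measurable (V.anc t i)
  measurable_J : ∀ t ℓ, Measurable (V.J t ℓ)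
  measurable_prop : ∀ s k ℓ, Measurable (V.prop s k ℓ)
  measurable_U : ∀ s k ℓ, Measurable (V.U s k ℓ)
  /-- The initial particles are i.i.d. with law `ρ₀`. -/
  init : CondIID P ⊥ (V.ξ 0) (fun _ => ρ₀)
  /-- Given `𝓕_t^N`, the pairs (ancestor, particle) at time `t + 1` are i.i.d. draws from the
  instrumental law. -/
  move : ∀ t < T, CondIID P (V.forwardσ H K ρ₀ t)
    (fun i ω => (V.anc (t + 1) i ω, V.ξ (t + 1) i ω)) (V.instrumental H K ρ₀ t)
  /-- Given `𝓕_T^N`, the indices `J_T^ℓ` are i.i.d. with probabilities proportional to `ω_T`. -/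
  final : CondIID P (V.forwardσ H K ρ₀ T) (V.J T)
    (fun ω => categorical fun i => V.weight H K ρ₀ T i ω)
  /-- Given `𝓖_{s+1}^N`, the trials at time `s` are i.i.d.; a trial consists of an index with
  probabilities proportional to `ω_s` and an independent uniform variable on `[0, 1]`. -/
  trials : ∀ s < T, CondIID P (V.backwardσ H K ρ₀ T (s + 1))
    (fun (kℓ : ℕ × Fin N) ω => (V.prop s kℓ.1 kℓ.2 ω, V.U s kℓ.1 kℓ.2 ω))
    (fun ω => (categorical fun i => V.weight H K ρ₀ s i ω).prod
      (volume.restrict (Set.Icc (0 : ℝ) 1)))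
  /-- An accepted proposal becomes the time-`s` index of the path. -/
  accepted : ∀ s < T, ∀ k ℓ ω, ℓ ∈ V.active H σ s ω k → V.Accept H σ s k ℓ ω →
    V.J s ℓ ω = V.prop s k ℓ ω

end Vars

end FFBSi

end

noncomputable section

namespace FFBSi

open ProbabilityTheory

/-! Every pass of the loop costs one trial per waiting path, so `Z_s^N / N` is the sum over `k` of
the fraction of paths waiting at the start of pass `k`. Let `W_i` be the normalized weights at time
`s`, let `q = ∑ W_i m(ξ_s^i, ·)` be the particle version of the predictive density `G = ∫ φ_s(dx)
m(x, ·)`, and let `B_t` be the function `backward (T - t) t`. Given the forward pass and the later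
indices, a path whose particle at time `s + 1` is `x'` is still waiting after `k` trials with
probability `(1 - q(x')/σ)^k`, independently of the other paths.

It remains to average over the selected particles. Conditioning successively on later indices turns
an average over `J_{s+1}` into one over `J_T`, at the price of applying the backward kernels to the
statistic (`tip_avg_backStat`). The denominator of each backward kernel is the particle predictive
density from which the next cloud is essentially drawn, so the two cancel
(`lintegral_predDensity_stepFun`). The fraction waiting is thus asymptotically `c⁻¹ ∫ q (1 - q/σ)^k
g_{s+1} B_{s+1} dν` with `c = ∫ B_s dφ_s`. Since `q → G` in `L¹(ν)` by Scheffé's argument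
(`tip_lintegral_absDiff`) and `y (1 - y/σ)^k` is Lipschitz on `[0, σ]`, `q` may be replaced by `G`
(`tip_avg_waiting`).

Finally `∑_k G (1 - G/σ)^k = σ` wherever `G > 0`: the predictive density disappears and the limits
sum to `β(s)` (`tsum_waitingLimit`). If `β(s) = ∞`, partial sums already force divergence. Otherwise
the tail from pass `k₀` on has conditional mean governed by `∫ σ (1 - q/σ)^{k₀} g_{s+1} B_{s+1} dν`,
which is small when `N → ∞` and then `k₀ → ∞` (`tip_avg_waiting_tail`). The tail statistic is
unbounded where `q` is small, so the weak law `TIP.of_condMean` has two regimes: Chebyshev for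
bounded variables, and Markov, without any bound, when the limit is zero. The equality `α(s) = β(s)`
is Bayes' formula for `φ_s`.

Bootstrap and fully adapted filters are treated together through `AuxFilter.Regular`; the adjustment
weights only contribute constants that cancel on self-normalization. -/

theorem ennreal_prod_iSup_of_monotone {ι : Type*} (F : Finset ι) (u : ι → ℕ → ℝ≥0∞)
    (hu : ∀ i, Monotone (u i)) : ∏ i ∈ F, ⨆ n, u i n = ⨆ n, ∏ i ∈ F, u i n := by
  classical
  induction F using Finset.induction_on with
  | empty => simp
  | insert i F hi ih =>
    simp only [Finset.prod_insert hi, ih]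
    refine le_antisymm ?_ (iSup_le fun n => mul_le_mul' (le_iSup (u i) n)
      (le_iSup (fun n => ∏ i ∈ F, u i n) n))
    rw [ENNReal.iSup_mul]
    refine iSup_le fun a => ?_
    rw [ENNReal.mul_iSup]
    refine iSup_le fun b => ?_
    refine le_iSup_of_le (max a b) (mul_le_mul' (hu i (le_max_left _ _)) ?_)
    exact Finset.prod_le_prod' fun j _ => hu j (le_max_right _ _)

/-! ### Conditionally i.i.d. variables: integrals of products -/

section CondIID

variable {Ω E ι 𝒴 : Type*} {𝓕 : MeasurableSpace Ω} {mΩ : MeasurableSpace Ω}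
  [MeasurableSpace E] [MeasurableSpace 𝒴]
  {P : Measure Ω} {V : ι → Ω → E} {q : Ω → Measure E}
  {Y : Ω → 𝒴} {κ : Kernel 𝒴 E}

/-- The definition is the case of indicators. Indices are moved one at a time from `F₂`, where they
carry an indicator, to `F₁`, where they carry a bounded function that may also depend on the
conditioning data `Y`. -/
theorem CondIID.setLIntegral_mul_prod [IsFiniteMeasure P] [IsMarkovKernel κ]
    (hV : CondIID P 𝓕 V q) (h𝓕 : 𝓕 ≤ mΩ) (hVm : ∀ i, Measurable (V i))
    (hY : Measurable[𝓕] Y) (hq : ∀ ω, q ω = κ (Y ω)) {Ψ : ι → 𝒴 × E → ℝ≥0∞}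
    (hΨ : ∀ i, Measurable (Ψ i)) (hb : ∀ i, ∃ C : ℝ≥0, ∀ z, Ψ i z ≤ C) (F₁ : Finset ι) :
    ∀ F₂ : Finset ι, Disjoint F₁ F₂ → ∀ A : ι → Set E, (∀ i, MeasurableSet (A i)) →
    ∀ S : Set Ω, MeasurableSet[𝓕] S →
      ∫⁻ ω in S, (∏ i ∈ F₁, Ψ i (Y ω, V i ω)) * ∏ i ∈ F₂, (A i).indicator 1 (V i ω) ∂P =
      ∫⁻ ω in S, (∏ i ∈ F₁, ∫⁻ v, Ψ i (Y ω, v) ∂κ (Y ω)) * ∏ i ∈ F₂, κ (Y ω) (A i) ∂P := by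
  classical
  have hYm : Measurable Y := hY.mono h𝓕 le_rfl
  choose C hC using hb
  have hint : ∀ i y, ∫⁻ v, Ψ i (y, v) ∂κ y ≤ C i := fun i y => by
    calc ∫⁻ v, Ψ i (y, v) ∂κ y ≤ ∫⁻ _, C i ∂κ y := lintegral_mono fun v => hC i _
      _ = C i := by simp
  induction F₁ using Finset.induction_on with
  | empty =>
    intro F₂ _ A hA S hS
    have := hV F₂ A hA S hS
    simp only [Finset.prod_empty, one_mul]
    simp only [hq] at this
    rw [← this, Set.inter_comm, ← Measure.restrict_apply, ← lintegral_indicator_one]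
    · congr with ω
      by_cases h : ∀ i ∈ F₂, V i ω ∈ A i
      · rw [Set.indicator_of_mem (by simpa using h)]
        exact Finset.prod_eq_one fun i hi => by simp [h i hi]
      · rw [Set.indicator_of_notMem (by simpa using h)]
        push Not at h
        obtain ⟨i, hi, hiA⟩ := h
        exact Finset.prod_eq_zero hi (by simp [hiA])
    all_goals exact Finset.measurableSet_biInter _ fun i _ => hVm i (hA i)
  | insert j F hj ih =>
    intro F₂ hd A hA S hS
    have hdF : Disjoint F F₂ := hd.mono_left (Finset.subset_insert _ _)
    have hjF₂ : j ∉ F₂ := Finset.disjoint_left.1 hd (Finset.mem_insert_self _ _)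
    set R : Ω → ℝ≥0∞ := fun ω =>
      (∏ i ∈ F, Ψ i (Y ω, V i ω)) * ∏ i ∈ F₂, (A i).indicator 1 (V i ω)
    set Q : Ω → ℝ≥0∞ := fun ω =>
      (∏ i ∈ F, ∫⁻ v, Ψ i (Y ω, v) ∂κ (Y ω)) * ∏ i ∈ F₂, κ (Y ω) (A i)
    have hRm : Measurable R := by
      refine (Finset.measurable_prod _ fun i _ => (hΨ i).comp (hYm.prodMk (hVm i))).mul
        (Finset.measurable_prod _ fun i _ => ?_)
      exact (measurable_one.indicator (hA i)).comp (hVm i)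
    have hQm : Measurable Q := by
      refine (Finset.measurable_prod _ fun i _ => ?_).mul
        (Finset.measurable_prod _ fun i _ => (κ.measurable_coe (hA i)).comp hYm)
      exact ((hΨ i).lintegral_kernel_prod_right' (κ := κ)).comp hYm
    have hRb : ∀ ω, R ω ≤ ∏ i ∈ F, (C i : ℝ≥0∞) := fun ω => by
      calc R ω ≤ (∏ i ∈ F, (C i : ℝ≥0∞)) * 1 := by
            refine mul_le_mul' (Finset.prod_le_prod' fun i _ => hC i _)
              (Finset.prod_le_one' fun i _ => Set.indicator_le_self' (by simp) _)
        _ = _ := mul_one _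
    have hCtop : ∏ i ∈ F, (C i : ℝ≥0∞) ≠ ⊤ := by
      exact_mod_cast ENNReal.coe_ne_top (r := ∏ i ∈ F, C i)
    have : IsFiniteMeasure ((P.restrict S).withDensity R) := by
      refine isFiniteMeasure_withDensity (ne_top_of_le_ne_top ?_ (lintegral_mono hRb))
      simpa using ENNReal.mul_ne_top hCtop (measure_ne_top _ _)
    have : IsFiniteMeasure (((P.restrict S).withDensity R).map fun ω => (Y ω, V j ω)) :=
      Measure.isFiniteMeasure_map _ _
    -- Both sides are determined on rectangles `B ×ˢ D`, the left one being finite. A rectangle is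
    -- the induction hypothesis with `V j ∈ D` as one more indicator and `Y ⁻¹' B ∩ S` in place of
    -- `S`.
    have key : ((P.restrict S).withDensity R).map (fun ω => (Y ω, V j ω)) =
        (((P.restrict S).withDensity Q).map Y) ⊗ₘ κ := by
      refine Measure.ext_prod fun {B D} hB hD => ?_
      have h𝓕B : MeasurableSet[𝓕] (Y ⁻¹' B) := hY hB
      have hκm : Measurable fun ω => κ (Y ω) D := (κ.measurable_coe hD).comp hYm
      rw [Measure.map_apply (hYm.prodMk (hVm j)) (hB.prod hD),
        Measure.compProd_apply_prod hB hD, setLIntegral_map hB (κ.measurable_coe hD) hYm,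
        withDensity_apply _ ((hYm.prodMk (hVm j)) (hB.prod hD)),
        setLIntegral_withDensity_eq_setLIntegral_mul _ hQm hκm
          (hYm hB), Measure.restrict_restrict (hYm hB)]
      have := ih (insert j F₂) (by
        rw [Finset.disjoint_insert_right]; exact ⟨hj, hdF⟩)
        (fun i => if i = j then D else A i) (fun i => by split_ifs <;> simp [*])
        (Y ⁻¹' B ∩ S) (MeasurableSet.inter h𝓕B hS)
      have e1 : ∀ f : Set E → ι → ℝ≥0∞, ∏ i ∈ F₂, f (if i = j then D else A i) i =
          ∏ i ∈ F₂, f (A i) i := fun f => Finset.prod_congr rfl fun i hi => by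
        rw [if_neg]; rintro rfl; exact hjF₂ hi
      simp only [Finset.prod_insert hjF₂, if_true] at this
      have e2 := fun ω => e1 fun D i => D.indicator 1 (V i ω)
      have e3 := fun ω => e1 fun D _ => κ (Y ω) D
      simp only [e2, e3] at this
      rw [show (fun ω => (Y ω, V j ω)) ⁻¹' B ×ˢ D = V j ⁻¹' D ∩ Y ⁻¹' B by
        ext; simp [and_comm], ← Measure.restrict_restrict (hVm j hD),
        ← lintegral_indicator (hVm j hD), Measure.restrict_restrict (hYm hB)]
      convert this using 2
      · ext ω
        by_cases h : V j ω ∈ D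
        · simp [R, h]
        · simp [R, h]
      · ext ω
        simp only [Pi.mul_apply, Q]
        ring
    have h1 : ∫⁻ z, Ψ j z ∂(((P.restrict S).withDensity R).map fun ω => (Y ω, V j ω)) =
        ∫⁻ z, Ψ j z ∂((((P.restrict S).withDensity Q).map Y) ⊗ₘ κ) := by rw [key]
    have hΨV : Measurable fun ω => Ψ j (Y ω, V j ω) := (hΨ j).comp (hYm.prodMk (hVm j))
    have hΨκ : Measurable fun y => ∫⁻ v, Ψ j (y, v) ∂κ y :=
      (hΨ j).lintegral_kernel_prod_right' (κ := κ)
    have hΨκY : Measurable fun ω => ∫⁻ v, Ψ j (Y ω, v) ∂κ (Y ω) := hΨκ.comp hYm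
    rw [lintegral_map (hΨ j) (hYm.prodMk (hVm j)),
      lintegral_withDensity_eq_lintegral_mul _ hRm hΨV, Measure.lintegral_compProd (hΨ j),
      lintegral_map hΨκ hYm, lintegral_withDensity_eq_lintegral_mul _ hQm hΨκY] at h1
    simp only [Finset.prod_insert hj]
    convert h1 using 2 <;> · ext ω; simp only [Pi.mul_apply, R, Q]; ring

/-- Truncation at level `n` reduces to the bounded case; monotone convergence removes the
truncation, on both sides and inside the finite products. -/
theorem CondIID.setLIntegral_prod [IsFiniteMeasure P] [IsMarkovKernel κ]
    (hV : CondIID P 𝓕 V q) (h𝓕 : 𝓕 ≤ mΩ) (hVm : ∀ i, Measurable (V i))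
    (hY : Measurable[𝓕] Y) (hq : ∀ ω, q ω = κ (Y ω)) {Ψ : ι → 𝒴 × E → ℝ≥0∞}
    (hΨ : ∀ i, Measurable (Ψ i)) (F : Finset ι) {S : Set Ω} (hS : MeasurableSet[𝓕] S) :
    ∫⁻ ω in S, ∏ i ∈ F, Ψ i (Y ω, V i ω) ∂P =
      ∫⁻ ω in S, ∏ i ∈ F, ∫⁻ v, Ψ i (Y ω, v) ∂κ (Y ω) ∂P := by
  have hYm : Measurable Y := hY.mono h𝓕 le_rfl
  set Φ : ℕ → ι → 𝒴 × E → ℝ≥0∞ := fun n i z => min (Ψ i z) n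
  have hΦ : ∀ n i, Measurable (Φ n i) := fun n i => (hΨ i).min measurable_const
  have hmono : ∀ i z, Monotone fun n => Φ n i z := fun i z m n h =>
    min_le_min le_rfl (by exact_mod_cast h)
  have hsup : ∀ i z, ⨆ n, Φ n i z = Ψ i z := fun i z => by
    refine le_antisymm (iSup_le fun n => min_le_left _ _) ?_
    rcases eq_or_ne (Ψ i z) ⊤ with h | h
    · simp only [Φ, h, le_top, inf_of_le_right, ENNReal.iSup_natCast]
    · obtain ⟨n, hn⟩ := ENNReal.exists_nat_gt h
      exact le_iSup_of_le n (le_min le_rfl hn.le)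
  have hint : ∀ i ω, ∫⁻ v, Ψ i (Y ω, v) ∂κ (Y ω) = ⨆ n, ∫⁻ v, Φ n i (Y ω, v) ∂κ (Y ω) :=
    fun i ω => by
      have hm : ∀ n, Measurable fun v => Φ n i (Y ω, v) :=
        fun n => (hΦ n i).comp measurable_prodMk_left
      rw [← lintegral_iSup hm fun m n h v => hmono i _ h]
      simp only [hsup]
  have hmono' : ∀ i ω, Monotone fun n => ∫⁻ v, Φ n i (Y ω, v) ∂κ (Y ω) :=
    fun i ω m n h => lintegral_mono fun v => hmono i _ h
  simp only [hint]
  simp only [← hsup]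
  simp only [ennreal_prod_iSup_of_monotone _ _ fun i => hmono i _,
    ennreal_prod_iSup_of_monotone _ _ fun i => hmono' i _]
  rw [lintegral_iSup, lintegral_iSup]
  · refine iSup_congr fun n => ?_
    simpa using hV.setLIntegral_mul_prod h𝓕 hVm hY hq (hΦ n)
      (fun i => ⟨n, fun z => by simp [Φ]⟩) F ∅ (by simp) (fun _ => ∅) (by simp) S hS
  · exact fun n => Finset.measurable_prod _ fun i _ =>
      ((hΦ n i).lintegral_kernel_prod_right' (κ := κ)).comp hYm
  · exact fun m n h ω => Finset.prod_le_prod' fun i _ => hmono' i ω h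
  · exact fun n => Finset.measurable_prod _ fun i _ => (hΦ n i).comp (hYm.prodMk (hVm i))
  · exact fun m n h ω => Finset.prod_le_prod' fun i _ => hmono i _ h

end CondIID

/-! ### Convergence in probability along a filter -/

section TIP

variable {Ω ι E E' E'' : Type*} [MeasurableSpace Ω] [TopologicalSpace E] [TopologicalSpace E']
  [TopologicalSpace E'']

/-- Convergence in probability to a constant along a filter. -/
def TIP (P : Measure Ω) (l : Filter ι) (Z : ι → Ω → E) (a : E) : Prop :=
  ∀ U ∈ 𝓝 a, Tendsto (fun i => P {ω | Z i ω ∉ U}) l (𝓝 0)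

variable {P : Measure Ω} {l : Filter ι}

theorem TIP.const (a : E) : TIP P l (fun _ _ => a) a := fun _ hU => by
  simpa [mem_of_mem_nhds hU] using tendsto_const_nhds

theorem TIP.prodMk {Z : ι → Ω → E} {W : ι → Ω → E'} {a : E} {b : E'} (hZ : TIP P l Z a)
    (hW : TIP P l W b) : TIP P l (fun i ω => (Z i ω, W i ω)) (a, b) := by
  intro U hU
  obtain ⟨A, hA, B, hB, hAB⟩ := mem_nhds_prod_iff.1 hU
  have := (hZ A hA).add (hW B hB)
  rw [add_zero] at this
  refine tendsto_of_tendsto_of_tendsto_of_le_of_le tendsto_const_nhds this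
    (fun _ => zero_le) fun i => le_trans (measure_mono fun ω hω => ?_) (measure_union_le _ _)
  by_contra hc
  simp only [Set.mem_union, Set.mem_ofPred_eq, not_or, not_not] at hc
  exact hω (hAB ⟨hc.1, hc.2⟩)

theorem TIP.map {Z : ι → Ω → E} {a : E} (hZ : TIP P l Z a) {f : E → E'} (hf : ContinuousAt f a) :
    TIP P l (fun i ω => f (Z i ω)) (f a) := fun U hU => hZ _ (hf hU)

theorem TIP.map₂ {Z : ι → Ω → E} {W : ι → Ω → E'} {a : E} {b : E'} (hZ : TIP P l Z a)
    (hW : TIP P l W b) {f : E → E' → E''} (hf : ContinuousAt (fun z : E × E' => f z.1 z.2) (a, b)) :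
    TIP P l (fun i ω => f (Z i ω) (W i ω)) (f a b) :=
  (hZ.prodMk hW).map (f := fun z : E × E' => f z.1 z.2) hf

theorem TIP.congr_off {Z W : ι → Ω → E} {a : E} (hZ : TIP P l Z a)
    (h : Tendsto (fun i => P {ω | W i ω ≠ Z i ω}) l (𝓝 0)) : TIP P l W a := by
  intro U hU
  have := (hZ U hU).add h
  rw [add_zero] at this
  refine tendsto_of_tendsto_of_tendsto_of_le_of_le tendsto_const_nhds this
    (fun _ => zero_le) fun i => le_trans (measure_mono fun ω hω => ?_) (measure_union_le _ _)
  by_contra hc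
  simp only [Set.mem_union, Set.mem_ofPred_eq, not_or, not_not, ne_eq] at hc
  exact hω (by simpa [hc.2] using hc.1)

theorem TIP.congr_ae {Z W : ι → Ω → E} {a : E} (hZ : TIP P l Z a)
    (h : ∀ᶠ i in l, W i =ᵐ[P] Z i) : TIP P l W a :=
  hZ.congr_off (tendsto_const_nhds.congr' (h.mono fun _ hi => (ae_iff.1 hi).symm))

theorem TIP.comp {ι' : Type*} {l' : Filter ι'} {Z : ι → Ω → E} {a : E} (hZ : TIP P l Z a)
    {u : ι' → ι} (hu : Tendsto u l' l) : TIP P l' (fun i => Z (u i)) a :=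
  fun U hU => (hZ U hU).comp hu

/-- Iterated limits as a single filter: first `n → ∞` with `k` fixed, then `k → ∞`. No uniformity in
`k` is needed. -/
theorem TIP.curry {Z : ℕ × ℕ → Ω → E} {r : ℕ → E} {a : E}
    (h : ∀ k, TIP P atTop (fun n => Z (k, n)) (r k)) (hr : Tendsto r atTop (𝓝 a)) :
    TIP P (atTop.curry atTop) Z a := by
  intro U hU
  obtain ⟨O, hOU, hO, haO⟩ := mem_nhds_iff.1 hU
  rw [ENNReal.tendsto_nhds_zero]
  intro ε hε
  rw [eventually_curry_iff]
  filter_upwards [hr (hO.mem_nhds haO)] with k hk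
  filter_upwards [(ENNReal.tendsto_nhds_zero.1 (h k O (hO.mem_nhds hk))) ε hε] with n hn
  exact le_trans (measure_mono fun ω hω hωO => hω (hOU hωO)) hn

theorem tip_zero_iff {Z : ι → Ω → ℝ≥0∞} :
    TIP P l Z 0 ↔ ∀ ε : ℝ≥0∞, 0 < ε → Tendsto (fun i => P {ω | ε ≤ Z i ω}) l (𝓝 0) := by
  constructor
  · intro h ε hε
    simpa using h _ (Iio_mem_nhds hε)
  · intro h U hU
    obtain ⟨ε, hε, hεU⟩ := ENNReal.nhds_zero_basis.mem_iff.1 hU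
    refine tendsto_of_tendsto_of_tendsto_of_le_of_le tendsto_const_nhds (h ε hε)
      (fun _ => zero_le) fun i => measure_mono fun ω hω => ?_
    exact not_lt.1 fun h => hω (hεU (Set.mem_Iio.2 h))

theorem TIP.zero_of_le {Z W : ι → Ω → ℝ≥0∞} (hZ : TIP P l Z 0)
    (h : ∀ᶠ i in l, ∀ᵐ ω ∂P, W i ω ≤ Z i ω) : TIP P l W 0 := by
  rw [tip_zero_iff] at *
  intro ε hε
  refine tendsto_of_tendsto_of_tendsto_of_le_of_le' tendsto_const_nhds (hZ ε hε)
    (Eventually.of_forall fun _ => zero_le) (h.mono fun i hi => measure_mono_ae ?_)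
  filter_upwards [hi] with ω hω h
  exact le_trans h hω

theorem TIP.of_lintegral {Z : ι → Ω → ℝ≥0∞} (hm : ∀ᶠ i in l, AEMeasurable (Z i) P)
    (h : Tendsto (fun i => ∫⁻ ω, Z i ω ∂P) l (𝓝 0)) : TIP P l Z 0 := by
  rw [tip_zero_iff]
  intro ε hε
  rcases eq_or_ne ε ⊤ with rfl | hε'
  · refine tendsto_of_tendsto_of_tendsto_of_le_of_le' tendsto_const_nhds h
      (Eventually.of_forall fun _ => zero_le) (hm.mono fun i hi => ?_)
    refine (measure_mono fun ω hω => ?_).trans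
      ((meas_ge_le_lintegral_div hi one_ne_zero ENNReal.one_ne_top).trans_eq (by simp))
    exact le_trans (b := ⊤) le_top (Set.mem_ofPred.1 hω)
  · have h' : Tendsto (fun i => (∫⁻ ω, Z i ω ∂P) / ε) l (𝓝 0) := by
      simpa using ENNReal.Tendsto.div_const h (Or.inr hε.ne')
    exact tendsto_of_tendsto_of_tendsto_of_le_of_le' tendsto_const_nhds h'
      (Eventually.of_forall fun _ => zero_le)
      (hm.mono fun i hi => meas_ge_le_lintegral_div hi hε.ne' hε')

/-- Bounded convergence: the integrand is below `ε / 2` off an event whose probability tends to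
zero, and below `C` on it. -/
theorem TIP.tendsto_lintegral [IsProbabilityMeasure P] {Z : ι → Ω → ℝ≥0∞}
    (hm : ∀ i, Measurable (Z i)) {C : ℝ≥0} (hC : ∀ i ω, Z i ω ≤ C) (h : TIP P l Z 0) :
    Tendsto (fun i => ∫⁻ ω, Z i ω ∂P) l (𝓝 0) := by
  rw [tip_zero_iff] at h
  rw [ENNReal.tendsto_nhds_zero]
  intro ε hε
  have hε2 : 0 < ε / 2 := ENNReal.half_pos hε.ne'
  have h1 : Tendsto (fun i => C * P {ω | ε / 2 ≤ Z i ω}) l (𝓝 0) := by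
    simpa using ENNReal.Tendsto.const_mul (h _ hε2) (Or.inr ENNReal.coe_ne_top)
  filter_upwards [ENNReal.tendsto_nhds_zero.1 h1 _ hε2] with i hi
  have hms : MeasurableSet {ω | ε / 2 ≤ Z i ω} := measurableSet_le measurable_const (hm i)
  calc ∫⁻ ω, Z i ω ∂P ≤ ∫⁻ ω, ε / 2 + {ω | ε / 2 ≤ Z i ω}.indicator (fun _ => (C : ℝ≥0∞)) ω ∂P := by
        refine lintegral_mono fun ω => ?_
        by_cases h : ε / 2 ≤ Z i ω
        · rw [Set.indicator_of_mem (by exact h)]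
          exact (hC i ω).trans le_add_self
        · exact (not_le.1 h).le.trans le_self_add
    _ = ε / 2 + C * P {ω | ε / 2 ≤ Z i ω} := by
        rw [lintegral_add_left measurable_const, lintegral_indicator hms]
        simp
    _ ≤ ε / 2 + ε / 2 := by gcongr
    _ = ε := ENNReal.add_halves ε

/-- The two inequalities stand for `|Z - a| ≤ D`, avoiding truncated subtraction. -/
theorem TIP.of_le_add {Z D : ι → Ω → ℝ≥0∞} {a : ℝ≥0∞} (ha : a ≠ ⊤) (hD : TIP P l D 0)
    (h₁ : ∀ i ω, Z i ω ≤ a + D i ω) (h₂ : ∀ i ω, a ≤ Z i ω + D i ω) : TIP P l Z a := by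
  intro U hU
  obtain ⟨ε, hε, hεU⟩ := (ENNReal.hasBasis_nhds_of_ne_top' ha).mem_iff.1 hU
  refine tendsto_of_tendsto_of_tendsto_of_le_of_le tendsto_const_nhds
    (tip_zero_iff.1 hD ε (pos_iff_ne_zero.2 hε)) (fun _ => zero_le) fun i => measure_mono fun ω hω => ?_
  by_contra hc
  have hc' : D i ω < ε := not_le.1 hc
  refine hω (hεU ⟨?_, ?_⟩)
  · exact tsub_le_iff_right.2 ((h₂ i ω).trans (by gcongr))
  · exact (h₁ i ω).trans (by gcongr)

/-- For a family that ignores the outer index, the outer "eventually" is about a constant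
proposition. -/
theorem TIP.of_curry {Z : ℕ → Ω → E} {a : E}
    (h : TIP P (atTop.curry atTop) (fun p : ℕ × ℕ => Z p.2) a) : TIP P atTop Z a := by
  intro U hU
  rw [ENNReal.tendsto_nhds_zero]
  intro ε hε
  exact eventually_const.1
    (eventually_curry_iff.1 (ENNReal.tendsto_nhds_zero.1 (h U hU) ε hε))

theorem TIP.top_of_le {Z W : ι → Ω → ℝ≥0∞} (hZ : TIP P l Z ⊤)
    (h : ∀ i ω, Z i ω ≤ W i ω) : TIP P l W ⊤ := by
  intro U hU
  obtain ⟨c, hc, hcU⟩ := ENNReal.nhds_top_basis.mem_iff.1 hU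
  refine tendsto_of_tendsto_of_tendsto_of_le_of_le tendsto_const_nhds
    (hZ _ (Ioi_mem_nhds hc)) (fun _ => zero_le) fun i => measure_mono fun ω hω hlt => ?_
  exact hω (hcU (lt_of_lt_of_le (Set.mem_Ioi.1 hlt) (h i ω)))

theorem TIP.sum {Z : ℕ → ι → Ω → ℝ≥0∞} {a : ℕ → ℝ≥0∞}
    (h : ∀ k, TIP P l (Z k) (a k)) (m : ℕ) :
    TIP P l (fun i ω => ∑ k ∈ Finset.range m, Z k i ω) (∑ k ∈ Finset.range m, a k) := by
  induction m with
  | zero => simpa using TIP.const 0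
  | succ m ih =>
    simp only [Finset.sum_range_succ]
    exact ih.map₂ (h m) (f := fun y z => y + z) continuous_add.continuousAt

end TIP

/-- The average of finitely many quantities. -/
def avg {N : ℕ} (a : Fin N → ℝ≥0∞) : ℝ≥0∞ := (N : ℝ≥0∞)⁻¹ * ∑ i, a i

theorem avg_const {N : ℕ} (hN : 0 < N) (a : ℝ≥0∞) : avg (fun _ : Fin N => a) = a := by
  have : (N : ℝ≥0∞) ≠ 0 := by exact_mod_cast hN.ne'
  simp [avg, ← mul_assoc, ENNReal.inv_mul_cancel this (ENNReal.natCast_ne_top N)]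

/-- Given `𝓖`, the variables `X ℓ` have conditional means `M ℓ`. -/
structure CondMean {Ω : Type*} (𝓖 : MeasurableSpace Ω) {mΩ : MeasurableSpace Ω} (P : Measure Ω)
    {N : ℕ} (X M : Fin N → Ω → ℝ≥0∞) : Prop where
  measurable_left : ∀ ℓ, Measurable (X ℓ)
  measurable_right : ∀ ℓ, Measurable[𝓖] (M ℓ)
  setLIntegral : ∀ ℓ S, MeasurableSet[𝓖] S → ∫⁻ ω in S, X ℓ ω ∂P = ∫⁻ ω in S, M ℓ ω ∂P

/-- The variables `X ℓ` are bounded and pairwise conditionally uncorrelated. -/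
structure BddUncorr {Ω : Type*} {mΩ : MeasurableSpace Ω} (P : Measure Ω)
    {N : ℕ} (C : ℝ≥0) (X M : Fin N → Ω → ℝ≥0∞) : Prop where
  left_le : ∀ ℓ, ∀ᵐ ω ∂P, X ℓ ω ≤ C
  right_le : ∀ ℓ, ∀ᵐ ω ∂P, M ℓ ω ≤ C
  lintegral_mul : ∀ ℓ ℓ', ℓ ≠ ℓ' → ∫⁻ ω, X ℓ ω * X ℓ' ω ∂P = ∫⁻ ω, M ℓ ω * M ℓ' ω ∂P

/-! ### Weak laws of large numbers from conditional means -/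

section Transfer

variable {Ω : Type*} {𝓖 : MeasurableSpace Ω} {mΩ : MeasurableSpace Ω} {P : Measure Ω} {N : ℕ}
  {X M : Fin N → Ω → ℝ≥0∞}

/-- The measures with densities `X ℓ` and `M ℓ` agree on `𝓖`, hence give the same integral to every
`𝓖`-measurable function. -/
theorem CondMean.lintegral_mul (h : CondMean 𝓖 P X M) (h𝓖 : 𝓖 ≤ mΩ) (ℓ : Fin N) {Z : Ω → ℝ≥0∞}
    (hZ : Measurable[𝓖] Z) : ∫⁻ ω, Z ω * X ℓ ω ∂P = ∫⁻ ω, Z ω * M ℓ ω ∂P := by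
  have hM : Measurable (M ℓ) := (h.measurable_right ℓ).mono h𝓖 le_rfl
  have key : (P.withDensity (X ℓ)).trim h𝓖 = (P.withDensity (M ℓ)).trim h𝓖 := by
    refine @Measure.ext _ 𝓖 _ _ fun S hS => ?_
    rw [trim_measurableSet_eq h𝓖 hS, trim_measurableSet_eq h𝓖 hS, withDensity_apply _ (h𝓖 _ hS),
      withDensity_apply _ (h𝓖 _ hS), h.setLIntegral ℓ S hS]
  have hZ' : Measurable Z := hZ.mono h𝓖 le_rfl
  have := congrArg (fun μ => @lintegral Ω 𝓖 μ Z) key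
  simp only [lintegral_trim h𝓖 hZ] at this
  rw [lintegral_withDensity_eq_lintegral_mul _ (h.measurable_left ℓ) hZ',
    lintegral_withDensity_eq_lintegral_mul _ hM hZ'] at this
  simpa [mul_comm] using this

theorem CondMean.setLIntegral_avg (h : CondMean 𝓖 P X M) (h𝓖 : 𝓖 ≤ mΩ) {S : Set Ω}
    (hS : MeasurableSet[𝓖] S) :
    ∫⁻ ω in S, avg (fun ℓ => X ℓ ω) ∂P = ∫⁻ ω in S, avg (fun ℓ => M ℓ ω) ∂P := by
  have hM : ∀ ℓ, Measurable (M ℓ) := fun ℓ => (h.measurable_right ℓ).mono h𝓖 le_rfl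
  simp only [avg]
  rw [lintegral_const_mul _ (Finset.measurable_sum _ fun i _ => h.measurable_left i),
    lintegral_const_mul _ (Finset.measurable_sum _ fun i _ => hM i),
    lintegral_finsetSum _ fun i _ => h.measurable_left i,
    lintegral_finsetSum _ fun i _ => hM i]
  simp only [h.setLIntegral _ S hS]

/-- Off-diagonal terms vanish: `E[X X'] = E[M M']` is assumed, and `E[M X'] = E[M M']` because `M`
is `𝓖`-measurable. Each of the `N` diagonal terms is at most `C ^ 2`. -/
theorem CondMean.integral_sq_le [IsProbabilityMeasure P] (h : CondMean 𝓖 P X M) (h𝓖 : 𝓖 ≤ mΩ)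
    {C : ℝ≥0} (hb : BddUncorr P C X M) :
    ∫ ω, (∑ ℓ, ((X ℓ ω).toReal - (M ℓ ω).toReal)) ^ 2 ∂P ≤ N * (C : ℝ) ^ 2 := by
  have hM : ∀ ℓ, Measurable (M ℓ) := fun ℓ => (h.measurable_right ℓ).mono h𝓖 le_rfl
  have hX := h.measurable_left
  set x : Fin N → Ω → ℝ := fun ℓ ω => (X ℓ ω).toReal
  set m : Fin N → Ω → ℝ := fun ℓ ω => (M ℓ ω).toReal
  have hxm : ∀ ℓ, Measurable (x ℓ) := fun ℓ => (hX ℓ).ennreal_toReal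
  have hmm : ∀ ℓ, Measurable (m ℓ) := fun ℓ => (hM ℓ).ennreal_toReal
  have toR : ∀ a : ℝ≥0∞, a ≤ C → a.toReal ∈ Set.Icc (0 : ℝ) C := fun a ha =>
    ⟨ENNReal.toReal_nonneg, ENNReal.toReal_le_coe_of_le_coe ha⟩
  have hxC : ∀ ℓ, ∀ᵐ ω ∂P, x ℓ ω ∈ Set.Icc (0 : ℝ) C := fun ℓ =>
    (hb.left_le ℓ).mono fun ω hω => toR _ hω
  have hmC : ∀ ℓ, ∀ᵐ ω ∂P, m ℓ ω ∈ Set.Icc (0 : ℝ) C := fun ℓ =>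
    (hb.right_le ℓ).mono fun ω hω => toR _ hω
  have mul_int : ∀ u v : Ω → ℝ, Measurable u → Measurable v → (∀ᵐ ω ∂P, u ω ∈ Set.Icc (0 : ℝ) C) →
      (∀ᵐ ω ∂P, v ω ∈ Set.Icc (0 : ℝ) C) → Integrable (fun ω => u ω * v ω) P := by
    intro u v hu hv hu' hv'
    refine Integrable.of_bound (hu.mul hv).aestronglyMeasurable ((C : ℝ) * C) ?_
    filter_upwards [hu', hv'] with ω h1 h2
    rw [Real.norm_eq_abs, abs_of_nonneg (mul_nonneg h1.1 h2.1)]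
    exact mul_le_mul h1.2 h2.2 h2.1 C.2
  have toI : ∀ U W U' W' : Ω → ℝ≥0∞, Measurable U → Measurable W → Measurable U' → Measurable W' →
      (∀ᵐ ω ∂P, U ω ≤ C) → (∀ᵐ ω ∂P, W ω ≤ C) → (∀ᵐ ω ∂P, U' ω ≤ C) → (∀ᵐ ω ∂P, W' ω ≤ C) →
      ∫⁻ ω, U ω * W ω ∂P = ∫⁻ ω, U' ω * W' ω ∂P →
      ∫ ω, (U ω).toReal * (W ω).toReal ∂P = ∫ ω, (U' ω).toReal * (W' ω).toReal ∂P := by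
    intro U W U' W' hU hW hU' hW' bU bW bU' bW' e
    simp only [← ENNReal.toReal_mul]
    rw [integral_toReal (f := fun ω => U ω * W ω) (hU.mul hW).aemeasurable,
      integral_toReal (f := fun ω => U' ω * W' ω) (hU'.mul hW').aemeasurable, e]
    · filter_upwards [bU', bW'] with ω h1 h2
      exact ENNReal.mul_lt_top (h1.trans_lt ENNReal.coe_lt_top) (h2.trans_lt ENNReal.coe_lt_top)
    · filter_upwards [bU, bW] with ω h1 h2
      exact ENNReal.mul_lt_top (h1.trans_lt ENNReal.coe_lt_top) (h2.trans_lt ENNReal.coe_lt_top)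
  have hoff : ∀ ℓ ℓ', ℓ ≠ ℓ' → ∫ ω, (x ℓ ω - m ℓ ω) * (x ℓ' ω - m ℓ' ω) ∂P = 0 := by
    intro ℓ ℓ' hne
    have e1 : ∫ ω, x ℓ ω * x ℓ' ω ∂P = ∫ ω, m ℓ ω * m ℓ' ω ∂P :=
      toI _ _ _ _ (hX _) (hX _) (hM _) (hM _) (hb.left_le _) (hb.left_le _) (hb.right_le _)
        (hb.right_le _) (hb.lintegral_mul ℓ ℓ' hne)
    have e2 : ∫ ω, m ℓ ω * x ℓ' ω ∂P = ∫ ω, m ℓ ω * m ℓ' ω ∂P :=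
      toI _ _ _ _ (hM _) (hX _) (hM _) (hM _) (hb.right_le _) (hb.left_le _) (hb.right_le _)
        (hb.right_le _) (h.lintegral_mul h𝓖 ℓ' (h.measurable_right ℓ))
    have e3 : ∫ ω, m ℓ' ω * x ℓ ω ∂P = ∫ ω, m ℓ' ω * m ℓ ω ∂P :=
      toI _ _ _ _ (hM _) (hX _) (hM _) (hM _) (hb.right_le _) (hb.left_le _) (hb.right_le _)
        (hb.right_le _) (h.lintegral_mul h𝓖 ℓ (h.measurable_right ℓ'))
    have i1 := mul_int _ _ (hxm ℓ) (hxm ℓ') (hxC _) (hxC _)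
    have i2 := mul_int _ _ (hmm ℓ) (hxm ℓ') (hmC _) (hxC _)
    have i3 := mul_int _ _ (hmm ℓ') (hxm ℓ) (hmC _) (hxC _)
    have i4 := mul_int _ _ (hmm ℓ) (hmm ℓ') (hmC _) (hmC _)
    calc ∫ ω, (x ℓ ω - m ℓ ω) * (x ℓ' ω - m ℓ' ω) ∂P
        = ∫ ω, ((x ℓ ω * x ℓ' ω - m ℓ ω * x ℓ' ω) - m ℓ' ω * x ℓ ω) + m ℓ ω * m ℓ' ω ∂P := by
          congr with ω; ring
      _ = 0 := by
          have i12 : Integrable (fun ω => x ℓ ω * x ℓ' ω - m ℓ ω * x ℓ' ω) P := i1.sub i2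
          have i123 : Integrable (fun ω => x ℓ ω * x ℓ' ω - m ℓ ω * x ℓ' ω - m ℓ' ω * x ℓ ω) P :=
            i12.sub i3
          rw [integral_add i123 i4, integral_sub i12 i3, integral_sub i1 i2, e1, e2, e3]
          simp only [mul_comm (m ℓ' _)]
          ring
  have hint : ∀ ℓ ℓ', Integrable (fun ω => (x ℓ ω - m ℓ ω) * (x ℓ' ω - m ℓ' ω)) P := by
    intro ℓ ℓ'
    have : (fun ω => (x ℓ ω - m ℓ ω) * (x ℓ' ω - m ℓ' ω)) = fun ω =>
        ((x ℓ ω * x ℓ' ω - m ℓ ω * x ℓ' ω) - m ℓ' ω * x ℓ ω) + m ℓ ω * m ℓ' ω := by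
      ext ω; ring
    rw [this]
    exact (((mul_int _ _ (hxm ℓ) (hxm ℓ') (hxC _) (hxC _)).sub
      (mul_int _ _ (hmm ℓ) (hxm ℓ') (hmC _) (hxC _))).sub
      (mul_int _ _ (hmm ℓ') (hxm ℓ) (hmC _) (hxC _))).add
      (mul_int _ _ (hmm ℓ) (hmm ℓ') (hmC _) (hmC _))
  calc ∫ ω, (∑ ℓ, (x ℓ ω - m ℓ ω)) ^ 2 ∂P
      = ∑ ℓ, ∑ ℓ', ∫ ω, (x ℓ ω - m ℓ ω) * (x ℓ' ω - m ℓ' ω) ∂P := by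
        simp only [sq, Finset.sum_mul_sum]
        rw [integral_finsetSum _ fun ℓ _ => integrable_finsetSum _ fun ℓ' _ => hint ℓ ℓ']
        exact Finset.sum_congr rfl fun ℓ _ => integral_finsetSum _ fun ℓ' _ => hint ℓ ℓ'
    _ = ∑ ℓ, ∫ ω, (x ℓ ω - m ℓ ω) * (x ℓ ω - m ℓ ω) ∂P :=
        Finset.sum_congr rfl fun ℓ _ => Finset.sum_eq_single ℓ
          (fun ℓ' _ hne => hoff ℓ ℓ' hne.symm) (by simp)
    _ ≤ ∑ _ℓ : Fin N, (C : ℝ) ^ 2 := by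
        refine Finset.sum_le_sum fun ℓ _ => ?_
        calc ∫ ω, (x ℓ ω - m ℓ ω) * (x ℓ ω - m ℓ ω) ∂P ≤ ∫ _, (C : ℝ) ^ 2 ∂P := by
              refine integral_mono_ae (hint ℓ ℓ) (integrable_const _) ?_
              filter_upwards [hxC ℓ, hmC ℓ] with ω h1 h2
              have := h1.1; have := h1.2; have := h2.1; have := h2.2
              nlinarith
          _ = (C : ℝ) ^ 2 := by simp
    _ = N * (C : ℝ) ^ 2 := by simp

/-- Markov's inequality restricted to the `𝓖`-event on which the averaged conditional mean is at
most `c`. Neither boundedness nor independence is required. -/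
theorem CondMean.measure_le_avg_le (h : CondMean 𝓖 P X M) (h𝓖 : 𝓖 ≤ mΩ) [IsProbabilityMeasure P]
    {ε : ℝ≥0∞} (hε : ε ≠ 0) (hε' : ε ≠ ⊤) (c : ℝ≥0∞) :
    P {ω | ε ≤ avg fun ℓ => X ℓ ω} ≤ P {ω | ¬ (avg fun ℓ => M ℓ ω) ≤ c} + c / ε := by
  set S : Set Ω := {ω | (avg fun ℓ => M ℓ ω) ≤ c}
  have hS : MeasurableSet[𝓖] S := by
    refine measurableSet_le ?_ measurable_const
    exact (Finset.measurable_sum _ fun i _ => h.measurable_right i).const_mul _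
  have hXm : Measurable fun ω => avg fun ℓ => X ℓ ω :=
    (Finset.measurable_sum _ fun i _ => h.measurable_left i).const_mul _
  have hsub : {ω | ε ≤ avg fun ℓ => X ℓ ω} ⊆ Sᶜ ∪ ({ω | ε ≤ avg fun ℓ => X ℓ ω} ∩ S) := by
    intro ω hω
    by_cases hS : ω ∈ S
    · exact Or.inr ⟨hω, hS⟩
    · exact Or.inl hS
  refine (measure_mono hsub).trans ((measure_union_le _ _).trans (add_le_add le_rfl ?_))
  rw [← Measure.restrict_apply' (h𝓖 _ hS)]
  refine (meas_ge_le_lintegral_div hXm.aemeasurable hε hε').trans ?_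
  gcongr
  rw [h.setLIntegral_avg h𝓖 hS]
  calc ∫⁻ ω in S, avg (fun ℓ => M ℓ ω) ∂P ≤ ∫⁻ _ in S, c ∂P :=
        setLIntegral_mono measurable_const fun ω hω => hω
    _ ≤ c * 1 := by
        rw [setLIntegral_const]
        gcongr
        exact prob_le_one
    _ = c := mul_one c

/-- Chebyshev's inequality with the variance bound of `integral_sq_le`; the bound depends on `N` and
`C` only, so it applies to triangular arrays. -/
theorem CondMean.measure_le_abs_le (h : CondMean 𝓖 P X M) (h𝓖 : 𝓖 ≤ mΩ) [IsProbabilityMeasure P]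
    {C : ℝ≥0} (hb : BddUncorr P C X M) (hN : 0 < N) {ε : ℝ} (hε : 0 < ε) :
    P {ω | ε ≤ |(avg fun ℓ => X ℓ ω).toReal - (avg fun ℓ => M ℓ ω).toReal|} ≤
      ENNReal.ofReal ((C : ℝ) ^ 2 / ε ^ 2 / N) := by
  have hM : ∀ ℓ, Measurable (M ℓ) := fun ℓ => (h.measurable_right ℓ).mono h𝓖 le_rfl
  have hX := h.measurable_left
  have hN' : (0 : ℝ) < N := by exact_mod_cast hN
  set D : Ω → ℝ := fun ω => ∑ ℓ, ((X ℓ ω).toReal - (M ℓ ω).toReal)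
  have hDm : Measurable D := Finset.measurable_sum _ fun ℓ _ =>
    (hX ℓ).ennreal_toReal.sub (hM ℓ).ennreal_toReal
  have hall : ∀ᵐ ω ∂P, ∀ ℓ, X ℓ ω ≤ C ∧ M ℓ ω ≤ C :=
    ae_all_iff.2 fun ℓ => (hb.left_le ℓ).and (hb.right_le ℓ)
  have havg : ∀ a : Fin N → ℝ≥0∞, (∀ ℓ, a ℓ ≤ C) → (avg a).toReal = (N : ℝ)⁻¹ * ∑ ℓ, (a ℓ).toReal :=
    fun a ha => by
      rw [avg, ENNReal.toReal_mul, ENNReal.toReal_sum fun ℓ _ =>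
        ((ha ℓ).trans_lt ENNReal.coe_lt_top).ne]
      simp
  have hDint : Integrable (fun ω => D ω ^ 2) P := by
    refine Integrable.of_bound (hDm.pow_const 2).aestronglyMeasurable ((N * C : ℝ) ^ 2) ?_
    filter_upwards [hall] with ω hω
    rw [Real.norm_eq_abs, abs_of_nonneg (sq_nonneg _), ← sq_abs (D ω)]
    refine pow_le_pow_left₀ (abs_nonneg _) ?_ 2
    calc |D ω| ≤ ∑ ℓ, |(X ℓ ω).toReal - (M ℓ ω).toReal| := Finset.abs_sum_le_sum_abs _ _
      _ ≤ ∑ _ℓ : Fin N, (C : ℝ) := by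
          refine Finset.sum_le_sum fun ℓ _ => ?_
          have h1 := ENNReal.toReal_le_coe_of_le_coe (hω ℓ).1
          have h2 := ENNReal.toReal_le_coe_of_le_coe (hω ℓ).2
          have h3 : 0 ≤ (X ℓ ω).toReal := ENNReal.toReal_nonneg
          have h4 : 0 ≤ (M ℓ ω).toReal := ENNReal.toReal_nonneg
          rw [abs_le]
          constructor <;> linarith
      _ = N * C := by simp
  have hcheb := mul_meas_ge_le_integral_of_nonneg (ae_of_all P fun ω => sq_nonneg (D ω)) hDint
    ((ε * N) ^ 2)
  have hsq := h.integral_sq_le h𝓖 hb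
  have hreal : P.real {ω | (ε * N) ^ 2 ≤ D ω ^ 2} ≤ (C : ℝ) ^ 2 / ε ^ 2 / N := by
    have h0 : (ε * N) ^ 2 * P.real {ω | (ε * N) ^ 2 ≤ D ω ^ 2} ≤ N * (C : ℝ) ^ 2 := hcheb.trans hsq
    rw [div_div, le_div_iff₀ (by positivity)]
    have : N * (P.real {ω | (ε * N) ^ 2 ≤ D ω ^ 2} * (ε ^ 2 * N)) ≤ N * (C : ℝ) ^ 2 := by
      calc _ = (ε * N) ^ 2 * P.real {ω | (ε * N) ^ 2 ≤ D ω ^ 2} := by ring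
        _ ≤ _ := h0
    exact le_of_mul_le_mul_left this hN'
  calc P {ω | ε ≤ |(avg fun ℓ => X ℓ ω).toReal - (avg fun ℓ => M ℓ ω).toReal|}
      ≤ P {ω | (ε * N) ^ 2 ≤ D ω ^ 2} := by
        refine measure_mono_ae ?_
        filter_upwards [hall] with ω hω hle
        change ε ≤ |_| at hle
        rw [havg _ fun ℓ => (hω ℓ).1, havg _ fun ℓ => (hω ℓ).2, ← mul_sub,
          ← Finset.sum_sub_distrib, abs_mul, abs_of_pos (inv_pos.2 hN'),
          le_inv_mul_iff₀ hN', mul_comm] at hle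
        change (ε * N) ^ 2 ≤ D ω ^ 2
        rw [← sq_abs (D ω)]
        exact pow_le_pow_left₀ (by positivity) hle 2
    _ = ENNReal.ofReal (P.real {ω | (ε * N) ^ 2 ≤ D ω ^ 2}) := (ofReal_measureReal).symm
    _ ≤ _ := ENNReal.ofReal_le_ofReal hreal

end Transfer

/-- Convergence of averaged conditional means passes to the variables themselves. For limit zero,
Markov suffices and the variables may be unbounded; otherwise Chebyshev is used, under a common
bound and conditional uncorrelatedness. -/
theorem TIP.of_condMean {Ω ι : Type*} {mΩ : MeasurableSpace Ω} {P : Measure Ω}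
    [IsProbabilityMeasure P] {l : Filter ι} {n : ι → ℕ} (hn : Tendsto n l atTop)
    {𝓖 : ι → MeasurableSpace Ω} (h𝓖 : ∀ i, 𝓖 i ≤ mΩ) {X M : (i : ι) → Fin (n i) → Ω → ℝ≥0∞}
    {L : ℝ≥0∞} (hL : L ≠ ⊤) (h : ∀ᶠ i in l, CondMean (𝓖 i) P (X i) (M i))
    (hb : L = 0 ∨ ∃ C : ℝ≥0, ∀ᶠ i in l, BddUncorr P C (X i) (M i))
    (hM : TIP P l (fun i ω => avg fun ℓ => M i ℓ ω) L) :
    TIP P l (fun i ω => avg fun ℓ => X i ℓ ω) L := by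
  rcases hb with rfl | ⟨C, hb⟩
  · rw [tip_zero_iff]
    suffices H : ∀ ε : ℝ≥0∞, 0 < ε → ε ≠ ⊤ →
        Tendsto (fun i => P {ω | ε ≤ avg fun ℓ => X i ℓ ω}) l (𝓝 0) by
      intro ε hε
      refine tendsto_of_tendsto_of_tendsto_of_le_of_le tendsto_const_nhds
        (H (min ε 1) (lt_min hε one_pos) (ne_top_of_le_ne_top ENNReal.one_ne_top (min_le_right _ _)))
        (fun _ => zero_le) fun i => measure_mono fun ω hω =>
          Set.mem_ofPred.2 (le_trans (min_le_left _ _) (Set.mem_ofPred.1 hω))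
    intro ε hε hε'
    rw [ENNReal.tendsto_nhds_zero]
    intro δ hδ
    have hδ2 : 0 < δ / 2 := ENNReal.half_pos hδ.ne'
    -- With the threshold `c = ε * (δ / 2)` for the conditional means, the Markov term `c / ε` is `δ
    -- / 2`.
    have hc : 0 < ε * (δ / 2) := ENNReal.mul_pos hε.ne' hδ2.ne'
    filter_upwards [h, ENNReal.tendsto_nhds_zero.1 (hM _ (Iic_mem_nhds hc)) _ hδ2] with i hi hi2
    calc P {ω | ε ≤ avg fun ℓ => X i ℓ ω} ≤ _ :=
          hi.measure_le_avg_le (h𝓖 i) hε.ne' hε' (ε * (δ / 2))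
      _ ≤ δ / 2 + δ / 2 := by
          refine add_le_add hi2 (le_of_eq ?_)
          rw [ENNReal.mul_div_right_comm, ENNReal.div_self hε.ne' hε', one_mul]
      _ = δ := ENNReal.add_halves δ
  · have hdiff : TIP P l (fun i ω => (avg fun ℓ => X i ℓ ω).toReal -
        (avg fun ℓ => M i ℓ ω).toReal) (0 : ℝ) := by
      intro U hU
      obtain ⟨ε, hε, hεU⟩ := Metric.mem_nhds_iff.1 hU
      have hlim : Tendsto (fun i => ENNReal.ofReal ((C : ℝ) ^ 2 / ε ^ 2 / n i)) l (𝓝 0) := by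
        rw [← ENNReal.ofReal_zero]
        exact ENNReal.tendsto_ofReal ((tendsto_const_div_atTop_nhds_zero_nat _).comp hn)
      refine tendsto_of_tendsto_of_tendsto_of_le_of_le' tendsto_const_nhds hlim
        (Eventually.of_forall fun _ => zero_le) ?_
      filter_upwards [h, hb, hn.eventually_gt_atTop 0] with i h1 h2 h3
      refine (measure_mono fun ω hω => ?_).trans (h1.measure_le_abs_le (h𝓖 i) h2 h3 hε)
      refine Set.mem_ofPred.2 (not_lt.1 fun hlt => hω (hεU ?_))
      simpa [Real.dist_eq] using hlt
    -- The difference lives in `ℝ`; it is added back to the averaged means by a map that is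
    -- continuous at `(L, 0)` because `L` is finite.
    have hcont : ContinuousAt (fun z : ℝ≥0∞ × ℝ => ENNReal.ofReal (z.1.toReal + z.2)) (L, 0) := by
      have h1 : ContinuousAt (fun z : ℝ≥0∞ × ℝ => z.1.toReal) (L, 0) :=
        (ENNReal.tendsto_toReal hL).comp continuousAt_fst
      exact ENNReal.continuous_ofReal.continuousAt.comp (h1.add continuousAt_snd)
    have := hM.map₂ hdiff (f := fun a b => ENNReal.ofReal (a.toReal + b)) hcont
    simp only [add_zero, ENNReal.ofReal_toReal hL] at this
    refine this.congr_ae ?_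
    filter_upwards [hb, hn.eventually_gt_atTop 0] with i hi hni
    filter_upwards [ae_all_iff.2 hi.left_le] with ω hω
    have hne : (avg fun ℓ => X i ℓ ω) ≠ ⊤ := by
      refine ENNReal.mul_ne_top ?_ (ENNReal.sum_ne_top.2 fun ℓ _ =>
        ((hω ℓ).trans_lt ENNReal.coe_lt_top).ne)
      simpa using hni.ne'
    simp [ENNReal.ofReal_toReal hne]

section IIDMeans

variable {Ω E 𝒴 : Type*} {𝓕 : MeasurableSpace Ω} {mΩ : MeasurableSpace Ω} [MeasurableSpace E]
  [MeasurableSpace 𝒴] {P : Measure Ω} {N : ℕ} {V : Fin N → Ω → E} {q : Ω → Measure E}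
  {Y : Ω → 𝒴} {κ : Kernel 𝒴 E}

theorem CondIID.condMean [IsFiniteMeasure P] [IsMarkovKernel κ]
    (hV : CondIID P 𝓕 V q) (h𝓕 : 𝓕 ≤ mΩ) (hVm : ∀ i, Measurable (V i))
    (hY : Measurable[𝓕] Y) (hq : ∀ ω, q ω = κ (Y ω)) {Ψ : 𝒴 × E → ℝ≥0∞} (hΨ : Measurable Ψ) :
    CondMean 𝓕 P (fun j ω => Ψ (Y ω, V j ω)) (fun _ ω => ∫⁻ v, Ψ (Y ω, v) ∂κ (Y ω)) where
  measurable_left j := hΨ.comp ((hY.mono h𝓕 le_rfl).prodMk (hVm j))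
  measurable_right _ := (hΨ.lintegral_kernel_prod_right' (κ := κ)).comp hY
  setLIntegral j S hS := by
    simpa using hV.setLIntegral_prod h𝓕 hVm hY hq (fun _ => hΨ) {j} hS

theorem CondIID.bddUncorr [IsFiniteMeasure P] [IsMarkovKernel κ]
    (hV : CondIID P 𝓕 V q) (h𝓕 : 𝓕 ≤ mΩ) (hVm : ∀ i, Measurable (V i))
    (hY : Measurable[𝓕] Y) (hq : ∀ ω, q ω = κ (Y ω)) {Ψ : 𝒴 × E → ℝ≥0∞} (hΨ : Measurable Ψ)
    {C : ℝ≥0} (hC : ∀ z, Ψ z ≤ C) :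
    BddUncorr P C (fun j ω => Ψ (Y ω, V j ω)) (fun _ ω => ∫⁻ v, Ψ (Y ω, v) ∂κ (Y ω)) where
  left_le j := ae_of_all _ fun ω => hC _
  right_le _ := ae_of_all _ fun ω => by
    calc ∫⁻ v, Ψ (Y ω, v) ∂κ (Y ω) ≤ ∫⁻ _, C ∂κ (Y ω) := lintegral_mono fun v => hC _
      _ = C := by simp
  lintegral_mul j k hjk := by
    simpa [Finset.prod_pair hjk] using
      hV.setLIntegral_prod h𝓕 hVm hY hq (fun _ => hΨ) {j, k} (S := Set.univ) MeasurableSet.univ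

end IIDMeans

/-! ### Normalized weights and sampling kernels -/

section NormWeight

variable {N : ℕ}

theorem sum_normWeight (hN : 0 < N) (a : Fin N → ℝ≥0) : ∑ i, normWeight a i = 1 := by
  unfold normWeight
  split_ifs with h
  · simp [hN.ne']
  · rw [← Finset.sum_div, div_self h]

theorem sum_coe_normWeight (hN : 0 < N) (a : Fin N → ℝ≥0) :
    ∑ i, (normWeight a i : ℝ≥0∞) = 1 := by
  exact_mod_cast congrArg ((↑) : ℝ≥0 → ℝ≥0∞) (sum_normWeight hN a)

theorem measurable_normWeight (i : Fin N) : Measurable fun a : Fin N → ℝ≥0 => normWeight a i := by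
  unfold normWeight
  have h : Measurable fun a : Fin N → ℝ≥0 => ∑ j, a j :=
    Finset.measurable_sum _ fun j _ => measurable_pi_apply j
  exact Measurable.ite (h (measurableSet_singleton 0)) measurable_const
    ((measurable_pi_apply i).div h)

/-- Positive factors preserve the zeros of `a` and of its total mass, so the uniform convention is
in force for both weight vectors or for neither. -/
theorem normWeight_mul_eq_zero {a b : Fin N → ℝ≥0} (hb : ∀ i, 0 < b i) (i : Fin N) :
    normWeight (fun j => a j * b j) i = 0 ↔ normWeight a i = 0 := by
  have h : ∑ j, a j * b j = 0 ↔ ∑ j, a j = 0 := by simp [(hb _).ne']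
  unfold normWeight
  by_cases h0 : ∑ j, a j = 0
  · rw [if_pos h0, if_pos (h.2 h0)]
  · rw [if_neg h0, if_neg (mt h.1 h0), div_eq_zero_iff, div_eq_zero_iff]
    simp [h0, mt h.1 h0, (hb i).ne']

/-- Resampling with adjusted weights and then dividing by the adjustment restores the original
weights up to one common factor. -/
theorem normWeight_mul_div {a b : Fin N → ℝ≥0} (hb : ∀ i, 0 < b i) (ha : ∑ j, a j ≠ 0)
    (i : Fin N) : normWeight (fun j => a j * b j) i / b i =
      normWeight a i / ∑ j, normWeight a j * b j := by
  have h : ∑ j, a j * b j ≠ 0 := by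
    contrapose! ha
    simpa [(hb _).ne'] using ha
  have hbi := (hb i).ne'
  have e : ∑ j, a j / (∑ j, a j) * b j = (∑ j, a j * b j) / ∑ j, a j := by
    rw [Finset.sum_div]
    exact Finset.sum_congr rfl fun j _ => by ring
  simp only [normWeight, if_neg ha, if_neg h]
  rw [e]
  field_simp

theorem measurable_eval_pair {X : Type*} [MeasurableSpace X] :
    Measurable fun p : (Fin N → X) × Fin N => p.1 p.2 :=
  measurable_from_prod_countable_left fun i => measurable_pi_apply i

end NormWeight

variable {X : Type*} [MeasurableSpace X]

/-- The conditions on an auxiliary particle filter under which the forward pass is consistent and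
the backward accept-reject loop terminates. -/
structure AuxFilter.Regular (K : AuxFilter X) (H : StateSpaceModel X) (T : ℕ) : Prop where
  measurable_adj : ∀ t, Measurable (K.adj (t + 1))
  measurable_prop : ∀ t, Measurable (Function.uncurry (K.prop (t + 1)))
  adj_pos : ∀ t < T, ∀ x, 0 < K.adj (t + 1) x
  adj_le : ∃ C : ℝ≥0, ∀ t < T, ∀ x, K.adj (t + 1) x ≤ C
  lintegral_prop : ∀ t < T, ∀ x, ∫⁻ x', (K.prop (t + 1) x x' : ℝ≥0∞) ∂H.ν = 1
  prop_eq_zero : ∀ t < T, ∀ x x', K.prop (t + 1) x x' = 0 ↔ H.m x x' = 0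
  weight_le : ∃ C : ℝ≥0, ∀ t < T, ∀ x x',
    H.m x x' * H.g (t + 1) x' / (K.adj (t + 1) x * K.prop (t + 1) x x') ≤ C

section Kernels

variable (H : StateSpaceModel X) {K : AuxFilter X} {N : ℕ}

instance : SigmaFinite H.ν := H.sigmaFinite_ν

instance : IsProbabilityMeasure H.χ := H.isProbabilityMeasure_χ

theorem lintegral_instrumental_aux {t : ℕ} (hK : Measurable (Function.uncurry (K.prop (t + 1))))
    (w : Fin N → ℝ≥0) (x : Fin N → X) {Ψ : Fin N × X → ℝ≥0∞} (hΨ : Measurable Ψ) :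
    ∫⁻ v, Ψ v ∂(∑ i, (normWeight w i : ℝ≥0∞) •
      (H.ν.withDensity fun x' => (K.prop (t + 1) (x i) x' : ℝ≥0∞)).map (Prod.mk i)) =
    ∑ i, (normWeight w i : ℝ≥0∞) * ∫⁻ x', K.prop (t + 1) (x i) x' * Ψ (i, x') ∂H.ν := by
  rw [lintegral_finsetSum_measure]
  refine Finset.sum_congr rfl fun i _ => ?_
  have hp : Measurable fun x' => (K.prop (t + 1) (x i) x' : ℝ≥0∞) :=
    (hK.comp measurable_prodMk_left).coe_nnreal_ennreal
  have hΨi : Measurable fun x' => Ψ (i, x') := hΨ.comp measurable_prodMk_left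
  rw [lintegral_smul_measure, lintegral_map hΨ measurable_prodMk_left,
    lintegral_withDensity_eq_lintegral_mul _ hp hΨi]
  rfl

/-- The instrumental law as a kernel from weights and particles. -/
def instrumentalKernel {T : ℕ} (hK : K.Regular H T) (t N : ℕ) :
    Kernel ((Fin N → ℝ≥0) × (Fin N → X)) (Fin N × X) where
  toFun y := ∑ i, (normWeight (fun j => y.1 j * K.adj (t + 1) (y.2 j)) i : ℝ≥0∞) •
    (H.ν.withDensity fun x' => (K.prop (t + 1) (y.2 i) x' : ℝ≥0∞)).map (Prod.mk i)
  measurable' := by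
    refine Measure.measurable_of_measurable_coe _ fun A hA => ?_
    have e : ∀ y : (Fin N → ℝ≥0) × (Fin N → X),
        (∑ i, (normWeight (fun j => y.1 j * K.adj (t + 1) (y.2 j)) i : ℝ≥0∞) •
          (H.ν.withDensity fun x' => (K.prop (t + 1) (y.2 i) x' : ℝ≥0∞)).map (Prod.mk i)) A =
        ∑ i, (normWeight (fun j => y.1 j * K.adj (t + 1) (y.2 j)) i : ℝ≥0∞) *
          ∫⁻ x', K.prop (t + 1) (y.2 i) x' * A.indicator 1 (i, x') ∂H.ν := fun y => by
      rw [← lintegral_instrumental_aux H (hK.measurable_prop t) _ _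
        (measurable_one.indicator hA), lintegral_indicator_one hA]
    simp only [e]
    refine Finset.measurable_sum _ fun i _ => Measurable.mul ?_ ?_
    · refine ((measurable_normWeight i).comp (measurable_pi_iff.2 fun j => ?_)).coe_nnreal_ennreal
      exact ((measurable_pi_apply j).comp measurable_fst).mul
        ((hK.measurable_adj t).comp ((measurable_pi_apply j).comp measurable_snd))
    · refine Measurable.lintegral_prod_right' (f := fun z : ((Fin N → ℝ≥0) × (Fin N → X)) × X =>
        (K.prop (t + 1) (z.1.2 i) z.2 : ℝ≥0∞) * A.indicator 1 (i, z.2)) ?_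
      refine Measurable.mul ?_ ((measurable_one.indicator hA).comp
        (measurable_const.prodMk measurable_snd))
      have hx : Measurable fun z : ((Fin N → ℝ≥0) × (Fin N → X)) × X => (z.1.2 i, z.2) :=
        ((measurable_pi_apply i).comp (measurable_snd.comp measurable_fst)).prodMk measurable_snd
      exact ((hK.measurable_prop t).comp hx).coe_nnreal_ennreal

theorem lintegral_instrumentalKernel {T : ℕ} (hK : K.Regular H T) {t : ℕ}
    (y : (Fin N → ℝ≥0) × (Fin N → X)) {Ψ : Fin N × X → ℝ≥0∞} (hΨ : Measurable Ψ) :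
    ∫⁻ v, Ψ v ∂(instrumentalKernel H hK t N y) =
    ∑ i, (normWeight (fun j => y.1 j * K.adj (t + 1) (y.2 j)) i : ℝ≥0∞) *
      ∫⁻ x', K.prop (t + 1) (y.2 i) x' * Ψ (i, x') ∂H.ν :=
  lintegral_instrumental_aux H (hK.measurable_prop t) _ _ hΨ

theorem isMarkovKernel_instrumentalKernel {T : ℕ} (hK : K.Regular H T) {t : ℕ} (ht : t < T)
    (hN : 0 < N) : IsMarkovKernel (instrumentalKernel H hK t N) where
  isProbabilityMeasure y := ⟨by
    rw [← lintegral_one, lintegral_instrumentalKernel H hK y measurable_const]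
    simp [hK.lintegral_prop t ht, sum_coe_normWeight hN]⟩

/-- Sampling proportionally to weights, as a kernel. -/
def categoricalKernel (N : ℕ) : Kernel (Fin N → ℝ≥0) (Fin N) where
  toFun := categorical
  measurable' := by
    refine Measure.measurable_of_measurable_coe _ fun A _ => ?_
    simp only [categorical, Measure.coe_finsetSum, Finset.sum_apply, Measure.smul_apply,
      smul_eq_mul]
    exact Finset.measurable_sum _ fun i _ =>
      (measurable_normWeight i).coe_nnreal_ennreal.mul measurable_const

theorem lintegral_categorical (w : Fin N → ℝ≥0) (f : Fin N → ℝ≥0∞) :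
    ∫⁻ i, f i ∂categorical w = ∑ i, (normWeight w i : ℝ≥0∞) * f i := by
  simp [categorical, lintegral_finsetSum_measure, lintegral_smul_measure, -Measure.coe_nnreal_smul]

theorem isMarkovKernel_categoricalKernel (hN : 0 < N) : IsMarkovKernel (categoricalKernel N) where
  isProbabilityMeasure w := ⟨by
    rw [← lintegral_one]
    exact (lintegral_categorical w _).trans (by simp [sum_coe_normWeight hN])⟩

end Kernels

/-! ### One move of the forward pass -/

section Runs

variable {Ω : Type*} {N : ℕ} {V : Vars X Ω N} {H : StateSpaceModel X} {K : AuxFilter X}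
  {ρ₀ : Measure X} {σ : ℝ≥0}

theorem Vars.measurable_ξ_forwardσ {r t : ℕ} (hrt : r ≤ t) (i : Fin N) :
    Measurable[V.forwardσ H K ρ₀ t] (V.ξ r i) := by
  refine measurable_iff_comap_le.2 (le_trans le_sup_left (le_trans (le_iSup (fun i =>
    MeasurableSpace.comap (V.ξ r i) inferInstance ⊔
      MeasurableSpace.comap (V.weight H K ρ₀ r i) inferInstance) i) ?_))
  exact le_iSup₂_of_le r hrt le_rfl

theorem Vars.measurable_weight_forwardσ {r t : ℕ} (hrt : r ≤ t) (i : Fin N) :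
    Measurable[V.forwardσ H K ρ₀ t] (V.weight H K ρ₀ r i) := by
  refine measurable_iff_comap_le.2 (le_trans le_sup_right (le_trans (le_iSup (fun i =>
    MeasurableSpace.comap (V.ξ r i) inferInstance ⊔
      MeasurableSpace.comap (V.weight H K ρ₀ r i) inferInstance) i) ?_))
  exact le_iSup₂_of_le r hrt le_rfl

theorem Vars.measurable_ξs_forwardσ {r t : ℕ} (hrt : r ≤ t) :
    Measurable[V.forwardσ H K ρ₀ t] fun ω i => V.ξ r i ω := by
  let _ := V.forwardσ H K ρ₀ t
  exact measurable_pi_iff.2 fun i => V.measurable_ξ_forwardσ hrt i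

theorem Vars.measurable_weights_forwardσ {r t : ℕ} (hrt : r ≤ t) :
    Measurable[V.forwardσ H K ρ₀ t] fun ω i => V.weight H K ρ₀ r i ω := by
  let _ := V.forwardσ H K ρ₀ t
  exact measurable_pi_iff.2 fun i => V.measurable_weight_forwardσ hrt i

theorem Vars.forwardσ_mono {r t : ℕ} (hrt : r ≤ t) :
    V.forwardσ H K ρ₀ r ≤ V.forwardσ H K ρ₀ t :=
  biSup_mono fun _ h => le_trans h hrt

theorem Vars.forwardσ_le_backwardσ {T s : ℕ} :
    V.forwardσ H K ρ₀ T ≤ V.backwardσ H K ρ₀ T s := le_sup_left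

theorem Vars.measurable_J_backwardσ {T s r : ℕ} (hsr : s ≤ r) (hrT : r ≤ T) (ℓ : Fin N) :
    Measurable[V.backwardσ H K ρ₀ T s] (V.J r ℓ) := by
  refine measurable_iff_comap_le.2 (le_trans (le_iSup (fun ℓ =>
    MeasurableSpace.comap (V.J r ℓ) inferInstance) ℓ) (le_trans ?_ le_sup_right))
  exact le_iSup₂_of_le (f := fun r (_ : r ∈ Set.Icc s T) => ⨆ ℓ : Fin N,
    MeasurableSpace.comap (V.J r ℓ) inferInstance) r ⟨hsr, hrT⟩ le_rfl

/-- The self-normalized particle approximation of the integral of a function with values `f i` at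
the particles. -/
def Vars.selfNorm (V : Vars X Ω N) (H : StateSpaceModel X) (K : AuxFilter X) (ρ₀ : Measure X)
    (t : ℕ) (f : Fin N → ℝ≥0∞) (ω : Ω) : ℝ≥0∞ :=
  ∑ i, (normWeight (fun j => V.weight H K ρ₀ t j ω) i : ℝ≥0∞) * f i

/-- The density of the particle approximation of the predictive distribution. -/
def Vars.predDensity (V : Vars X Ω N) (H : StateSpaceModel X) (K : AuxFilter X) (ρ₀ : Measure X)
    (t : ℕ) (ω : Ω) (x' : X) : ℝ≥0∞ :=
  V.selfNorm H K ρ₀ t (fun i => H.m (V.ξ t i ω) x') ω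

/-- The conditional mean of `weight (t + 1) * F (ξ (t + 1))`. -/
def Vars.moveMean (V : Vars X Ω N) (H : StateSpaceModel X) (K : AuxFilter X) (ρ₀ : Measure X)
    (t : ℕ) (F : X → ℝ≥0∞) (ω : Ω) : ℝ≥0∞ :=
  ∑ i, ((normWeight (fun j => V.weight H K ρ₀ t j ω * K.adj (t + 1) (V.ξ t j ω)) i /
      K.adj (t + 1) (V.ξ t i ω) : ℝ≥0) : ℝ≥0∞) *
    ∫⁻ x', H.m (V.ξ t i ω) x' * (H.g (t + 1) x' * F x') ∂H.ν

section Move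

variable {T : ℕ}

/-- The importance weight of a pair (ancestor, particle). -/
def moveWeight (H : StateSpaceModel X) (K : AuxFilter X) (t : ℕ) (x x' : X) : ℝ≥0 :=
  H.m x x' * H.g (t + 1) x' / (K.adj (t + 1) x * K.prop (t + 1) x x')

theorem measurable_moveWeight (hK : K.Regular H T) (t : ℕ) :
    Measurable (Function.uncurry (moveWeight H K t)) :=
  (H.measurable_m.mul ((H.measurable_g _).comp measurable_snd)).div
    (((hK.measurable_adj t).comp measurable_fst).mul (hK.measurable_prop t))

/-- Importance weighting cancels the proposal density. Where that density vanishes so does `m`,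
which makes the convention for division by zero harmless. -/
theorem prop_mul_moveWeight (hK : K.Regular H T) {t : ℕ} (ht : t < T) (x x' : X) :
    K.prop (t + 1) x x' * moveWeight H K t x x' =
      (K.adj (t + 1) x)⁻¹ * (H.m x x' * H.g (t + 1) x') := by
  have ha := (hK.adj_pos t ht x).ne'
  unfold moveWeight
  by_cases hp : K.prop (t + 1) x x' = 0
  · simp [hp, (hK.prop_eq_zero t ht x x').1 hp]
  · field_simp

variable {𝒵 : Type*} [MeasurableSpace 𝒵] {t : ℕ} {Z : Ω → 𝒵} {F : 𝒵 × X → ℝ≥0∞}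

/-- The summand of the weighted sample mean as a function of the past and of the new pair. -/
def moveFun (H : StateSpaceModel X) (K : AuxFilter X) (N t : ℕ) (F : 𝒵 × X → ℝ≥0∞)
    (z : (((Fin N → ℝ≥0) × (Fin N → X)) × 𝒵) × (Fin N × X)) : ℝ≥0∞ :=
  moveWeight H K t (z.1.1.2 z.2.1) z.2.2 * F (z.1.2, z.2.2)

theorem measurable_moveFun (hK : K.Regular H T) (hF : Measurable F) :
    Measurable (moveFun H K N t F) := by
  have h1 : Measurable fun z : (((Fin N → ℝ≥0) × (Fin N → X)) × 𝒵) × (Fin N × X) =>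
      (z.1.1.2 z.2.1, z.2.2) := by
    refine Measurable.prodMk (measurable_eval_pair.comp (Measurable.prodMk ?_ ?_)) ?_ <;> fun_prop
  refine ((measurable_moveWeight hK t).comp h1).coe_nnreal_ennreal.mul (hF.comp ?_)
  fun_prop

theorem lintegral_moveFun (hK : K.Regular H T) (ht : t < T) (hF : Measurable F)
    (ω : Ω) :
    ∫⁻ v, moveFun H K N t F ((((fun j => V.weight H K ρ₀ t j ω), fun j => V.ξ t j ω), Z ω), v)
      ∂instrumentalKernel H hK t N ((fun j => V.weight H K ρ₀ t j ω), fun j => V.ξ t j ω) =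
      V.moveMean H K ρ₀ t (fun x' => F (Z ω, x')) ω := by
  have hm : Measurable fun v => moveFun H K N t F
      ((((fun j => V.weight H K ρ₀ t j ω), fun j => V.ξ t j ω), Z ω), v) :=
    (measurable_moveFun hK hF).comp measurable_prodMk_left
  rw [lintegral_instrumentalKernel H hK _ hm, Vars.moveMean]
  refine Finset.sum_congr rfl fun i _ => ?_
  have hmeas : Measurable fun x' => (H.m (V.ξ t i ω) x' : ℝ≥0∞) * (H.g (t + 1) x' * F (Z ω, x')) :=
    ((H.measurable_m.comp measurable_prodMk_left).coe_nnreal_ennreal).mul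
      ((H.measurable_g _).coe_nnreal_ennreal.mul (hF.comp measurable_prodMk_left))
  rw [div_eq_mul_inv, ENNReal.coe_mul, mul_assoc, ← lintegral_const_mul _ hmeas]
  congr 1
  refine lintegral_congr fun x' => ?_
  simp only [moveFun]
  rw [← mul_assoc, ← ENNReal.coe_mul, prop_mul_moveWeight hK ht]
  push_cast
  ring

/-- The adjustment multipliers survive only in the normalizing constant. If all weights vanish, the
uniform convention breaks this identity, hence the hypothesis on `ω`. -/
theorem Vars.moveMean_eq (hK : K.Regular H T) (ht : t < T) {F : X → ℝ≥0∞} {ω : Ω}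
    (hF : Measurable F) (hω : ∑ j, V.weight H K ρ₀ t j ω ≠ 0) :
    V.moveMean H K ρ₀ t F ω =
      (∫⁻ x', V.predDensity H K ρ₀ t ω x' * (H.g (t + 1) x' * F x') ∂H.ν) /
        V.selfNorm H K ρ₀ t (fun i => K.adj (t + 1) (V.ξ t i ω)) ω := by
  have hmeas : ∀ i, Measurable fun x' =>
      (H.m (V.ξ t i ω) x' : ℝ≥0∞) * (H.g (t + 1) x' * F x') := fun i =>
    ((H.measurable_m.comp measurable_prodMk_left).coe_nnreal_ennreal).mul
      ((H.measurable_g _).coe_nnreal_ennreal.mul hF)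
  simp only [moveMean, predDensity, selfNorm, Finset.sum_mul, mul_assoc]
  rw [lintegral_finsetSum _ fun i _ => (hmeas i).const_mul _]
  simp only [lintegral_const_mul _ (hmeas _), div_eq_mul_inv, Finset.sum_mul]
  refine Finset.sum_congr rfl fun i _ => ?_
  have h := normWeight_mul_div (b := fun j => K.adj (t + 1) (V.ξ t j ω))
    (fun j => hK.adj_pos t ht _) hω i
  have hne : ∑ j, normWeight (fun j => V.weight H K ρ₀ t j ω) j * K.adj (t + 1) (V.ξ t j ω) ≠ 0 := by
    intro h0
    simp only [Finset.sum_eq_zero_iff, Finset.mem_univ, forall_const, mul_eq_zero,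
      (hK.adj_pos t ht _).ne', or_false] at h0
    have := sum_normWeight (N := N) (Nat.pos_of_ne_zero fun h => by subst h; simp at hω)
      (fun j => V.weight H K ρ₀ t j ω)
    simp [h0] at this
  rw [← div_eq_mul_inv, h, ENNReal.coe_div hne, div_eq_mul_inv]
  push_cast
  ring

end Move

variable [MeasurableSpace Ω] {T : ℕ} {P : Measure Ω}

theorem Vars.IsRun.measurable_weight (hV : V.IsRun H K ρ₀ σ P T) (hK : K.Regular H T) (t : ℕ)
    (i : Fin N) : Measurable (V.weight H K ρ₀ t i) := by
  cases t with
  | zero =>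
    exact ((Measure.measurable_rnDeriv _ _).ennreal_toNNReal.comp (hV.measurable_ξ 0 i)).mul
      ((H.measurable_g 0).comp (hV.measurable_ξ 0 i))
  | succ t =>
    have hx : Measurable fun ω => V.ξ t (V.anc (t + 1) i ω) ω :=
      measurable_eval_pair.comp ((measurable_pi_iff.2 (hV.measurable_ξ t)).prodMk
        (hV.measurable_anc (t + 1) i))
    have hx' := hV.measurable_ξ (t + 1) i
    exact ((H.measurable_m.comp (hx.prodMk hx')).mul ((H.measurable_g _).comp hx')).div
      (((hK.measurable_adj t).comp hx).mul ((hK.measurable_prop t).comp (hx.prodMk hx')))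

theorem Vars.IsRun.forwardσ_le (hV : V.IsRun H K ρ₀ σ P T) (hK : K.Regular H T) (t : ℕ) :
    V.forwardσ H K ρ₀ t ≤ ‹MeasurableSpace Ω› :=
  iSup₂_le fun r _ => iSup_le fun i => sup_le (hV.measurable_ξ r i).comap_le
    (hV.measurable_weight hK r i).comap_le

theorem Vars.IsRun.backwardσ_le (hV : V.IsRun H K ρ₀ σ P T) (hK : K.Regular H T) (s : ℕ) :
    V.backwardσ H K ρ₀ T s ≤ ‹MeasurableSpace Ω› :=
  sup_le (hV.forwardσ_le hK T) (iSup₂_le fun r _ => iSup_le fun ℓ => (hV.measurable_J r ℓ).comap_le)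

variable [IsProbabilityMeasure P]

section Move

variable {𝒵 : Type*} [MeasurableSpace 𝒵] {t : ℕ} {Z : Ω → 𝒵} {F : 𝒵 × X → ℝ≥0∞}

/-- The test function may depend on the past through `Z`. This is essential later, where it involves
the particle predictive density of the previous cloud. -/
theorem Vars.IsRun.condMean_move (hV : V.IsRun H K ρ₀ σ P T) (hK : K.Regular H T) (ht : t < T)
    (hN : 0 < N) (hZ : Measurable[V.forwardσ H K ρ₀ t] Z) (hF : Measurable F) :
    CondMean (V.forwardσ H K ρ₀ t) P
      (fun j ω => V.weight H K ρ₀ (t + 1) j ω * F (Z ω, V.ξ (t + 1) j ω))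
      (fun _ ω => V.moveMean H K ρ₀ t (fun x' => F (Z ω, x')) ω) := by
  have := isMarkovKernel_instrumentalKernel H hK ht hN
  set κ : Kernel (((Fin N → ℝ≥0) × (Fin N → X)) × 𝒵) (Fin N × X) :=
    (instrumentalKernel H hK t N).comap Prod.fst measurable_fst
  have := (hV.move t ht).condMean (κ := κ) (Ψ := moveFun H K N t F) (Y := fun ω =>
    (((fun j => V.weight H K ρ₀ t j ω), fun j => V.ξ t j ω), Z ω)) (hV.forwardσ_le hK t)
    (fun i => (hV.measurable_anc _ _).prodMk (hV.measurable_ξ _ _))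
    (((measurable_weights_forwardσ le_rfl).prodMk (measurable_ξs_forwardσ le_rfl)).prodMk hZ)
    (fun ω => rfl) (measurable_moveFun hK hF)
  rw [show (fun (_ : Fin N) ω => V.moveMean H K ρ₀ t (fun x' => F (Z ω, x')) ω) = _ from
    funext₂ fun _ ω => (lintegral_moveFun hK ht hF ω).symm]
  exact this

theorem Vars.IsRun.bddUncorr_move (hV : V.IsRun H K ρ₀ σ P T) (hK : K.Regular H T) (ht : t < T)
    (hN : 0 < N) (hZ : Measurable[V.forwardσ H K ρ₀ t] Z) (hF : Measurable F) {C C' : ℝ≥0}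
    (hC : ∀ x x', moveWeight H K t x x' ≤ C) (hC' : ∀ z, F z ≤ C') :
    BddUncorr P (C * C')
      (fun j ω => V.weight H K ρ₀ (t + 1) j ω * F (Z ω, V.ξ (t + 1) j ω))
      (fun _ ω => V.moveMean H K ρ₀ t (fun x' => F (Z ω, x')) ω) := by
  have := isMarkovKernel_instrumentalKernel H hK ht hN
  set κ : Kernel (((Fin N → ℝ≥0) × (Fin N → X)) × 𝒵) (Fin N × X) :=
    (instrumentalKernel H hK t N).comap Prod.fst measurable_fst
  have := (hV.move t ht).bddUncorr (κ := κ) (Ψ := moveFun H K N t F) (Y := fun ω =>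
    (((fun j => V.weight H K ρ₀ t j ω), fun j => V.ξ t j ω), Z ω)) (C := C * C')
    (hV.forwardσ_le hK t)
    (fun i => (hV.measurable_anc _ _).prodMk (hV.measurable_ξ _ _))
    (((measurable_weights_forwardσ le_rfl).prodMk (measurable_ξs_forwardσ le_rfl)).prodMk hZ)
    (fun ω => rfl) (measurable_moveFun hK hF) (fun z => by
      rw [ENNReal.coe_mul]
      exact mul_le_mul' (ENNReal.coe_le_coe.2 (hC _ _)) (hC' _))
  rw [show (fun (_ : Fin N) ω => V.moveMean H K ρ₀ t (fun x' => F (Z ω, x')) ω) = _ from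
    funext₂ fun _ ω => (lintegral_moveFun hK ht hF ω).symm]
  exact this

end Move

end Runs

/-! ### The exact filter recursion and its bounds -/

section Filter

variable (H : StateSpaceModel X) {T : ℕ}

theorem lintegral_push (μ : Measure X) [SFinite μ] {f : X → ℝ≥0∞} (hf : Measurable f) :
    ∫⁻ x', f x' ∂H.push μ = ∫⁻ x, ∫⁻ x', H.m x x' * f x' ∂H.ν ∂μ := by
  have hm : Measurable fun z : X × X => (H.m z.1 z.2 : ℝ≥0∞) := H.measurable_m.coe_nnreal_ennreal
  have hm' : Measurable fun x' => ∫⁻ x, (H.m x x' : ℝ≥0∞) ∂μ :=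
    Measurable.lintegral_prod_left' hm
  rw [StateSpaceModel.push, lintegral_withDensity_eq_lintegral_mul _ hm' hf,
    lintegral_lintegral_swap (hm.mul (hf.comp measurable_snd)).aemeasurable]
  refine lintegral_congr fun x' => ?_
  have hmx : Measurable fun x => (H.m x x' : ℝ≥0∞) := hm.comp measurable_prodMk_right
  rw [lintegral_mul_const _ hmx]
  rfl

/-- One step of the filter recursion, acting on functions. -/
def StateSpaceModel.lookAhead (t : ℕ) (f : X → ℝ≥0∞) (x : X) : ℝ≥0∞ :=
  ∫⁻ x', H.m x x' * (H.g (t + 1) x' * f x') ∂H.ν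

/-- The transition density is bounded by `σ`, and the likelihood functions up to time `T` are
positive and bounded. -/
structure StateSpaceModel.Regular (T : ℕ) (σ : ℝ≥0) : Prop where
  m_le : ∀ x x', H.m x x' ≤ σ
  g_pos : ∀ t ≤ T, ∀ x, 0 < H.g t x
  g_le : ∃ C : ℝ≥0, ∀ t ≤ T, ∀ x, H.g t x ≤ C

variable {H} {σ : ℝ≥0}

theorem measurable_lookAhead {t : ℕ} {f : X → ℝ≥0∞} (hf : Measurable f) :
    Measurable (H.lookAhead t f) := by
  refine Measurable.lintegral_prod_right' (f := fun z : X × X =>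
    (H.m z.1 z.2 : ℝ≥0∞) * (H.g (t + 1) z.2 * f z.2)) ?_
  exact H.measurable_m.coe_nnreal_ennreal.mul
    ((((H.measurable_g _).coe_nnreal_ennreal).mul hf).comp measurable_snd)

theorem measurable_m_right (x : X) : Measurable fun x' => (H.m x x' : ℝ≥0∞) :=
  (H.measurable_m.comp measurable_prodMk_left).coe_nnreal_ennreal

theorem lookAhead_le {t : ℕ} {f : X → ℝ≥0∞} {C C' : ℝ≥0} (hC : ∀ x, H.g (t + 1) x ≤ C)
    (hf : ∀ x, f x ≤ C') (x : X) : H.lookAhead t f x ≤ (C * C' : ℝ≥0) := by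
  calc H.lookAhead t f x ≤ ∫⁻ x', H.m x x' * (C * C' : ℝ≥0) ∂H.ν := by
        refine lintegral_mono fun x' => ?_
        rw [ENNReal.coe_mul]
        gcongr
        · exact hC x'
        · exact hf x'
    _ = (C * C' : ℝ≥0) := by
        rw [lintegral_mul_const _ (measurable_m_right x), H.lintegral_m, one_mul]

theorem lookAhead_ne_zero {t : ℕ} {f : X → ℝ≥0∞} (hfm : Measurable f)
    (hg : ∀ x, 0 < H.g (t + 1) x) (hf : ∀ x, f x ≠ 0) (x : X) : H.lookAhead t f x ≠ 0 := by
  intro h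
  have hm : Measurable fun x' => (H.m x x' : ℝ≥0∞) * (H.g (t + 1) x' * f x') :=
    (measurable_m_right x).mul ((H.measurable_g _).coe_nnreal_ennreal.mul hfm)
  rw [StateSpaceModel.lookAhead, lintegral_eq_zero_iff hm] at h
  have h1 : ∫⁻ x', (H.m x x' : ℝ≥0∞) ∂H.ν = 0 := by
    rw [lintegral_eq_zero_iff (measurable_m_right x)]
    filter_upwards [h] with x' hx'
    simpa [(hg x').ne', hf x'] using hx'
  simp [H.lintegral_m] at h1

theorem lintegral_ne_zero_of_forall {μ : Measure X} (hμ : μ ≠ 0) {f : X → ℝ≥0∞}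
    (hfm : Measurable f) (hf : ∀ x, f x ≠ 0) : ∫⁻ x, f x ∂μ ≠ 0 := by
  intro h
  rw [lintegral_eq_zero_iff hfm] at h
  refine hμ (Measure.measure_univ_eq_zero.1 ?_)
  rw [measure_eq_zero_iff_ae_notMem]
  filter_upwards [h] with x hx
  exact (hf x hx).elim

theorem unnormFilter_succ_lintegral (t : ℕ) [SFinite (H.unnormFilter t)] {f : X → ℝ≥0∞}
    (hf : Measurable f) :
    ∫⁻ x, f x ∂H.unnormFilter (t + 1) = ∫⁻ x, H.lookAhead t f x ∂H.unnormFilter t := by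
  have hg : Measurable fun x => (H.g (t + 1) x : ℝ≥0∞) := (H.measurable_g _).coe_nnreal_ennreal
  rw [StateSpaceModel.unnormFilter, lintegral_withDensity_eq_lintegral_mul _ hg hf,
    lintegral_push _ _ (hg.mul hf)]
  rfl

theorem unnormFilter_univ (hH : H.Regular T σ) {t : ℕ} (ht : t ≤ T) :
    H.unnormFilter t Set.univ ≠ 0 ∧ H.unnormFilter t Set.univ ≠ ⊤ := by
  obtain ⟨C, hC⟩ := hH.g_le
  induction t with
  | zero =>
    have hg : Measurable fun x => (H.g 0 x : ℝ≥0∞) := (H.measurable_g _).coe_nnreal_ennreal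
    rw [StateSpaceModel.unnormFilter, withDensity_apply _ MeasurableSet.univ, Measure.restrict_univ]
    constructor
    · exact lintegral_ne_zero_of_forall (IsProbabilityMeasure.ne_zero _) hg fun x => by
        simpa using (hH.g_pos 0 ht x).ne'
    · refine ne_top_of_le_ne_top (ENNReal.coe_ne_top (r := C)) ?_
      calc ∫⁻ x, (H.g 0 x : ℝ≥0∞) ∂H.χ ≤ ∫⁻ _, C ∂H.χ :=
            lintegral_mono fun x => ENNReal.coe_le_coe.2 (hC 0 ht x)
        _ = C := by simp
  | succ t ih =>
    obtain ⟨h0, h1⟩ := ih (Nat.le_of_succ_le ht)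
    have : IsFiniteMeasure (H.unnormFilter t) := ⟨h1.lt_top⟩
    rw [← lintegral_one, unnormFilter_succ_lintegral t measurable_const]
    constructor
    · refine lintegral_ne_zero_of_forall (fun h => h0 (by simp [h]))
        (measurable_lookAhead measurable_const)
        (lookAhead_ne_zero measurable_const (hH.g_pos _ ht) fun _ => one_ne_zero)
    · refine ne_top_of_le_ne_top (ENNReal.mul_ne_top (ENNReal.coe_ne_top (r := C * 1)) h1) ?_
      calc ∫⁻ x, H.lookAhead t (fun _ => 1) x ∂H.unnormFilter t
          ≤ ∫⁻ _, (C * 1 : ℝ≥0) ∂H.unnormFilter t :=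
            lintegral_mono (lookAhead_le (hC _ ht) fun _ => by simp)
        _ = _ := by rw [lintegral_const]

theorem isProbabilityMeasure_filter (hH : H.Regular T σ) {t : ℕ} (ht : t ≤ T) :
    IsProbabilityMeasure (H.filter t) := by
  obtain ⟨h0, h1⟩ := unnormFilter_univ hH ht
  exact ⟨by simp [StateSpaceModel.filter, ENNReal.inv_mul_cancel h0 h1]⟩

theorem lintegral_filter_succ (hH : H.Regular T σ) {t : ℕ} (ht : t < T) {f : X → ℝ≥0∞}
    (hf : Measurable f) :
    ∫⁻ x, f x ∂H.filter (t + 1) =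
      (∫⁻ x, H.lookAhead t f x ∂H.filter t) / ∫⁻ x, H.lookAhead t (fun _ => 1) x ∂H.filter t := by
  obtain ⟨h0, h1⟩ := unnormFilter_univ hH ht.le
  have : IsFiniteMeasure (H.unnormFilter t) := ⟨h1.lt_top⟩
  simp only [StateSpaceModel.filter, lintegral_smul_measure, smul_eq_mul]
  rw [← lintegral_one, unnormFilter_succ_lintegral t hf, unnormFilter_succ_lintegral t
    measurable_const, ENNReal.mul_div_mul_left _ _ (ENNReal.inv_ne_zero.2 h1)
    (ENNReal.inv_ne_top.2 h0), ENNReal.div_eq_inv_mul]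

end Filter

section SelfNorm

variable {Ω : Type*} {H : StateSpaceModel X} {K : AuxFilter X} {ρ₀ : Measure X}

theorem lintegral_predDensity_mul {N : ℕ} (V : Vars X Ω N) (t : ℕ) (ω : Ω) {h : X → ℝ≥0∞}
    (hh : Measurable h) :
    ∫⁻ x', V.predDensity H K ρ₀ t ω x' * h x' ∂H.ν =
      V.selfNorm H K ρ₀ t (fun i => ∫⁻ x', H.m (V.ξ t i ω) x' * h x' ∂H.ν) ω := by
  have hm : ∀ i, Measurable fun x' => (H.m (V.ξ t i ω) x' : ℝ≥0∞) * h x' := fun i =>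
    (measurable_m_right _).mul hh
  simp only [Vars.predDensity, Vars.selfNorm, Finset.sum_mul, mul_assoc]
  rw [lintegral_finsetSum _ fun i _ => (hm i).const_mul _]
  exact Finset.sum_congr rfl fun i _ => lintegral_const_mul _ (hm i)

theorem selfNorm_eq_div {N : ℕ} (V : Vars X Ω N) {t : ℕ} {ω : Ω}
    (hω : ∑ j, V.weight H K ρ₀ t j ω ≠ 0) (f : Fin N → ℝ≥0∞) :
    V.selfNorm H K ρ₀ t f ω =
      avg (fun j => V.weight H K ρ₀ t j ω * f j) / avg (fun j => (V.weight H K ρ₀ t j ω : ℝ≥0∞)) := by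
  have hN : (N : ℝ≥0∞) ≠ 0 := by
    have : N ≠ 0 := fun h => by subst h; simp at hω
    exact_mod_cast this
  unfold avg
  rw [ENNReal.mul_div_mul_left _ _ (by simp) (by simpa using hN)]
  simp only [Vars.selfNorm, normWeight, if_neg hω, ENNReal.coe_div hω]
  push_cast
  simp only [div_eq_mul_inv, Finset.sum_mul]
  exact Finset.sum_congr rfl fun i _ => by ring

theorem selfNorm_mono {N : ℕ} (V : Vars X Ω N) {t : ℕ} {ω : Ω} {f f' : Fin N → ℝ≥0∞}
    (h : ∀ i, f i ≤ f' i) : V.selfNorm H K ρ₀ t f ω ≤ V.selfNorm H K ρ₀ t f' ω := by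
  unfold Vars.selfNorm
  gcongr with i
  exact h i

theorem selfNorm_const {N : ℕ} (V : Vars X Ω N) (hN : 0 < N) {t : ℕ} {ω : Ω} (c : ℝ≥0∞) :
    V.selfNorm H K ρ₀ t (fun _ => c) ω = c := by
  rw [Vars.selfNorm, ← Finset.sum_mul, sum_coe_normWeight hN, one_mul]

end SelfNorm

section Bounds

variable {H : StateSpaceModel X} {K : AuxFilter X} {σ : ℝ≥0} {T : ℕ}

theorem lintegral_le_of_le {μ : Measure X} [IsProbabilityMeasure μ] {f : X → ℝ≥0∞} {C : ℝ≥0∞}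
    (hf : ∀ x, f x ≤ C) : ∫⁻ x, f x ∂μ ≤ C :=
  (lintegral_mono hf).trans_eq (by simp)

theorem lintegral_adj (hH : H.Regular T σ) (hK : K.Regular H T) {t : ℕ} (ht : t < T) :
    ∫⁻ x, (K.adj (t + 1) x : ℝ≥0∞) ∂H.filter t ≠ 0 ∧
      ∫⁻ x, (K.adj (t + 1) x : ℝ≥0∞) ∂H.filter t ≠ ⊤ := by
  have := isProbabilityMeasure_filter hH ht.le
  obtain ⟨C, hC⟩ := hK.adj_le
  exact ⟨lintegral_ne_zero_of_forall (IsProbabilityMeasure.ne_zero _)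
    (hK.measurable_adj t).coe_nnreal_ennreal fun x => by simpa using (hK.adj_pos t ht x).ne',
    ne_top_of_le_ne_top (ENNReal.coe_ne_top (r := C))
      (lintegral_le_of_le fun x => ENNReal.coe_le_coe.2 (hC t ht x))⟩

theorem lookAhead_one (hH : H.Regular T σ) {t : ℕ} (ht : t < T) :
    ∫⁻ x, H.lookAhead t (fun _ => 1) x ∂H.filter t ≠ 0 ∧
      ∫⁻ x, H.lookAhead t (fun _ => 1) x ∂H.filter t ≠ ⊤ := by
  have := isProbabilityMeasure_filter hH ht.le
  obtain ⟨C, hC⟩ := hH.g_le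
  exact ⟨lintegral_ne_zero_of_forall (IsProbabilityMeasure.ne_zero _)
    (measurable_lookAhead measurable_const)
    (lookAhead_ne_zero measurable_const (hH.g_pos _ ht) fun _ => one_ne_zero),
    ne_top_of_le_ne_top (ENNReal.coe_ne_top (r := C * 1))
      (lintegral_le_of_le (lookAhead_le (hC _ ht) fun _ => by simp))⟩

end Bounds

/-! ### Consistency of the auxiliary particle filter -/

section Forward

variable {Ω ι : Type*} [MeasurableSpace Ω] {P : Measure Ω} {l : Filter ι}
  {n : ι → ℕ} {V : (i : ι) → Vars X Ω (n i)} {H : StateSpaceModel X} {K : AuxFilter X}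
  {ρ₀ : Measure X} {σ : ℝ≥0} {T : ℕ}

/-- A nonzero limit of the mean weight makes the degenerate event negligible, so the uniform
convention does not affect limits in probability. -/
theorem tendsto_measure_sum_weight_eq_zero {t : ℕ} {d : ℝ≥0∞} (hd : d ≠ 0)
    (h : TIP P l (fun i ω => avg fun j => ((V i).weight H K ρ₀ t j ω : ℝ≥0∞)) d) :
    Tendsto (fun i => P {ω | ∑ j, (V i).weight H K ρ₀ t j ω = 0}) l (𝓝 0) := by
  refine tendsto_of_tendsto_of_tendsto_of_le_of_le tendsto_const_nhds
    (h _ (Ioi_mem_nhds (pos_iff_ne_zero.2 hd))) (fun _ => zero_le) fun i => measure_mono ?_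
  intro ω hω
  have : ∑ j, ((V i).weight H K ρ₀ t j ω : ℝ≥0∞) = 0 := by
    exact_mod_cast congrArg ((↑) : ℝ≥0 → ℝ≥0∞) (Set.mem_ofPred.1 hω)
  simp only [avg, this, mul_zero, Set.mem_ofPred_eq, Set.mem_Ioi, lt_self_iff_false,
    not_false_eq_true]

theorem continuousAt_ennreal_div {a b : ℝ≥0∞} (ha : a ≠ ⊤) (hb : b ≠ 0) :
    ContinuousAt (fun z : ℝ≥0∞ × ℝ≥0∞ => z.1 / z.2) (a, b) :=
  ENNReal.Tendsto.div continuousAt_fst (Or.inr hb) continuousAt_snd (Or.inr ha)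

theorem TIP.selfNorm {t : ℕ} {f : (i : ι) → Fin (n i) → Ω → ℝ≥0∞} {a d : ℝ≥0∞} (ha : a ≠ ⊤)
    (hd : d ≠ 0) (h : TIP P l (fun i ω => avg fun j => (V i).weight H K ρ₀ t j ω * f i j ω) a)
    (hw : TIP P l (fun i ω => avg fun j => ((V i).weight H K ρ₀ t j ω : ℝ≥0∞)) d) :
    TIP P l (fun i ω => (V i).selfNorm H K ρ₀ t (fun j => f i j ω) ω) (a / d) := by
  refine (h.map₂ hw (continuousAt_ennreal_div ha hd)).congr_off
    (tendsto_of_tendsto_of_tendsto_of_le_of_le tendsto_const_nhds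
      (tendsto_measure_sum_weight_eq_zero hd hw) (fun _ => zero_le) fun i => measure_mono ?_)
  intro ω hω
  by_contra hc
  exact hω (selfNorm_eq_div _ hc _)

/-- The particle filter is consistent at time `t`. -/
structure Consistent (P : Measure Ω) (l : Filter ι) (V : (i : ι) → Vars X Ω (n i))
    (H : StateSpaceModel X) (K : AuxFilter X) (ρ₀ : Measure X) (t : ℕ) : Prop where
  tip_selfNorm : ∀ f : X → ℝ≥0∞, Measurable f → (∃ C : ℝ≥0, ∀ x, f x ≤ C) →
    TIP P l (fun i ω => (V i).selfNorm H K ρ₀ t (fun j => f ((V i).ξ t j ω)) ω)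
      (∫⁻ x, f x ∂H.filter t)
  tip_weight : ∃ d : ℝ≥0∞, d ≠ 0 ∧
    TIP P l (fun i ω => avg fun j => ((V i).weight H K ρ₀ t j ω : ℝ≥0∞)) d

theorem Consistent.tip_adj {t : ℕ} (h : Consistent P l V H K ρ₀ t) (hK : K.Regular H T)
    (ht : t < T) : TIP P l (fun i ω => (V i).selfNorm H K ρ₀ t
      (fun j => K.adj (t + 1) ((V i).ξ t j ω)) ω) (∫⁻ x, (K.adj (t + 1) x : ℝ≥0∞) ∂H.filter t) := by
  obtain ⟨C, hC⟩ := hK.adj_le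
  exact h.tip_selfNorm _ (hK.measurable_adj t).coe_nnreal_ennreal
    ⟨C, fun x => ENNReal.coe_le_coe.2 (hC t ht x)⟩

variable [IsProbabilityMeasure P]

/-- The conditional mean of the weighted average is a ratio of two self-normalized quantities at
time `t`, up to a negligible event; the weak law does the rest. The alternative in `hb` is that of
`TIP.of_condMean`. -/
theorem TIP.move (hn : Tendsto n l atTop) (hK : K.Regular H T)
    (hV : ∀ i, (V i).IsRun H K ρ₀ σ P T) {t : ℕ} (ht : t < T) {𝒵 : ι → Type*}
    [∀ i, MeasurableSpace (𝒵 i)] {Z : (i : ι) → Ω → 𝒵 i}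
    (hZ : ∀ i, Measurable[(V i).forwardσ H K ρ₀ t] (Z i)) {F : (i : ι) → 𝒵 i × X → ℝ≥0∞}
    (hF : ∀ i, Measurable (F i)) {c d L : ℝ≥0∞} (hc : c ≠ 0) (hd : d ≠ 0) (hL : L ≠ ⊤)
    (hw : TIP P l (fun i ω => avg fun j => ((V i).weight H K ρ₀ t j ω : ℝ≥0∞)) d)
    (hadj : TIP P l (fun i ω => (V i).selfNorm H K ρ₀ t
      (fun j => K.adj (t + 1) ((V i).ξ t j ω)) ω) c)
    (hlim : TIP P l (fun i ω => ∫⁻ x', (V i).predDensity H K ρ₀ t ω x' *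
      (H.g (t + 1) x' * F i (Z i ω, x')) ∂H.ν) L)
    (hb : L = 0 ∨ ∃ C : ℝ≥0, ∀ i z, F i z ≤ C) :
    TIP P l (fun i ω => avg fun j => (V i).weight H K ρ₀ (t + 1) j ω *
      F i (Z i ω, (V i).ξ (t + 1) j ω)) (L / c) := by
  have hpos := hn.eventually_gt_atTop 0
  obtain ⟨Cw, hCw⟩ := hK.weight_le
  have hmean : TIP P l (fun i ω => (V i).moveMean H K ρ₀ t (fun x' => F i (Z i ω, x')) ω)
      (L / c) := by
    refine (hlim.map₂ hadj (continuousAt_ennreal_div hL hc)).congr_off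
      (tendsto_of_tendsto_of_tendsto_of_le_of_le tendsto_const_nhds
        (tendsto_measure_sum_weight_eq_zero hd hw) (fun _ => zero_le) fun i => measure_mono ?_)
    intro ω hω
    by_contra hne
    exact hω (Vars.moveMean_eq hK ht ((hF i).comp measurable_prodMk_left) hne)
  refine TIP.of_condMean hn (fun i => (hV i).forwardσ_le hK t) (ENNReal.div_ne_top hL hc)
    (hpos.mono fun i hi => (hV i).condMean_move hK ht hi (hZ i) (hF i)) ?_
    (hmean.congr_ae (hpos.mono fun i hi => ae_of_all _ fun ω => avg_const hi _))
  rcases hb with rfl | ⟨C, hC⟩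
  · exact Or.inl (by simp)
  · exact Or.inr ⟨Cw * C, hpos.mono fun i hi =>
      (hV i).bddUncorr_move hK ht hi (hZ i) (hF i) (hCw t ht) (hC i)⟩

theorem Consistent.tip_weight_mul_succ {t : ℕ} (h : Consistent P l V H K ρ₀ t)
    (hn : Tendsto n l atTop) (hH : H.Regular T σ) (hK : K.Regular H T)
    (hV : ∀ i, (V i).IsRun H K ρ₀ σ P T) (ht : t < T) {f : X → ℝ≥0∞} (hf : Measurable f)
    (hfb : ∃ C : ℝ≥0, ∀ x, f x ≤ C) :
    TIP P l (fun i ω => avg fun j => (V i).weight H K ρ₀ (t + 1) j ω * f ((V i).ξ (t + 1) j ω))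
      ((∫⁻ x, H.lookAhead t f x ∂H.filter t) / ∫⁻ x, (K.adj (t + 1) x : ℝ≥0∞) ∂H.filter t) := by
  have := isProbabilityMeasure_filter hH ht.le
  obtain ⟨d, hd, hw⟩ := h.tip_weight
  obtain ⟨C, hC⟩ := hfb
  obtain ⟨Cg, hCg⟩ := hH.g_le
  have hgf : Measurable fun x' => (H.g (t + 1) x' : ℝ≥0∞) * f x' :=
    (H.measurable_g _).coe_nnreal_ennreal.mul hf
  have hb := lookAhead_le (f := f) (hCg _ ht) hC
  refine TIP.move hn hK hV ht (𝒵 := fun _ => Unit) (Z := fun _ _ => ())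
    (fun _ => measurable_const) (F := fun _ z => f z.2) (fun _ => hf.comp measurable_snd)
    (lintegral_adj hH hK ht).1 hd (ne_top_of_le_ne_top ENNReal.coe_ne_top (lintegral_le_of_le hb))
    hw (h.tip_adj hK ht) ?_ (Or.inr ⟨C, fun _ z => hC _⟩)
  simp only [lintegral_predDensity_mul _ _ _ hgf]
  exact h.tip_selfNorm _ (measurable_lookAhead hf) ⟨_, hb⟩

/-- Numerator and mean weight at time `t + 1` both carry the factor `1 / ∫ adj dφ_t`. It cancels in
the self-normalized ratio, which is then the filter recursion. -/
theorem Consistent.succ {t : ℕ} (h : Consistent P l V H K ρ₀ t) (hn : Tendsto n l atTop)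
    (hH : H.Regular T σ) (hK : K.Regular H T) (hV : ∀ i, (V i).IsRun H K ρ₀ σ P T) (ht : t < T) :
    Consistent P l V H K ρ₀ (t + 1) := by
  have := isProbabilityMeasure_filter hH ht.le
  obtain ⟨Cg, hCg⟩ := hH.g_le
  have hw := h.tip_weight_mul_succ hn hH hK hV ht (f := fun _ => 1) measurable_const
    ⟨1, fun _ => by simp⟩
  simp only [mul_one] at hw
  have hd := ENNReal.div_ne_zero.2 ⟨(lookAhead_one hH ht).1, (lintegral_adj hH hK ht).2⟩
  refine ⟨fun f hf hfb => ?_, _, hd, hw⟩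
  have h1 := h.tip_weight_mul_succ hn hH hK hV ht hf hfb
  obtain ⟨C, hC⟩ := hfb
  have hb := lookAhead_le (f := f) (hCg _ ht) hC
  have := TIP.selfNorm (ENNReal.div_ne_top (ne_top_of_le_ne_top ENNReal.coe_ne_top
    (lintegral_le_of_le hb)) (lintegral_adj hH hK ht).1) hd h1 hw
  rw [lintegral_filter_succ hH ht hf]
  convert this using 1
  simp only [div_eq_mul_inv]
  rw [ENNReal.mul_inv (Or.inr (by simpa using (lintegral_adj hH hK ht).1))
    (Or.inr (by simpa using (lintegral_adj hH hK ht).2)), inv_inv]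
  calc _ = (∫⁻ x, H.lookAhead t f x ∂H.filter t) * (∫⁻ x, H.lookAhead t (fun _ => 1) x ∂H.filter t)⁻¹
        * ((∫⁻ x, (K.adj (t + 1) x : ℝ≥0∞) ∂H.filter t) *
          (∫⁻ x, (K.adj (t + 1) x : ℝ≥0∞) ∂H.filter t)⁻¹) := by
        rw [ENNReal.mul_inv_cancel (lintegral_adj hH hK ht).1 (lintegral_adj hH hK ht).2, mul_one]
    _ = _ := by ring

theorem tip_weight_mul_zero (hn : Tendsto n l atTop) [IsProbabilityMeasure ρ₀] (hρ : H.χ ≪ ρ₀)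
    (hρb : ∃ C : ℝ≥0, ∀ᵐ x ∂ρ₀, H.χ.rnDeriv ρ₀ x * H.g 0 x ≤ C)
    (hV : ∀ i, (V i).IsRun H K ρ₀ σ P T) {f : X → ℝ≥0∞} (hf : Measurable f)
    (hfb : ∃ C : ℝ≥0, ∀ x, f x ≤ C) (hfin : ∫⁻ x, H.g 0 x * f x ∂H.χ ≠ ⊤) :
    TIP P l (fun i ω => avg fun j => (V i).weight H K ρ₀ 0 j ω * f ((V i).ξ 0 j ω))
      (∫⁻ x, H.g 0 x * f x ∂H.χ) := by
  obtain ⟨C, hC⟩ := hρb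
  obtain ⟨C', hC'⟩ := hfb
  have hg : Measurable fun x => (H.g 0 x : ℝ≥0∞) := (H.measurable_g _).coe_nnreal_ennreal
  set u : X → ℝ≥0∞ := fun x => ((H.χ.rnDeriv ρ₀ x).toNNReal * H.g 0 x : ℝ≥0) * f x
  have hum : Measurable u := (((Measure.measurable_rnDeriv _ _).ennreal_toNNReal.mul
    (H.measurable_g 0)).coe_nnreal_ennreal).mul hf
  have hub : ∀ᵐ x ∂ρ₀, u x ≤ (C * C' : ℝ≥0) := by
    filter_upwards [hC] with x hx
    simp only [u]
    rw [ENNReal.coe_mul C]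
    refine mul_le_mul' (le_trans ?_ hx) (hC' x)
    rw [ENNReal.coe_mul]
    gcongr
    exact ENNReal.coe_toNNReal_le_self
  have hgf : Measurable fun x => (H.g 0 x : ℝ≥0∞) * f x := hg.mul hf
  -- The bound on `u` holds only `ρ₀`-almost everywhere, while the weak law is applied to a function
  -- bounded everywhere. Truncation changes neither the mean nor, almost surely, the averages.
  have hmean : ∫⁻ x, min (u x) (C * C' : ℝ≥0) ∂ρ₀ = ∫⁻ x, H.g 0 x * f x ∂H.χ := by
    rw [← lintegral_rnDeriv_mul hρ hgf.aemeasurable]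
    refine lintegral_congr_ae ?_
    filter_upwards [hub, Measure.rnDeriv_lt_top H.χ ρ₀] with x hx hx'
    rw [min_eq_left hx]
    simp only [u]
    rw [ENNReal.coe_mul, ENNReal.coe_toNNReal hx'.ne, mul_assoc]
  have hΨ : Measurable fun z : Unit × X => min (u z.2) (C * C' : ℝ≥0) :=
    (hum.comp measurable_snd).min measurable_const
  have key : TIP P l (fun i ω => avg fun j => min (u ((V i).ξ 0 j ω)) (C * C' : ℝ≥0))
      (∫⁻ x, H.g 0 x * f x ∂H.χ) := by
    refine TIP.of_condMean hn (𝓖 := fun _ => ⊥) (fun _ => bot_le) hfin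
      (M := fun i _ _ => ∫⁻ x, min (u x) (C * C' : ℝ≥0) ∂ρ₀)
      (Eventually.of_forall fun i => (hV i).init.condMean (Y := fun _ => ())
        (κ := Kernel.const Unit ρ₀) bot_le ((hV i).measurable_ξ 0) measurable_const
        (fun _ => rfl) hΨ) (Or.inr ⟨C * C', Eventually.of_forall fun i =>
        (hV i).init.bddUncorr (Y := fun _ => ())
        (κ := Kernel.const Unit ρ₀) bot_le ((hV i).measurable_ξ 0) measurable_const
        (fun _ => rfl) hΨ fun _ => min_le_right _ _⟩) ?_
    rw [← hmean]
    exact (TIP.const _).congr_ae ((hn.eventually_gt_atTop 0).mono fun i hi =>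
      ae_of_all _ fun ω => avg_const hi _)
  refine key.congr_ae (Eventually.of_forall fun i => ?_)
  have hlaw : ∀ j, P.map ((V i).ξ 0 j) = ρ₀ := fun j => by
    ext A hA
    rw [Measure.map_apply ((hV i).measurable_ξ 0 j) hA]
    simpa using (hV i).init {j} (fun _ => A) (fun _ => hA) Set.univ (@MeasurableSet.univ Ω ⊥)
  have hall : ∀ᵐ ω ∂P, ∀ j, u ((V i).ξ 0 j ω) ≤ (C * C' : ℝ≥0) := ae_all_iff.2 fun j => by
    refine ae_of_ae_map (p := fun x => u x ≤ (C * C' : ℝ≥0)) ((hV i).measurable_ξ 0 j).aemeasurable ?_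
    rw [hlaw]
    exact hub
  filter_upwards [hall] with ω hω
  congr with j
  rw [min_eq_left (hω j)]
  rfl

theorem consistent_zero (hn : Tendsto n l atTop) (hH : H.Regular T σ) [IsProbabilityMeasure ρ₀]
    (hρ : H.χ ≪ ρ₀) (hρb : ∃ C : ℝ≥0, ∀ᵐ x ∂ρ₀, H.χ.rnDeriv ρ₀ x * H.g 0 x ≤ C)
    (hV : ∀ i, (V i).IsRun H K ρ₀ σ P T) : Consistent P l V H K ρ₀ 0 := by
  obtain ⟨Cg, hCg⟩ := hH.g_le
  have hg : Measurable fun x => (H.g 0 x : ℝ≥0∞) := (H.measurable_g _).coe_nnreal_ennreal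
  obtain ⟨h0, h1⟩ := unnormFilter_univ hH (Nat.zero_le T)
  have e : ∀ f : X → ℝ≥0∞, Measurable f →
      ∫⁻ x, f x ∂H.unnormFilter 0 = ∫⁻ x, H.g 0 x * f x ∂H.χ := fun f hf =>
    lintegral_withDensity_eq_lintegral_mul _ hg hf
  have hd : ∫⁻ x, H.g 0 x * 1 ∂H.χ = H.unnormFilter 0 Set.univ := by
    rw [← e _ measurable_const, lintegral_one]
  have hw := tip_weight_mul_zero hn hρ hρb hV (f := fun _ => 1) measurable_const
    ⟨1, fun _ => by simp⟩ (by rw [hd]; exact h1)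
  rw [hd] at hw
  simp only [mul_one] at hw
  refine ⟨fun f hf ⟨C, hC⟩ => ?_, _, h0, hw⟩
  have hfin : ∫⁻ x, H.g 0 x * f x ∂H.χ ≠ ⊤ :=
    ne_top_of_le_ne_top (ENNReal.coe_ne_top (r := Cg * C)) (lintegral_le_of_le fun x => by
      rw [ENNReal.coe_mul]
      exact mul_le_mul' (ENNReal.coe_le_coe.2 (hCg 0 (Nat.zero_le T) x)) (hC x))
  have := TIP.selfNorm hfin h0 (tip_weight_mul_zero hn hρ hρb hV hf ⟨C, hC⟩ hfin) hw
  rwa [← e f hf, ENNReal.div_eq_inv_mul, ← smul_eq_mul, ← lintegral_smul_measure] at this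

theorem consistent (hn : Tendsto n l atTop) (hH : H.Regular T σ) (hK : K.Regular H T)
    [IsProbabilityMeasure ρ₀] (hρ : H.χ ≪ ρ₀)
    (hρb : ∃ C : ℝ≥0, ∀ᵐ x ∂ρ₀, H.χ.rnDeriv ρ₀ x * H.g 0 x ≤ C)
    (hV : ∀ i, (V i).IsRun H K ρ₀ σ P T) {t : ℕ} (ht : t ≤ T) : Consistent P l V H K ρ₀ t := by
  induction t with
  | zero => exact consistent_zero hn hH hρ hρb hV
  | succ t ih => exact (ih (Nat.le_of_succ_le ht)).succ hn hH hK hV ht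

end Forward

theorem CondMean.congr_left {Ω : Type*} {𝓖 : MeasurableSpace Ω} {mΩ : MeasurableSpace Ω}
    {P : Measure Ω} {N : ℕ} {X' X M : Fin N → Ω → ℝ≥0∞}
    (h : CondMean 𝓖 P X M) (hm : ∀ ℓ, Measurable (X' ℓ)) (he : ∀ ℓ, X' ℓ =ᵐ[P] X ℓ) :
    CondMean 𝓖 P X' M := by
  refine ⟨hm, h.measurable_right, fun ℓ S hS => ?_⟩
  rw [← h.setLIntegral ℓ S hS]
  exact lintegral_congr_ae (ae_restrict_of_ae (he ℓ))

/-! ### Accept-reject trials and the conditional law of the backward indices -/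

section Trials

variable {Ω : Type*} {N : ℕ} {V : Vars X Ω N} {H : StateSpaceModel X} {K : AuxFilter X}
  {ρ₀ : Measure X} {σ : ℝ≥0} {T : ℕ}

/-- There is a point because `χ` has mass one, and `m x ·` has integral one there, so it cannot
vanish identically. -/
theorem StateSpaceModel.Regular.σ_ne_zero (hH : H.Regular T σ) : σ ≠ 0 := by
  rintro rfl
  obtain ⟨x⟩ := nonempty_of_isProbabilityMeasure H.χ
  have h := H.lintegral_m x
  have : ∀ x', H.m x x' = 0 := fun x' => le_antisymm (hH.m_le x x') zero_le
  simp [this] at h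

/-- The data on which the trials depend: the weights and particles at the current time, the
particles selected by the paths at the next time, and the values of a function. -/
abbrev TrialData (X : Type*) (N : ℕ) : Type _ :=
  ((Fin N → ℝ≥0) × (Fin N → X)) × ((Fin N → X) × (Fin N → ℝ≥0∞))

/-- The density of the predictive distribution at the particle selected by the path `ℓ`. -/
def TrialData.density (H : StateSpaceModel X) (y : TrialData X N) (ℓ : Fin N) : ℝ≥0∞ :=
  ∑ i, (normWeight y.1.1 i : ℝ≥0∞) * H.m (y.1.2 i) (y.2.1 ℓ)

/-- The law of a trial. -/
def trialKernel (X : Type*) [MeasurableSpace X] (N : ℕ) : Kernel (TrialData X N) (Fin N × ℝ) :=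
  ((categoricalKernel N).comap (fun y => y.1.1) (by fun_prop)) ×ₖ
    Kernel.const _ (volume.restrict (Set.Icc (0 : ℝ) 1))

instance : IsProbabilityMeasure (volume.restrict (Set.Icc (0 : ℝ) 1)) :=
  ⟨by simp⟩

theorem isMarkovKernel_trialKernel (hN : 0 < N) : IsMarkovKernel (trialKernel X N) := by
  have := isMarkovKernel_categoricalKernel hN
  unfold trialKernel
  infer_instance

theorem trialKernel_apply (hN : 0 < N) (y : TrialData X N) :
    trialKernel X N y = (categorical y.1.1).prod (volume.restrict (Set.Icc (0 : ℝ) 1)) := by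
  have := isMarkovKernel_categoricalKernel hN
  rw [trialKernel, Kernel.prod_apply]
  rfl

theorem lintegral_trialKernel (hN : 0 < N) (y : TrialData X N) {Ψ : Fin N × ℝ → ℝ≥0∞}
    (hΨ : Measurable Ψ) :
    ∫⁻ v, Ψ v ∂trialKernel X N y =
      ∑ i, (normWeight y.1.1 i : ℝ≥0∞) * ∫⁻ u in Set.Icc (0 : ℝ) 1, Ψ (i, u) := by
  rw [trialKernel_apply hN, lintegral_prod _ hΨ.aemeasurable, lintegral_categorical]

/-- The indicator of rejection. -/
def rejectFun (H : StateSpaceModel X) (σ : ℝ≥0) (ℓ : Fin N)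
    (z : TrialData X N × (Fin N × ℝ)) : ℝ≥0∞ :=
  if z.2.2 ≤ (H.m (z.1.1.2 z.2.1) (z.1.2.1 ℓ) : ℝ) / σ then 0 else 1

/-- The value at the proposed index in case of acceptance. -/
def acceptFun (H : StateSpaceModel X) (σ : ℝ≥0) (ℓ : Fin N)
    (z : TrialData X N × (Fin N × ℝ)) : ℝ≥0∞ :=
  if z.2.2 ≤ (H.m (z.1.1.2 z.2.1) (z.1.2.1 ℓ) : ℝ) / σ then z.1.2.2 z.2.1 else 0

theorem measurableSet_accept (ℓ : Fin N) : MeasurableSet {z : TrialData X N × (Fin N × ℝ) |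
    z.2.2 ≤ (H.m (z.1.1.2 z.2.1) (z.1.2.1 ℓ) : ℝ) / σ} := by
  refine measurableSet_le (by fun_prop) (Measurable.div_const ?_ _)
  have h1 : Measurable fun z : TrialData X N × (Fin N × ℝ) => (z.1.1.2 z.2.1, z.1.2.1 ℓ) := by
    refine Measurable.prodMk (measurable_eval_pair.comp (Measurable.prodMk ?_ ?_)) ?_ <;> fun_prop
  exact (H.measurable_m.comp h1).coe_nnreal_real

theorem measurable_rejectFun (ℓ : Fin N) : Measurable (rejectFun H σ ℓ) :=
  Measurable.ite (measurableSet_accept ℓ) measurable_const measurable_const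

theorem measurable_acceptFun (ℓ : Fin N) : Measurable (acceptFun H σ ℓ) := by
  refine Measurable.ite (measurableSet_accept ℓ)
    (measurable_eval_pair.comp (Measurable.prodMk ?_ ?_)) measurable_const <;> fun_prop

theorem volume_restrict_Iic {c : ℝ} (h1 : c ≤ 1) :
    volume.restrict (Set.Icc (0 : ℝ) 1) {u | u ≤ c} = ENNReal.ofReal c := by
  rw [Measure.restrict_apply (show MeasurableSet {u : ℝ | u ≤ c} from measurableSet_Iic),
    show {u : ℝ | u ≤ c} ∩ Set.Icc 0 1 = Set.Icc 0 c by
      ext u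
      simp only [Set.mem_inter_iff, Set.mem_ofPred_eq, Set.mem_Icc]
      constructor
      · rintro ⟨a, b, c⟩; exact ⟨b, a⟩
      · rintro ⟨a, b⟩; exact ⟨b, a, b.trans h1⟩]
  simp

theorem lintegral_acceptFun (hH : H.Regular T σ) (hN : 0 < N) (y : TrialData X N) (ℓ : Fin N) :
    ∫⁻ v, acceptFun H σ ℓ (y, v) ∂trialKernel X N y =
      (∑ i, (normWeight y.1.1 i : ℝ≥0∞) * (H.m (y.1.2 i) (y.2.1 ℓ) * y.2.2 i)) / σ := by
  have hσ := hH.σ_ne_zero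
  have hm : Measurable fun v => acceptFun H σ ℓ (y, v) :=
    (measurable_acceptFun ℓ).comp measurable_prodMk_left
  rw [lintegral_trialKernel hN y hm, div_eq_mul_inv, Finset.sum_mul]
  refine Finset.sum_congr rfl fun i _ => ?_
  set c : ℝ := (H.m (y.1.2 i) (y.2.1 ℓ) : ℝ) / σ
  have hc1 : c ≤ 1 := div_le_one_of_le₀ (by exact_mod_cast hH.m_le _ _) (NNReal.coe_nonneg _)
  have : ∫⁻ u in Set.Icc (0 : ℝ) 1, acceptFun H σ ℓ (y, (i, u)) =
      y.2.2 i * ENNReal.ofReal c := by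
    rw [← volume_restrict_Iic hc1, ← lintegral_indicator_const
      (show MeasurableSet {u : ℝ | u ≤ c} from measurableSet_Iic)]
    refine lintegral_congr fun u => ?_
    simp [acceptFun, Set.indicator_apply, c]
  rw [this, show c = ((H.m (y.1.2 i) (y.2.1 ℓ) / σ : ℝ≥0) : ℝ) from rfl, ENNReal.ofReal_coe_nnreal,
    ENNReal.coe_div hσ, div_eq_mul_inv]
  ring

theorem density_div_le_one (hH : H.Regular T σ) (hN : 0 < N) (y : TrialData X N) (ℓ : Fin N) :
    y.density H ℓ / σ ≤ 1 := by
  refine ENNReal.div_le_of_le_mul ?_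
  calc y.density H ℓ ≤ ∑ i, (normWeight y.1.1 i : ℝ≥0∞) * σ := by
        unfold TrialData.density
        gcongr with i
        exact hH.m_le _ _
    _ = 1 * σ := by rw [← Finset.sum_mul, sum_coe_normWeight hN]

theorem lintegral_rejectFun (hH : H.Regular T σ) (hN : 0 < N) (y : TrialData X N) (ℓ : Fin N) :
    ∫⁻ v, rejectFun H σ ℓ (y, v) ∂trialKernel X N y = 1 - y.density H ℓ / σ := by
  have := isMarkovKernel_trialKernel (X := X) hN
  -- With the value `1` at every index, `acceptFun` becomes the indicator of acceptance,
  -- complementary to `rejectFun`.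
  set y' : TrialData X N := (y.1, (y.2.1, fun _ => 1))
  have hm : Measurable fun v => acceptFun H σ ℓ (y', v) :=
    (measurable_acceptFun ℓ).comp measurable_prodMk_left
  have h1 := lintegral_acceptFun hH hN y' ℓ
  simp only [y', mul_one] at h1
  have h2 : ∫⁻ v, rejectFun H σ ℓ (y, v) ∂trialKernel X N y +
      ∫⁻ v, acceptFun H σ ℓ (y', v) ∂trialKernel X N y = 1 := by
    rw [← lintegral_add_right _ hm]
    calc _ = ∫⁻ _, 1 ∂trialKernel X N y := lintegral_congr fun v => by
          simp only [rejectFun, acceptFun, y']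
          split_ifs <;> simp
      _ = 1 := by simp
  have h3 : ∫⁻ v, acceptFun H σ ℓ (y', v) ∂trialKernel X N y = y.density H ℓ / σ := by
    rw [trialKernel_apply hN y, ← trialKernel_apply hN y']
    exact h1
  rw [h3] at h2
  exact ENNReal.eq_sub_of_add_eq (ne_top_of_le_ne_top ENNReal.one_ne_top
    (density_div_le_one hH hN y ℓ)) h2

/-- The data on which the trials at time `s` depend. -/
def Vars.trialData (V : Vars X Ω N) (H : StateSpaceModel X) (K : AuxFilter X) (ρ₀ : Measure X)
    (s : ℕ) (f : Fin N → Ω → ℝ≥0∞) (ω : Ω) : TrialData X N :=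
  ((fun j => V.weight H K ρ₀ s j ω, fun j => V.ξ s j ω),
    (fun ℓ => V.ξ (s + 1) (V.J (s + 1) ℓ ω) ω, fun i => f i ω))

theorem Vars.measurable_trialData {s : ℕ} (hs : s < T) {f : Fin N → Ω → ℝ≥0∞}
    (hf : ∀ i, Measurable[V.backwardσ H K ρ₀ T (s + 1)] (f i)) :
    Measurable[V.backwardσ H K ρ₀ T (s + 1)] (V.trialData H K ρ₀ s f) := by
  have h1 := (V.measurable_weights_forwardσ (H := H) (K := K) (ρ₀ := ρ₀) hs.le).mono
    (V.forwardσ_le_backwardσ (s := s + 1)) le_rfl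
  have h2 := (V.measurable_ξs_forwardσ (H := H) (K := K) (ρ₀ := ρ₀) hs.le).mono
    (V.forwardσ_le_backwardσ (s := s + 1)) le_rfl
  have h3 := (V.measurable_ξs_forwardσ (H := H) (K := K) (ρ₀ := ρ₀) (Nat.succ_le_of_lt hs)).mono
    (V.forwardσ_le_backwardσ (s := s + 1)) le_rfl
  have h4 : ∀ ℓ, Measurable[V.backwardσ H K ρ₀ T (s + 1)] (V.J (s + 1) ℓ) :=
    fun ℓ => V.measurable_J_backwardσ le_rfl (Nat.succ_le_of_lt hs) ℓ
  let _ := V.backwardσ H K ρ₀ T (s + 1)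
  exact (h1.prodMk h2).prodMk ((measurable_pi_iff.2 fun ℓ => measurable_eval_pair.comp
    (h3.prodMk (h4 ℓ))).prodMk (measurable_pi_iff.2 hf))

/-- The pair of variables of a trial. -/
def Vars.trial (V : Vars X Ω N) (s : ℕ) (p : ℕ × Fin N) (ω : Ω) : Fin N × ℝ :=
  (V.prop s p.1 p.2 ω, V.U s p.1 p.2 ω)

/-- The function `Φ` of the `k`-th trial of the path `ℓ`, provided that this trial takes place. -/
def Vars.atTrial (V : Vars X Ω N) (H : StateSpaceModel X) (K : AuxFilter X) (ρ₀ : Measure X)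
    (σ : ℝ≥0) (s : ℕ) (f : Fin N → Ω → ℝ≥0∞) (Φ : Fin N → TrialData X N × (Fin N × ℝ) → ℝ≥0∞)
    (k : ℕ) (ℓ : Fin N) (ω : Ω) : ℝ≥0∞ :=
  (∏ j ∈ Finset.range k, rejectFun H σ ℓ (V.trialData H K ρ₀ s f ω, V.trial s (j, ℓ) ω)) *
    Φ ℓ (V.trialData H K ρ₀ s f ω, V.trial s (k, ℓ) ω)

/-- The conditional mean of `Vars.atTrial`. -/
def Vars.atTrialMean (V : Vars X Ω N) (H : StateSpaceModel X) (K : AuxFilter X) (ρ₀ : Measure X)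
    (σ : ℝ≥0) (s : ℕ) (f : Fin N → Ω → ℝ≥0∞) (Φ : Fin N → TrialData X N × (Fin N × ℝ) → ℝ≥0∞)
    (k : ℕ) (ℓ : Fin N) (ω : Ω) : ℝ≥0∞ :=
  (1 - (V.trialData H K ρ₀ s f ω).density H ℓ / σ) ^ k *
    ∫⁻ v, Φ ℓ (V.trialData H K ρ₀ s f ω, v) ∂trialKernel X N (V.trialData H K ρ₀ s f ω)

theorem measurable_density (ℓ : Fin N) :
    Measurable fun y : TrialData X N => y.density H ℓ := by
  refine Finset.measurable_sum _ fun i _ => ?_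
  have h1 : Measurable fun y : TrialData X N => (y.1.2 i, y.2.1 ℓ) := by fun_prop
  have h2 : Measurable fun y : TrialData X N => y.1.1 := by fun_prop
  exact ((measurable_normWeight i).comp h2).coe_nnreal_ennreal.mul
    (H.measurable_m.comp h1).coe_nnreal_ennreal

theorem Vars.measurable_atTrialMean {s : ℕ} {f : Fin N → Ω → ℝ≥0∞}
    {Φ : Fin N → TrialData X N × (Fin N × ℝ) → ℝ≥0∞} (hN : 0 < N) (hs : s < T)
    (hf : ∀ i, Measurable[V.backwardσ H K ρ₀ T (s + 1)] (f i))
    (hΦ : ∀ ℓ, Measurable (Φ ℓ)) (k : ℕ) (ℓ : Fin N) :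
    Measurable[V.backwardσ H K ρ₀ T (s + 1)] (V.atTrialMean H K ρ₀ σ s f Φ k ℓ) := by
  have := isMarkovKernel_trialKernel (X := X) hN
  have h := V.measurable_trialData hs hf
  let _ := V.backwardσ H K ρ₀ T (s + 1)
  exact (((measurable_const.sub ((measurable_density ℓ).div_const _)).pow_const k).mul
    ((hΦ ℓ).lintegral_kernel_prod_right' (κ := trialKernel X N))).comp h

theorem Vars.mem_active_iff {s k : ℕ} {ℓ : Fin N} {ω : Ω} :
    ℓ ∈ V.active H σ s ω k ↔ ∀ j < k, ¬ V.Accept H σ s j ℓ ω := by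
  induction k with
  | zero => simp [Vars.active]
  | succ k ih =>
    simp only [Vars.active, Finset.mem_filter, ih, Nat.lt_succ_iff_lt_or_eq]
    constructor
    · rintro ⟨h1, h2⟩ j (hj | rfl)
      exacts [h1 j hj, h2]
    · exact fun h => ⟨fun j hj => h j (Or.inl hj), h k (Or.inr rfl)⟩

theorem Vars.prod_rejectFun (s k : ℕ) (f : Fin N → Ω → ℝ≥0∞) (ℓ : Fin N) (ω : Ω) :
    ∏ j ∈ Finset.range k, rejectFun H σ ℓ (V.trialData H K ρ₀ s f ω, V.trial s (j, ℓ) ω) =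
      (V.active H σ s ω k : Set (Fin N)).indicator 1 ℓ := by
  classical
  have e : ∀ j, rejectFun H σ ℓ (V.trialData H K ρ₀ s f ω, V.trial s (j, ℓ) ω) =
      if V.Accept H σ s j ℓ ω then 0 else 1 := fun j => rfl
  simp only [e]
  by_cases h : ℓ ∈ V.active H σ s ω k
  · rw [Set.indicator_of_mem (by exact_mod_cast h)]
    refine Finset.prod_eq_one fun j hj => if_neg (mem_active_iff.1 h j (Finset.mem_range.1 hj))
  · rw [Set.indicator_of_notMem (by exact_mod_cast h)]
    simp only [mem_active_iff, not_forall, not_not] at h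
    obtain ⟨j, hj, hacc⟩ := h
    exact Finset.prod_eq_zero (Finset.mem_range.2 hj) (if_pos hacc)

theorem Vars.measurable_tsum_atTrialMean {s : ℕ} {f : Fin N → Ω → ℝ≥0∞}
    {Φ : Fin N → TrialData X N × (Fin N × ℝ) → ℝ≥0∞} (hN : 0 < N) (hs : s < T)
    (hf : ∀ i, Measurable[V.backwardσ H K ρ₀ T (s + 1)] (f i))
    (hΦ : ∀ ℓ, Measurable (Φ ℓ)) (k₀ : ℕ) (ℓ : Fin N) :
    Measurable[V.backwardσ H K ρ₀ T (s + 1)] fun ω =>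
      ∑' k, V.atTrialMean H K ρ₀ σ s f Φ (k + k₀) ℓ ω := by
  have h := fun k => V.measurable_atTrialMean (σ := σ) hN hs hf hΦ k ℓ
  let _ := V.backwardσ H K ρ₀ T (s + 1)
  exact Measurable.tsum fun k => h (k + k₀)

/-- The conditional mean of a function of the index `J t ℓ`, as a function of `J (t + 1) ℓ`. -/
def Vars.backStep (V : Vars X Ω N) (H : StateSpaceModel X) (K : AuxFilter X) (ρ₀ : Measure X)
    (t : ℕ) (f : Fin N → Ω → ℝ≥0∞) (j : Fin N) (ω : Ω) : ℝ≥0∞ :=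
  V.selfNorm H K ρ₀ t (fun i => H.m (V.ξ t i ω) (V.ξ (t + 1) j ω) * f i ω) ω /
    V.predDensity H K ρ₀ t ω (V.ξ (t + 1) j ω)

theorem tsum_one_sub_pow {a : ℝ≥0∞} (ha : a ≤ 1) : ∑' k : ℕ, (1 - a) ^ k = a⁻¹ := by
  rw [ENNReal.tsum_geometric, ENNReal.sub_sub_cancel ENNReal.one_ne_top ha]

/-- A weighted average of values at most `C`, or `0` when the denominator vanishes, since then the
numerator vanishes too and `0 / 0 = 0`. -/
theorem Vars.backStep_le {f : Fin N → Ω → ℝ≥0∞} {C : ℝ≥0} {t : ℕ} (hC : ∀ i ω, f i ω ≤ C)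
    (j : Fin N) (ω : Ω) : V.backStep H K ρ₀ t f j ω ≤ C := by
  refine ENNReal.div_le_of_le_mul ?_
  simp only [Vars.predDensity, Vars.selfNorm, Finset.mul_sum]
  refine Finset.sum_le_sum fun i _ => ?_
  calc _ ≤ (normWeight (fun j => V.weight H K ρ₀ t j ω) i : ℝ≥0∞) *
        (H.m (V.ξ t i ω) (V.ξ (t + 1) j ω) * C) := by gcongr; exact hC i ω
    _ = _ := by ring

theorem ennreal_inv_div_mul_div {a b c : ℝ≥0∞} (hc : c ≠ 0) (hc' : c ≠ ⊤) :
    (a / c)⁻¹ * (b / c) = b / a := by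
  rw [← ENNReal.div_eq_inv_mul, div_eq_mul_inv a, div_eq_mul_inv b,
    ENNReal.mul_div_mul_right _ _ (by simpa) (by simpa)]

/-- Summing over the accepted pass is a geometric series with sum `σ / q`. The factor `σ` cancels
against the acceptance probability and the exact backward kernel remains: rejection sampling is
unbiased. -/
theorem Vars.tsum_atTrialMean_acceptFun (hH : H.Regular T σ) (hN : 0 < N) (s : ℕ)
    (f : Fin N → Ω → ℝ≥0∞) (ℓ : Fin N) (ω : Ω) :
    ∑' k, V.atTrialMean H K ρ₀ σ s f (acceptFun H σ) k ℓ ω =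
      V.backStep H K ρ₀ s f (V.J (s + 1) ℓ ω) ω := by
  have hσ := hH.σ_ne_zero
  simp only [Vars.atTrialMean]
  rw [ENNReal.tsum_mul_right, tsum_one_sub_pow (density_div_le_one hH hN _ ℓ),
    lintegral_acceptFun hH hN, ennreal_inv_div_mul_div (by simpa using hσ) ENNReal.coe_ne_top]
  rfl

variable [MeasurableSpace Ω] {P : Measure Ω}

theorem Vars.IsRun.measurable_trial (hV : V.IsRun H K ρ₀ σ P T) (s : ℕ) (p : ℕ × Fin N) :
    Measurable (V.trial s p) :=
  (hV.measurable_prop s p.1 p.2).prodMk (hV.measurable_U s p.1 p.2)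

theorem Vars.IsRun.measurable_trialData (hV : V.IsRun H K ρ₀ σ P T) (hK : K.Regular H T)
    {s : ℕ} (hs : s < T) {f : Fin N → Ω → ℝ≥0∞}
    (hf : ∀ i, Measurable[V.backwardσ H K ρ₀ T (s + 1)] (f i)) :
    Measurable (V.trialData H K ρ₀ s f) :=
  (V.measurable_trialData hs hf).mono (hV.backwardσ_le hK _) le_rfl

theorem Vars.IsRun.measurable_atTrial (hV : V.IsRun H K ρ₀ σ P T) (hK : K.Regular H T)
    {s : ℕ} {f : Fin N → Ω → ℝ≥0∞} {Φ : Fin N → TrialData X N × (Fin N × ℝ) → ℝ≥0∞} (hs : s < T)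
    (hf : ∀ i, Measurable[V.backwardσ H K ρ₀ T (s + 1)] (f i))
    (hΦ : ∀ ℓ, Measurable (Φ ℓ)) (k : ℕ) (ℓ : Fin N) :
    Measurable (V.atTrial H K ρ₀ σ s f Φ k ℓ) := by
  have h := hV.measurable_trialData hK hs hf
  exact (Finset.measurable_prod _ fun j _ => (measurable_rejectFun ℓ).comp
    (h.prodMk (hV.measurable_trial s _))).mul ((hΦ ℓ).comp (h.prodMk (hV.measurable_trial s _)))

/-- At most one term is nonzero: the first accepted pass, where the field `accepted` identifies the
path's index with the proposal. -/
theorem Vars.IsRun.tsum_atTrial_acceptFun (hV : V.IsRun H K ρ₀ σ P T) {s : ℕ} (hs : s < T)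
    (f : Fin N → Ω → ℝ≥0∞) (ℓ : Fin N) (ω : Ω) [Decidable (∃ k, V.Accept H σ s k ℓ ω)] :
    ∑' k, V.atTrial H K ρ₀ σ s f (acceptFun H σ) k ℓ ω =
      if ∃ k, V.Accept H σ s k ℓ ω then f (V.J s ℓ ω) ω else 0 := by
  classical
  have e : ∀ k, V.atTrial H K ρ₀ σ s f (acceptFun H σ) k ℓ ω =
      if ℓ ∈ V.active H σ s ω k ∧ V.Accept H σ s k ℓ ω then f (V.J s ℓ ω) ω else 0 := by
    intro k
    rw [Vars.atTrial, prod_rejectFun]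
    by_cases h1 : ℓ ∈ V.active H σ s ω k
    · rw [Set.indicator_of_mem (by exact_mod_cast h1), Pi.one_apply, one_mul]
      by_cases h2 : V.Accept H σ s k ℓ ω
      · rw [if_pos ⟨h1, h2⟩, hV.accepted s hs k ℓ ω h1 h2]
        exact if_pos h2
      · rw [if_neg fun h => h2 h.2]
        exact if_neg h2
    · rw [Set.indicator_of_notMem (by exact_mod_cast h1), zero_mul, if_neg fun h => h1 h.1]
  simp only [e]
  split_ifs with h
  · have hmin : ∀ j < Nat.find h, ¬ V.Accept H σ s j ℓ ω := fun j hj => Nat.find_min h hj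
    rw [tsum_eq_single (Nat.find h), if_pos ⟨mem_active_iff.2 hmin, Nat.find_spec h⟩]
    intro k hk
    refine if_neg fun hc => hk (le_antisymm ?_ (Nat.find_min' h hc.2))
    by_contra hlt
    exact mem_active_iff.1 hc.1 _ (not_le.1 hlt) (Nat.find_spec h)
  · exact ENNReal.tsum_eq_zero.2 fun k => if_neg fun hc => h ⟨k, hc.2⟩

theorem Vars.IsRun.measurable_comp_J (hV : V.IsRun H K ρ₀ σ P T) {f : Fin N → Ω → ℝ≥0∞}
    (hf : ∀ i, Measurable (f i)) (s : ℕ) (ℓ : Fin N) : Measurable fun ω => f (V.J s ℓ ω) ω :=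
  measurable_eval_pair.comp ((measurable_pi_iff.2 hf).prodMk (hV.measurable_J s ℓ))

variable [IsProbabilityMeasure P]

/-- Distinct paths use disjoint sets of trials, so the conditional mean factorizes over paths. The
pass `k ℓ` may vary with the path, as the double series in `lintegral_tsum_atTrial_mul` requires. -/
theorem Vars.IsRun.setLIntegral_atTrial (hV : V.IsRun H K ρ₀ σ P T) (hK : K.Regular H T)
    (hH : H.Regular T σ) (hN : 0 < N) {s : ℕ} (hs : s < T) {f : Fin N → Ω → ℝ≥0∞}
    (hf : ∀ i, Measurable[V.backwardσ H K ρ₀ T (s + 1)] (f i))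
    {Φ : Fin N → TrialData X N × (Fin N × ℝ) → ℝ≥0∞} (hΦ : ∀ ℓ, Measurable (Φ ℓ))
    (L : Finset (Fin N)) (k : Fin N → ℕ) {S : Set Ω}
    (hS : MeasurableSet[V.backwardσ H K ρ₀ T (s + 1)] S) :
    ∫⁻ ω in S, ∏ ℓ ∈ L, V.atTrial H K ρ₀ σ s f Φ (k ℓ) ℓ ω ∂P =
      ∫⁻ ω in S, ∏ ℓ ∈ L, V.atTrialMean H K ρ₀ σ s f Φ (k ℓ) ℓ ω ∂P := by
  classical
  have := isMarkovKernel_trialKernel (X := X) hN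
  -- For each path in `L`, the trials `0, …, k ℓ`: the first `k ℓ` contribute rejection indicators,
  -- the last one contributes `Φ`.
  set F : Finset (ℕ × Fin N) := L.biUnion fun ℓ => (Finset.range (k ℓ + 1)).image fun j => (j, ℓ)
  have hF : ∀ p : ℕ × Fin N, p ∈ F ↔ p.2 ∈ L ∧ p.1 ∈ Finset.range (k p.2 + 1) := by
    rintro ⟨j, ℓ⟩
    simp only [F, Finset.mem_biUnion, Finset.mem_image, Prod.mk.injEq]
    constructor
    · rintro ⟨a, ha, b, hb, rfl, rfl⟩; exact ⟨ha, hb⟩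
    · rintro ⟨h1, h2⟩; exact ⟨ℓ, h1, j, h2, rfl, rfl⟩
  set Ψ : ℕ × Fin N → TrialData X N × (Fin N × ℝ) → ℝ≥0∞ := fun p =>
    if p.1 < k p.2 then rejectFun H σ p.2 else Φ p.2
  have hΨ : ∀ p, Measurable (Ψ p) := fun p => by
    simp only [Ψ]
    split_ifs
    exacts [measurable_rejectFun _, hΦ _]
  have htr : CondIID P (V.backwardσ H K ρ₀ T (s + 1)) (V.trial s)
      fun ω => trialKernel X N (V.trialData H K ρ₀ s f ω) := by
    simp only [trialKernel_apply hN]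
    exact hV.trials s hs
  have key := htr.setLIntegral_prod (κ := trialKernel X N)
    (Y := V.trialData H K ρ₀ s f) (hV.backwardσ_le hK _) (hV.measurable_trial s)
    (V.measurable_trialData hs hf) (fun _ => rfl) hΨ F hS
  simp only [Finset.prod_finset_product_right F L (fun ℓ => Finset.range (k ℓ + 1)) hF,
    Finset.prod_range_succ] at key
  refine Eq.trans (lintegral_congr fun ω => Finset.prod_congr rfl fun ℓ _ => ?_)
    (key.trans (lintegral_congr fun ω => Finset.prod_congr rfl fun ℓ _ => ?_))
  · simp only [Vars.atTrial, Ψ, lt_irrefl, if_false]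
    congr 1
    exact Finset.prod_congr rfl fun j hj => by rw [if_pos (Finset.mem_range.1 hj)]
  · simp only [Vars.atTrialMean, Ψ, lt_irrefl, if_false]
    congr 1
    rw [Finset.prod_congr rfl fun j hj => by rw [if_pos (Finset.mem_range.1 hj),
      lintegral_rejectFun hH hN], Finset.prod_const, Finset.card_range]

section AtTrial

variable {s : ℕ} {f : Fin N → Ω → ℝ≥0∞} {Φ : Fin N → TrialData X N × (Fin N × ℝ) → ℝ≥0∞}

theorem Vars.IsRun.condMean_atTrial (hV : V.IsRun H K ρ₀ σ P T) (hK : K.Regular H T)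
    (hH : H.Regular T σ) (hN : 0 < N) (hs : s < T)
    (hf : ∀ i, Measurable[V.backwardσ H K ρ₀ T (s + 1)] (f i)) (hΦ : ∀ ℓ, Measurable (Φ ℓ))
    (k : ℕ) : CondMean (V.backwardσ H K ρ₀ T (s + 1)) P (V.atTrial H K ρ₀ σ s f Φ k)
      (V.atTrialMean H K ρ₀ σ s f Φ k) where
  measurable_left := hV.measurable_atTrial hK hs hf hΦ k
  measurable_right := V.measurable_atTrialMean hN hs hf hΦ k
  setLIntegral ℓ S hS := by
    simpa using hV.setLIntegral_atTrial hK hH hN hs hf hΦ {ℓ} (fun _ => k) hS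

theorem Vars.IsRun.lintegral_atTrial_mul (hV : V.IsRun H K ρ₀ σ P T) (hK : K.Regular H T)
    (hH : H.Regular T σ) (hN : 0 < N) (hs : s < T)
    (hf : ∀ i, Measurable[V.backwardσ H K ρ₀ T (s + 1)] (f i)) (hΦ : ∀ ℓ, Measurable (Φ ℓ))
    (k k' : ℕ) {ℓ ℓ' : Fin N} (hℓ : ℓ ≠ ℓ') :
    ∫⁻ ω, V.atTrial H K ρ₀ σ s f Φ k ℓ ω * V.atTrial H K ρ₀ σ s f Φ k' ℓ' ω ∂P =
      ∫⁻ ω, V.atTrialMean H K ρ₀ σ s f Φ k ℓ ω * V.atTrialMean H K ρ₀ σ s f Φ k' ℓ' ω ∂P := by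
  have := hV.setLIntegral_atTrial hK hH hN hs hf hΦ {ℓ, ℓ'} (fun j => if j = ℓ then k else k')
    (S := Set.univ) MeasurableSet.univ
  simpa [Finset.prod_pair hℓ, hℓ.symm] using this

theorem Vars.IsRun.condMean_tsum_atTrial (hV : V.IsRun H K ρ₀ σ P T) (hK : K.Regular H T)
    (hH : H.Regular T σ) (hN : 0 < N) (hs : s < T)
    (hf : ∀ i, Measurable[V.backwardσ H K ρ₀ T (s + 1)] (f i)) (hΦ : ∀ ℓ, Measurable (Φ ℓ))
    (k₀ : ℕ) : CondMean (V.backwardσ H K ρ₀ T (s + 1)) P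
      (fun ℓ ω => ∑' k, V.atTrial H K ρ₀ σ s f Φ (k + k₀) ℓ ω)
      (fun ℓ ω => ∑' k, V.atTrialMean H K ρ₀ σ s f Φ (k + k₀) ℓ ω) where
  measurable_left ℓ := Measurable.tsum fun k => hV.measurable_atTrial hK hs hf hΦ _ ℓ
  measurable_right := V.measurable_tsum_atTrialMean hN hs hf hΦ k₀
  setLIntegral ℓ S hS := by
    have h := fun k => hV.condMean_atTrial hK hH hN hs hf hΦ (k + k₀)
    rw [lintegral_tsum fun k => ((h k).measurable_left ℓ).aemeasurable, lintegral_tsum fun k =>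
      (((h k).measurable_right ℓ).mono (hV.backwardσ_le hK _) le_rfl).aemeasurable]
    exact tsum_congr fun k => (h k).setLIntegral ℓ S hS

theorem Vars.IsRun.lintegral_tsum_atTrial_mul (hV : V.IsRun H K ρ₀ σ P T) (hK : K.Regular H T)
    (hH : H.Regular T σ) (hN : 0 < N) (hs : s < T)
    (hf : ∀ i, Measurable[V.backwardσ H K ρ₀ T (s + 1)] (f i)) (hΦ : ∀ ℓ, Measurable (Φ ℓ))
    {ℓ ℓ' : Fin N} (hℓ : ℓ ≠ ℓ') :
    ∫⁻ ω, (∑' k, V.atTrial H K ρ₀ σ s f Φ k ℓ ω) * (∑' k, V.atTrial H K ρ₀ σ s f Φ k ℓ' ω) ∂P =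
      ∫⁻ ω, (∑' k, V.atTrialMean H K ρ₀ σ s f Φ k ℓ ω) *
        (∑' k, V.atTrialMean H K ρ₀ σ s f Φ k ℓ' ω) ∂P := by
  have h1 := fun k ℓ => hV.measurable_atTrial hK hs hf hΦ k ℓ
  have h2 := fun k ℓ => (V.measurable_atTrialMean (σ := σ) hN hs hf hΦ k ℓ).mono
    (hV.backwardσ_le hK _) le_rfl
  have h3 : ∀ k k', Measurable fun ω =>
      V.atTrial H K ρ₀ σ s f Φ k' ℓ ω * V.atTrial H K ρ₀ σ s f Φ k ℓ' ω :=
    fun k k' => (h1 k' ℓ).mul (h1 k ℓ')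
  have h4 : ∀ k k', Measurable fun ω =>
      V.atTrialMean H K ρ₀ σ s f Φ k' ℓ ω * V.atTrialMean H K ρ₀ σ s f Φ k ℓ' ω :=
    fun k k' => (h2 k' ℓ).mul (h2 k ℓ')
  simp only [← ENNReal.tsum_mul_left, ← ENNReal.tsum_mul_right]
  rw [lintegral_tsum fun k => (Measurable.tsum (h3 k)).aemeasurable,
    lintegral_tsum fun k => (Measurable.tsum (h4 k)).aemeasurable]
  refine tsum_congr fun k => ?_
  refine (lintegral_tsum fun k' => (h3 k k').aemeasurable).trans
    (Eq.trans ?_ (lintegral_tsum fun k' => (h4 k k').aemeasurable).symm)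
  exact tsum_congr fun k' => hV.lintegral_atTrial_mul hK hH hN hs hf hΦ k' k hℓ

end AtTrial

/-- A new particle almost surely descends from an ancestor with positive weight by a move of
positive proposal density. By `prop_eq_zero` that move has `m > 0`, so the ancestor alone makes the
sum positive. -/
theorem Vars.IsRun.ae_predDensity_ne_zero (hV : V.IsRun H K ρ₀ σ P T) (hK : K.Regular H T)
    (hN : 0 < N) {t : ℕ} (ht : t < T) :
    ∀ᵐ ω ∂P, ∀ j, V.predDensity H K ρ₀ t ω (V.ξ (t + 1) j ω) ≠ 0 := by
  classical
  have := isMarkovKernel_instrumentalKernel H hK ht hN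
  set D : ((Fin N → ℝ≥0) × (Fin N → X)) × (Fin N × X) → ℝ≥0∞ := fun z =>
    ∑ i, (normWeight z.1.1 i : ℝ≥0∞) * H.m (z.1.2 i) z.2.2
  have hD : Measurable D := by
    refine Finset.measurable_sum _ fun i _ => ?_
    have h1 : Measurable fun z : ((Fin N → ℝ≥0) × (Fin N → X)) × (Fin N × X) =>
        (z.1.2 i, z.2.2) := by fun_prop
    have h2 : Measurable fun z : ((Fin N → ℝ≥0) × (Fin N → X)) × (Fin N × X) => z.1.1 := by fun_prop
    exact ((measurable_normWeight i).comp h2).coe_nnreal_ennreal.mul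
      (H.measurable_m.comp h1).coe_nnreal_ennreal
  set Ψ : ((Fin N → ℝ≥0) × (Fin N → X)) × (Fin N × X) → ℝ≥0∞ := fun z => if D z = 0 then 1 else 0
  have hΨ : Measurable Ψ :=
    Measurable.ite (hD (measurableSet_singleton 0)) measurable_const measurable_const
  have hzero : ∀ y, ∫⁻ v, Ψ (y, v) ∂instrumentalKernel H hK t N y = 0 := by
    intro y
    have hΨy : Measurable fun v => Ψ (y, v) := hΨ.comp measurable_prodMk_left
    rw [lintegral_instrumentalKernel H hK y hΨy]
    refine Finset.sum_eq_zero fun i _ => ?_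
    by_cases hi : normWeight (fun j => y.1 j * K.adj (t + 1) (y.2 j)) i = 0
    · simp [hi]
    · have : ∀ x', (K.prop (t + 1) (y.2 i) x' : ℝ≥0∞) * Ψ (y, (i, x')) = 0 := fun x' => by
        by_cases h : D (y, (i, x')) = 0
        · have h3 : (normWeight y.1 i : ℝ≥0∞) * H.m (y.2 i) x' = 0 :=
            Finset.sum_eq_zero_iff.1 h i (Finset.mem_univ i)
          have h4 : normWeight y.1 i ≠ 0 :=
            fun h5 => hi ((normWeight_mul_eq_zero (fun j => hK.adj_pos t ht _) i).2 h5)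
          have h5 : H.m (y.2 i) x' = 0 := by simpa [h4] using h3
          simp [(hK.prop_eq_zero t ht _ _).2 h5]
        · simp [Ψ, h]
      simp [this]
  have hmean := (hV.move t ht).condMean (κ := instrumentalKernel H hK t N) (Ψ := Ψ) (Y := fun ω =>
    (fun j => V.weight H K ρ₀ t j ω, fun j => V.ξ t j ω)) (hV.forwardσ_le hK t)
    (fun i => (hV.measurable_anc _ _).prodMk (hV.measurable_ξ _ _))
    ((measurable_weights_forwardσ le_rfl).prodMk (measurable_ξs_forwardσ le_rfl))
    (fun ω => rfl) hΨ
  refine ae_all_iff.2 fun j => ?_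
  have h0 := hmean.setLIntegral j Set.univ MeasurableSet.univ
  simp only [hzero, lintegral_zero, Measure.restrict_univ] at h0
  rw [lintegral_eq_zero_iff (hmean.measurable_left j)] at h0
  filter_upwards [h0] with ω hω hc
  simp only [Pi.zero_apply, Ψ, ite_eq_right_iff, one_ne_zero, imp_false] at hω
  exact hω hc

/-- For the constant statistic `1`, the series of trials is the indicator of eventual acceptance,
and its conditional mean is `q / q`, equal to `1` almost surely since `q` is positive at the
selected particle. -/
theorem Vars.IsRun.ae_exists_accept (hV : V.IsRun H K ρ₀ σ P T) (hK : K.Regular H T)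
    (hH : H.Regular T σ) (hN : 0 < N) {s : ℕ} (hs : s < T) :
    ∀ᵐ ω ∂P, ∀ ℓ, ∃ k, V.Accept H σ s k ℓ ω := by
  classical
  refine ae_all_iff.2 fun ℓ => ?_
  have hmean := hV.condMean_tsum_atTrial hK hH hN hs (f := fun _ _ => 1)
    (fun i => measurable_const) (measurable_acceptFun (H := H) (σ := σ)) 0
  simp only [add_zero, tsum_atTrialMean_acceptFun hH hN, hV.tsum_atTrial_acceptFun hs] at hmean
  have hone : ∫⁻ ω, V.backStep H K ρ₀ s (fun _ _ => 1) (V.J (s + 1) ℓ ω) ω ∂P = 1 := by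
    rw [lintegral_congr_ae (g := fun _ => 1), lintegral_one, measure_univ]
    filter_upwards [hV.ae_predDensity_ne_zero hK hN hs] with ω hω
    simp only [Vars.backStep, mul_one]
    refine ENNReal.div_self (hω _) ?_
    exact ENNReal.sum_ne_top.2 fun i _ => ENNReal.mul_ne_top ENNReal.coe_ne_top ENNReal.coe_ne_top
  have hX := hmean.setLIntegral ℓ Set.univ MeasurableSet.univ
  rw [Measure.restrict_univ, hone] at hX
  have hms : MeasurableSet {ω | ∃ k, V.Accept H σ s k ℓ ω} := by
    convert hmean.measurable_left ℓ (measurableSet_singleton 1) using 1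
    ext ω
    by_cases h : ∃ k, V.Accept H σ s k ℓ ω <;> simp [h]
  rw [show (fun ω => if ∃ k, V.Accept H σ s k ℓ ω then (1 : ℝ≥0∞) else 0) =
    {ω | ∃ k, V.Accept H σ s k ℓ ω}.indicator 1 by ext ω; simp [Set.indicator_apply],
    lintegral_indicator_one hms] at hX
  exact mem_ae_iff.2 ((prob_compl_eq_zero_iff hms).2 hX)

theorem Vars.IsRun.tsum_atTrial_ae_eq (hV : V.IsRun H K ρ₀ σ P T) (hK : K.Regular H T)
    (hH : H.Regular T σ) (hN : 0 < N) {s : ℕ} (hs : s < T) (f : Fin N → Ω → ℝ≥0∞) (ℓ : Fin N) :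
    (fun ω => f (V.J s ℓ ω) ω) =ᵐ[P]
      fun ω => ∑' k, V.atTrial H K ρ₀ σ s f (acceptFun H σ) k ℓ ω := by
  classical
  filter_upwards [hV.ae_exists_accept hK hH hN hs] with ω hω
  rw [hV.tsum_atTrial_acceptFun hs, if_pos (hω ℓ)]

/-- As each path almost surely stops, a statistic at its index equals the series over passes, whose
conditional mean is the backward kernel. -/
theorem Vars.IsRun.condMean_J (hV : V.IsRun H K ρ₀ σ P T) (hK : K.Regular H T)
    (hH : H.Regular T σ) (hN : 0 < N) {s : ℕ} (hs : s < T) {f : Fin N → Ω → ℝ≥0∞}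
    (hf : ∀ i, Measurable[V.backwardσ H K ρ₀ T (s + 1)] (f i)) :
    CondMean (V.backwardσ H K ρ₀ T (s + 1)) P (fun ℓ ω => f (V.J s ℓ ω) ω)
      (fun ℓ ω => V.backStep H K ρ₀ s f (V.J (s + 1) ℓ ω) ω) := by
  have h := hV.condMean_tsum_atTrial hK hH hN hs hf (measurable_acceptFun (H := H) (σ := σ)) 0
  simp only [add_zero, tsum_atTrialMean_acceptFun hH hN] at h
  exact h.congr_left (hV.measurable_comp_J (fun i => (hf i).mono (hV.backwardσ_le hK _) le_rfl) s)
    (hV.tsum_atTrial_ae_eq hK hH hN hs f)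

theorem Vars.IsRun.bddUncorr_J (hV : V.IsRun H K ρ₀ σ P T) (hK : K.Regular H T)
    (hH : H.Regular T σ) (hN : 0 < N) {s : ℕ} (hs : s < T) {f : Fin N → Ω → ℝ≥0∞}
    (hf : ∀ i, Measurable[V.backwardσ H K ρ₀ T (s + 1)] (f i)) {C : ℝ≥0}
    (hC : ∀ i ω, f i ω ≤ C) :
    BddUncorr P C (fun ℓ ω => f (V.J s ℓ ω) ω)
      (fun ℓ ω => V.backStep H K ρ₀ s f (V.J (s + 1) ℓ ω) ω) where
  left_le ℓ := ae_of_all _ fun ω => hC _ _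
  right_le ℓ := ae_of_all _ fun ω => backStep_le hC _ _
  lintegral_mul ℓ ℓ' hℓ := by
    have h := hV.lintegral_tsum_atTrial_mul hK hH hN hs hf
      (measurable_acceptFun (H := H) (σ := σ)) hℓ
    simp only [tsum_atTrialMean_acceptFun hH hN] at h
    rw [← h]
    refine lintegral_congr_ae ?_
    filter_upwards [hV.tsum_atTrial_ae_eq hK hH hN hs f ℓ,
      hV.tsum_atTrial_ae_eq hK hH hN hs f ℓ'] with ω h1 h2
    rw [h1, h2]

theorem Vars.IsRun.condMean_J_final (hV : V.IsRun H K ρ₀ σ P T) (hK : K.Regular H T)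
    (hN : 0 < N) {f : Fin N → Ω → ℝ≥0∞} (hf : ∀ i, Measurable[V.forwardσ H K ρ₀ T] (f i)) :
    CondMean (V.forwardσ H K ρ₀ T) P (fun ℓ ω => f (V.J T ℓ ω) ω)
      (fun _ ω => V.selfNorm H K ρ₀ T (fun i => f i ω) ω) := by
  have := isMarkovKernel_categoricalKernel hN
  have h := hV.final.condMean (κ := (categoricalKernel N).comap
      (Prod.fst : (Fin N → ℝ≥0) × (Fin N → ℝ≥0∞) → Fin N → ℝ≥0) measurable_fst)
    (Y := fun ω => (fun i => V.weight H K ρ₀ T i ω, fun i => f i ω))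
    (Ψ := fun z => z.1.2 z.2) (hV.forwardσ_le hK T) (hV.measurable_J T)
    ((measurable_weights_forwardσ le_rfl).prodMk
      (@measurable_pi_iff _ _ _ (V.forwardσ H K ρ₀ T) _ _ |>.2 hf))
    (fun ω => rfl) (measurable_eval_pair.comp (measurable_fst.snd.prodMk measurable_snd))
  have e : ∀ ω, V.selfNorm H K ρ₀ T (fun i => f i ω) ω =
      ∫⁻ i, f i ω ∂categorical (fun i => V.weight H K ρ₀ T i ω) :=
    fun ω => (lintegral_categorical _ _).symm
  simp only [e]
  exact h

theorem Vars.IsRun.bddUncorr_J_final (hV : V.IsRun H K ρ₀ σ P T) (hK : K.Regular H T)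
    (hN : 0 < N) {f : Fin N → Ω → ℝ≥0∞} (hf : ∀ i, Measurable[V.forwardσ H K ρ₀ T] (f i))
    {C : ℝ≥0} (hC : ∀ i ω, f i ω ≤ C) :
    BddUncorr P C (fun ℓ ω => f (V.J T ℓ ω) ω)
      (fun _ ω => V.selfNorm H K ρ₀ T (fun i => f i ω) ω) := by
  have := isMarkovKernel_categoricalKernel hN
  have h := hV.final.bddUncorr (κ := (categoricalKernel N).comap
      (Prod.fst : (Fin N → ℝ≥0) × (Fin N → ℝ≥0∞) → Fin N → ℝ≥0) measurable_fst)
    -- The bound must hold for all arguments of `Ψ`, not only for the values taken by `f`; the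
    -- truncation changes nothing there.
    (Y := fun ω => (fun i => V.weight H K ρ₀ T i ω, fun i => min (f i ω) C))
    (Ψ := fun z => min (z.1.2 z.2) C) (C := C) (hV.forwardσ_le hK T) (hV.measurable_J T)
    ((measurable_weights_forwardσ le_rfl).prodMk
      (@measurable_pi_iff _ _ _ (V.forwardσ H K ρ₀ T) _ _ |>.2
      fun i => (hf i).min measurable_const))
    (fun ω => rfl) ((measurable_eval_pair.comp (measurable_fst.snd.prodMk measurable_snd)).min
      measurable_const) (fun z => min_le_right _ _)
  have e : ∀ ω, V.selfNorm H K ρ₀ T (fun i => f i ω) ω =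
      ∫⁻ i, f i ω ∂categorical (fun i => V.weight H K ρ₀ T i ω) :=
    fun ω => (lintegral_categorical _ _).symm
  simp only [min_eq_left (hC _ _)] at h
  simp only [e]
  exact h

end Trials

/-! ### The functions `backward`: recursion, positivity, bounds -/

section Backward

variable {H : StateSpaceModel X} {σ : ℝ≥0} {T : ℕ}

theorem backward_succ (n t : ℕ) :
    H.backward (n + 1) t = H.lookAhead t (H.backward n (t + 1)) := by
  ext x
  simp only [StateSpaceModel.backward, StateSpaceModel.lookAhead, mul_assoc]

theorem measurable_backward (n t : ℕ) : Measurable (H.backward n t) := by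
  induction n generalizing t with
  | zero => exact measurable_const
  | succ n ih => rw [backward_succ]; exact measurable_lookAhead (ih _)

theorem backward_le (hH : H.Regular T σ) (n t : ℕ) (h : t + n ≤ T) :
    ∃ C : ℝ≥0, ∀ x, H.backward n t x ≤ C := by
  obtain ⟨Cg, hCg⟩ := hH.g_le
  induction n generalizing t with
  | zero => exact ⟨1, fun x => by simp [StateSpaceModel.backward]⟩
  | succ n ih =>
    obtain ⟨C, hC⟩ := ih (t + 1) (by omega)
    exact ⟨Cg * C, fun x => by
      rw [backward_succ]; exact lookAhead_le (hCg (t + 1) (by omega)) hC x⟩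

theorem backward_ne_zero (hH : H.Regular T σ) (n t : ℕ) (h : t + n ≤ T) (x : X) :
    H.backward n t x ≠ 0 := by
  induction n generalizing t x with
  | zero => simp [StateSpaceModel.backward]
  | succ n ih =>
    rw [backward_succ]
    exact lookAhead_ne_zero (measurable_backward _ _) (hH.g_pos _ (by omega))
      (ih (t + 1) (by omega)) x

theorem backward_eq_lookAhead {t : ℕ} (ht : t < T) :
    H.backward (T - t) t = H.lookAhead t (H.backward (T - (t + 1)) (t + 1)) := by
  rw [← backward_succ]
  congr 1
  omega

theorem lintegral_backward (hH : H.Regular T σ) {t : ℕ} (ht : t ≤ T) :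
    ∫⁻ x, H.backward (T - t) t x ∂H.filter t ≠ 0 ∧
      ∫⁻ x, H.backward (T - t) t x ∂H.filter t ≠ ⊤ := by
  have := isProbabilityMeasure_filter hH ht
  obtain ⟨C, hC⟩ := backward_le hH (T - t) t (by omega)
  exact ⟨lintegral_ne_zero_of_forall (IsProbabilityMeasure.ne_zero _) (measurable_backward _ _)
    (backward_ne_zero hH _ _ (by omega)),
    ne_top_of_le_ne_top ENNReal.coe_ne_top (lintegral_le_of_le hC)⟩

end Backward

/-! ### Averages along the backward index paths -/

section Chain

variable {Ω : Type*} {H : StateSpaceModel X} {K : AuxFilter X} {ρ₀ : Measure X} {σ : ℝ≥0} {T : ℕ}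

/-- The backward recursion for a statistic `S` of the particles at time `r`: its value for the
particles at time `r + k`. -/
def Vars.backStat {N : ℕ} (V : Vars X Ω N) (H : StateSpaceModel X) (K : AuxFilter X)
    (ρ₀ : Measure X) (r : ℕ) (S : Fin N → Ω → ℝ≥0∞) : ℕ → Fin N → Ω → ℝ≥0∞
  | 0 => S
  | k + 1 => V.backStep H K ρ₀ (r + k) (Vars.backStat V H K ρ₀ r S k)

/-- Weights, particles and values of a statistic. -/
abbrev StepData (X : Type*) (N : ℕ) : Type _ :=
  ((Fin N → ℝ≥0) × (Fin N → X)) × (Fin N → ℝ≥0∞)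

/-- The function `Vars.backStep` as a function of the data and of the new particle. -/
def stepFun {N : ℕ} (H : StateSpaceModel X) (z : StepData X N × X) : ℝ≥0∞ :=
  (∑ i, (normWeight z.1.1.1 i : ℝ≥0∞) * (H.m (z.1.1.2 i) z.2 * z.1.2 i)) /
    ∑ i, (normWeight z.1.1.1 i : ℝ≥0∞) * H.m (z.1.1.2 i) z.2

theorem measurable_stepFun {N : ℕ} : Measurable (stepFun (N := N) H) := by
  have h1 : ∀ i, Measurable fun z : StepData X N × X => (normWeight z.1.1.1 i : ℝ≥0∞) := fun i =>
    ((measurable_normWeight i).comp (by fun_prop : Measurable fun z : StepData X N × X =>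
      z.1.1.1)).coe_nnreal_ennreal
  have h2 : ∀ i, Measurable fun z : StepData X N × X => (H.m (z.1.1.2 i) z.2 : ℝ≥0∞) := fun i =>
    (H.measurable_m.comp (by fun_prop : Measurable fun z : StepData X N × X =>
      (z.1.1.2 i, z.2))).coe_nnreal_ennreal
  have h3 : ∀ i, Measurable fun z : StepData X N × X => z.1.2 i := fun i => by fun_prop
  exact (Finset.measurable_sum _ fun i _ => (h1 i).mul ((h2 i).mul (h3 i))).div
    (Finset.measurable_sum _ fun i _ => (h1 i).mul (h2 i))

/-- The data for `stepFun`. -/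
def Vars.stepData {N : ℕ} (V : Vars X Ω N) (H : StateSpaceModel X) (K : AuxFilter X)
    (ρ₀ : Measure X) (t : ℕ) (S : Fin N → Ω → ℝ≥0∞) (ω : Ω) : StepData X N :=
  ((fun i => V.weight H K ρ₀ t i ω, fun i => V.ξ t i ω), fun i => S i ω)

theorem Vars.measurable_stepData {N : ℕ} (V : Vars X Ω N) {t : ℕ} {S : Fin N → Ω → ℝ≥0∞}
    (hS : ∀ i, Measurable[V.forwardσ H K ρ₀ t] (S i)) :
    Measurable[V.forwardσ H K ρ₀ t] (V.stepData H K ρ₀ t S) := by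
  have h1 := V.measurable_weights_forwardσ (H := H) (K := K) (ρ₀ := ρ₀) (le_refl t)
  have h2 := V.measurable_ξs_forwardσ (H := H) (K := K) (ρ₀ := ρ₀) (le_refl t)
  let _ := V.forwardσ H K ρ₀ t
  exact (h1.prodMk h2).prodMk (measurable_pi_iff.2 hS)

theorem Vars.measurable_backStep {N : ℕ} (V : Vars X Ω N) {t : ℕ} {S : Fin N → Ω → ℝ≥0∞}
    (hS : ∀ i, Measurable[V.forwardσ H K ρ₀ t] (S i)) (j : Fin N) :
    Measurable[V.forwardσ H K ρ₀ (t + 1)] (V.backStep H K ρ₀ t S j) := by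
  have h1 := (V.measurable_stepData hS).mono (V.forwardσ_mono (Nat.le_succ t)) le_rfl
  have h2 := V.measurable_ξ_forwardσ (H := H) (K := K) (ρ₀ := ρ₀) (le_refl (t + 1)) j
  let _ := V.forwardσ H K ρ₀ (t + 1)
  have h3 : Measurable fun ω => (V.stepData H K ρ₀ t S ω, V.ξ (t + 1) j ω) := h1.prodMk h2
  have h4 : Measurable fun ω => stepFun H (V.stepData H K ρ₀ t S ω, V.ξ (t + 1) j ω) :=
    measurable_stepFun.comp h3
  exact h4

theorem Vars.measurable_backStat {N : ℕ} (V : Vars X Ω N) {r : ℕ} {S : Fin N → Ω → ℝ≥0∞}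
    (hS : ∀ i, Measurable[V.forwardσ H K ρ₀ r] (S i)) (k : ℕ) (j : Fin N) :
    Measurable[V.forwardσ H K ρ₀ (r + k)] (V.backStat H K ρ₀ r S k j) := by
  induction k generalizing j with
  | zero => exact hS j
  | succ k ih => exact V.measurable_backStep ih j

theorem Vars.backStat_le {N : ℕ} (V : Vars X Ω N) {r : ℕ} {S : Fin N → Ω → ℝ≥0∞} {C : ℝ≥0}
    (hC : ∀ i ω, S i ω ≤ C) (k : ℕ) (j : Fin N) (ω : Ω) : V.backStat H K ρ₀ r S k j ω ≤ C := by
  induction k generalizing j ω with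
  | zero => exact hC j ω
  | succ k ih => exact V.backStep_le ih j ω

theorem stepFun_le {N : ℕ} (z : StepData X N) {C : ℝ≥0} (hC : ∀ i, z.2 i ≤ C) (x' : X) :
    stepFun H (z, x') ≤ C := by
  refine ENNReal.div_le_of_le_mul ?_
  rw [Finset.mul_sum]
  refine Finset.sum_le_sum fun i _ => ?_
  calc _ ≤ (normWeight z.1.1 i : ℝ≥0∞) * (H.m (z.1.2 i) x' * C) := by gcongr; exact hC i
    _ = _ := by ring

/-- The denominator of the backward kernel is exactly the predictive density against which it is
integrated. After cancellation and exchange of sum and integral, `lookAhead` acts on `f` while `S`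
stays with the old particles. -/
theorem lintegral_predDensity_stepFun {N : ℕ} (V : Vars X Ω N) (t : ℕ) (S : Fin N → Ω → ℝ≥0∞)
    {f : X → ℝ≥0∞} (hf : Measurable f) (ω : Ω) :
    ∫⁻ x', V.predDensity H K ρ₀ t ω x' * (H.g (t + 1) x' *
      (f x' * stepFun H (V.stepData H K ρ₀ t S ω, x'))) ∂H.ν =
    V.selfNorm H K ρ₀ t (fun i => H.lookAhead t f (V.ξ t i ω) * S i ω) ω := by
  set W := fun i => (normWeight (fun j => V.weight H K ρ₀ t j ω) i : ℝ≥0∞)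
  have hmeas : ∀ i, Measurable fun x' =>
      (H.m (V.ξ t i ω) x' : ℝ≥0∞) * (H.g (t + 1) x' * f x') := fun i =>
    (measurable_m_right _).mul ((H.measurable_g _).coe_nnreal_ennreal.mul hf)
  have e : ∀ x', V.predDensity H K ρ₀ t ω x' * (H.g (t + 1) x' *
      (f x' * stepFun H (V.stepData H K ρ₀ t S ω, x'))) =
      ∑ i, W i * S i ω * (H.m (V.ξ t i ω) x' * (H.g (t + 1) x' * f x')) := by
    intro x'
    have hD : V.predDensity H K ρ₀ t ω x' = ∑ i, W i * H.m (V.ξ t i ω) x' := rfl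
    have hs : stepFun H (V.stepData H K ρ₀ t S ω, x') =
      (∑ i, W i * (H.m (V.ξ t i ω) x' * S i ω)) / ∑ i, W i * H.m (V.ξ t i ω) x' := rfl
    rw [hD, hs]
    have hcancel : (∑ i, W i * H.m (V.ξ t i ω) x') *
        ((∑ i, W i * (H.m (V.ξ t i ω) x' * S i ω)) / ∑ i, W i * H.m (V.ξ t i ω) x') =
        ∑ i, W i * (H.m (V.ξ t i ω) x' * S i ω) := by
      -- A vanishing denominator forces every term of the numerator to vanish, so cancellation is
      -- valid there too.
      refine ENNReal.mul_div_cancel' (fun h0 => ?_) fun htop => ?_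
      · rw [Finset.sum_eq_zero_iff] at h0
        refine Finset.sum_eq_zero fun i hi => ?_
        rw [← mul_assoc, h0 i hi, zero_mul]
      · exact absurd htop (ENNReal.sum_ne_top.2 fun i _ =>
          ENNReal.mul_ne_top ENNReal.coe_ne_top ENNReal.coe_ne_top)
    calc _ = ((∑ i, W i * H.m (V.ξ t i ω) x') * ((∑ i, W i * (H.m (V.ξ t i ω) x' * S i ω)) /
          ∑ i, W i * H.m (V.ξ t i ω) x')) * (H.g (t + 1) x' * f x') := by ring
      _ = _ := by
        rw [hcancel, Finset.sum_mul]
        exact Finset.sum_congr rfl fun i _ => by ring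
  simp only [e]
  rw [lintegral_finsetSum _ fun i _ => (hmeas i).const_mul _]
  refine Finset.sum_congr rfl fun i _ => ?_
  rw [lintegral_const_mul _ (hmeas i)]
  simp only [StateSpaceModel.lookAhead, W]
  ring

variable {ι : Type*} [MeasurableSpace Ω] {P : Measure Ω} [IsProbabilityMeasure P] {l : Filter ι}
  {n : ι → ℕ} {V : (i : ι) → Vars X Ω (n i)}

/-- The passage from time `t` to time `t + 1` for self-normalized means of `f * F`. -/
theorem Consistent.tip_selfNorm_succ {t : ℕ} (h : Consistent P l V H K ρ₀ t)
    (hn : Tendsto n l atTop) (hH : H.Regular T σ) (hK : K.Regular H T)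
    (hV : ∀ i, (V i).IsRun H K ρ₀ σ P T) (ht : t < T) {𝒵 : ι → Type*}
    [∀ i, MeasurableSpace (𝒵 i)] {Z : (i : ι) → Ω → 𝒵 i}
    (hZ : ∀ i, Measurable[(V i).forwardσ H K ρ₀ t] (Z i)) {F : (i : ι) → 𝒵 i × X → ℝ≥0∞}
    (hF : ∀ i, Measurable (F i)) {L : ℝ≥0∞} (hL : L ≠ ⊤)
    (hb : L = 0 ∨ ∃ C : ℝ≥0, ∀ i z, F i z ≤ C)
    (hlim : TIP P l (fun i ω => ∫⁻ x', (V i).predDensity H K ρ₀ t ω x' *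
      (H.g (t + 1) x' * (H.backward (T - (t + 1)) (t + 1) x' * F i (Z i ω, x'))) ∂H.ν)
      (L * ∫⁻ x, H.backward (T - t) t x ∂H.filter t)) :
    TIP P l (fun i ω => (V i).selfNorm H K ρ₀ (t + 1) (fun j =>
        H.backward (T - (t + 1)) (t + 1) ((V i).ξ (t + 1) j ω) *
          F i (Z i ω, (V i).ξ (t + 1) j ω)) ω)
      (L * ∫⁻ x, H.backward (T - (t + 1)) (t + 1) x ∂H.filter (t + 1)) := by
  obtain ⟨d, hd, hw⟩ := h.tip_weight
  obtain ⟨Cf, hCf⟩ := backward_le hH (T - (t + 1)) (t + 1) (by omega)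
  have hw1 := h.tip_weight_mul_succ hn hH hK hV ht (f := fun _ => 1) measurable_const
    ⟨1, fun _ => by simp⟩
  simp only [mul_one] at hw1
  obtain ⟨hc0, hc1⟩ := lintegral_adj hH hK ht
  obtain ⟨hg0, hg1⟩ := lookAhead_one hH ht
  have hLf := ENNReal.mul_ne_top hL (lintegral_backward hH ht.le).2
  have hmove := TIP.move hn hK hV ht hZ
    (F := fun i z => H.backward (T - (t + 1)) (t + 1) z.2 * F i z)
    (fun i => ((measurable_backward _ _).comp measurable_snd).mul (hF i)) hc0 hd hLf hw
    (h.tip_adj hK ht) hlim (by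
      rcases hb with rfl | ⟨C, hC⟩
      · exact Or.inl (zero_mul _)
      · exact Or.inr ⟨Cf * C, fun i z => by
          rw [ENNReal.coe_mul]; exact mul_le_mul' (hCf _) (hC _ _)⟩)
  have hfin := TIP.selfNorm (ENNReal.div_ne_top hLf hc0) (ENNReal.div_ne_zero.2 ⟨hg0, hc1⟩) hmove hw1
  -- The adjustment constant cancels between the weighted average and the mean weight. What is left,
  -- `L * ∫ B_t dφ_t / ∫ lookAhead t 1 dφ_t`, is `L * ∫ B_{t+1} dφ_{t+1}` by the filter recursion.
  convert hfin using 1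
  rw [lintegral_filter_succ hH ht (measurable_backward _ _), ← backward_eq_lookAhead ht,
    div_eq_mul_inv (L * _), div_eq_mul_inv (∫⁻ x, H.lookAhead t (fun _ => 1) x ∂H.filter t),
    ENNReal.mul_div_mul_right _ _ (ENNReal.inv_ne_zero.2 hc1) (ENNReal.inv_ne_top.2 hc0),
    mul_div_assoc]

/-- Weighting by `backward` makes the limit keep the form `L * ∫ B_t dφ_t` at every time, with the
same `L`. At time `T`, where `backward` is `1`, it is `L` itself. -/
theorem tip_selfNorm_backStat (hn : Tendsto n l atTop) (hH : H.Regular T σ) (hK : K.Regular H T)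
    (hV : ∀ i, (V i).IsRun H K ρ₀ σ P T) (hcons : ∀ t ≤ T, Consistent P l V H K ρ₀ t) {r : ℕ}
    {S : (i : ι) → Fin (n i) → Ω → ℝ≥0∞}
    (hS : ∀ i j, Measurable[(V i).forwardσ H K ρ₀ r] (S i j)) {L : ℝ≥0∞} (hL : L ≠ ⊤)
    (hb : L = 0 ∨ ∃ C : ℝ≥0, ∀ i j ω, S i j ω ≤ C)
    (hlim : TIP P l (fun i ω => (V i).selfNorm H K ρ₀ r (fun j =>
      H.backward (T - r) r ((V i).ξ r j ω) * S i j ω) ω)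
      (L * ∫⁻ x, H.backward (T - r) r x ∂H.filter r)) (k : ℕ) (hk : r + k ≤ T) :
    TIP P l (fun i ω => (V i).selfNorm H K ρ₀ (r + k) (fun j =>
      H.backward (T - (r + k)) (r + k) ((V i).ξ (r + k) j ω) *
        (V i).backStat H K ρ₀ r (S i) k j ω) ω)
      (L * ∫⁻ x, H.backward (T - (r + k)) (r + k) x ∂H.filter (r + k)) := by
  induction k with
  | zero => exact hlim
  | succ k ih =>
    have ht : r + k < T := by omega
    have ih' := ih ht.le
    rw [backward_eq_lookAhead ht] at ih'
    rcases hb with h0 | ⟨C, hC⟩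
    · refine (hcons _ ht.le).tip_selfNorm_succ hn hH hK hV ht
        (fun i => (V i).measurable_stepData ((V i).measurable_backStat (hS i) k))
        (F := fun i => stepFun H) (fun i => measurable_stepFun) hL (Or.inl h0) ?_
      simp only [lintegral_predDensity_stepFun _ _ _ (measurable_backward _ _)]
      rw [backward_eq_lookAhead ht]
      exact ih'
    · have hle : ∀ i ω x', stepFun H
          ((V i).stepData H K ρ₀ (r + k) ((V i).backStat H K ρ₀ r (S i) k) ω, x') ≤ C :=
        fun i ω x' => stepFun_le _ (fun j => (V i).backStat_le (hC i) k j ω) x'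
      have key := (hcons _ ht.le).tip_selfNorm_succ hn hH hK hV ht
        (fun i => (V i).measurable_stepData ((V i).measurable_backStat (hS i) k))
        (F := fun i z => min (stepFun H z) C) (fun i => measurable_stepFun.min measurable_const) hL
        (Or.inr ⟨C, fun i z => min_le_right _ _⟩) (by
          simp only [min_eq_left (hle _ _ _)]
          simp only [lintegral_predDensity_stepFun _ _ _ (measurable_backward _ _)]
          rw [backward_eq_lookAhead ht]
          exact ih')
      simp only [min_eq_left (hle _ _ _)] at key
      exact key

/-- The averages over the backward index paths of a statistic of the particles at time `r`. -/
theorem tip_avg_backStat (hn : Tendsto n l atTop) (hH : H.Regular T σ) (hK : K.Regular H T)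
    (hV : ∀ i, (V i).IsRun H K ρ₀ σ P T) (hcons : ∀ t ≤ T, Consistent P l V H K ρ₀ t) {r : ℕ}
    {S : (i : ι) → Fin (n i) → Ω → ℝ≥0∞}
    (hS : ∀ i j, Measurable[(V i).forwardσ H K ρ₀ r] (S i j)) {L : ℝ≥0∞} (hL : L ≠ ⊤)
    (hb : L = 0 ∨ ∃ C : ℝ≥0, ∀ i j ω, S i j ω ≤ C)
    (hlim : TIP P l (fun i ω => (V i).selfNorm H K ρ₀ r (fun j =>
      H.backward (T - r) r ((V i).ξ r j ω) * S i j ω) ω)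
      (L * ∫⁻ x, H.backward (T - r) r x ∂H.filter r)) (d k : ℕ) (hd : r + k + d = T) :
    TIP P l (fun i ω => avg fun ℓ =>
      (V i).backStat H K ρ₀ r (S i) k ((V i).J (r + k) ℓ ω) ω) L := by
  have hpos := hn.eventually_gt_atTop 0
  -- Induction on the distance to `T`. At `T` the indices are a categorical sample; before `T`,
  -- conditioning on the later indices turns the statistic into its `backStep`, that is `backStat`
  -- with `k + 1` steps.
  induction d generalizing k with
  | zero =>
    obtain rfl : r + k = T := hd
    have := isProbabilityMeasure_filter hH le_rfl
    have h := tip_selfNorm_backStat hn hH hK hV hcons hS hL hb hlim k le_rfl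
    simp only [Nat.sub_self, StateSpaceModel.backward, one_mul, lintegral_const, measure_univ,
      mul_one] at h
    have hm := fun i => (V i).measurable_backStat (H := H) (K := K) (ρ₀ := ρ₀) (hS i) k
    refine TIP.of_condMean hn (fun i => (hV i).forwardσ_le hK _) hL
      (hpos.mono fun i hi => (hV i).condMean_J_final hK hi (hm i)) ?_
      (h.congr_ae (hpos.mono fun i hi => ae_of_all _ fun ω => avg_const hi _))
    rcases hb with h0 | ⟨C, hC⟩
    · exact Or.inl h0
    · exact Or.inr ⟨C, hpos.mono fun i hi => (hV i).bddUncorr_J_final hK hi (hm i)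
        fun j ω => (V i).backStat_le (hC i) k j ω⟩
  | succ d ih =>
    have hs : r + k < T := by omega
    have hm := fun i j => ((V i).measurable_backStat (H := H) (K := K) (ρ₀ := ρ₀) (hS i) k j).mono
      (((V i).forwardσ_mono hs.le).trans ((V i).forwardσ_le_backwardσ (s := r + k + 1))) le_rfl
    refine TIP.of_condMean hn (fun i => (hV i).backwardσ_le hK _) hL
      (hpos.mono fun i hi => (hV i).condMean_J hK hH hi hs (hm i)) ?_ (ih (k + 1) (by omega))
    rcases hb with h0 | ⟨C, hC⟩
    · exact Or.inl h0
    · exact Or.inr ⟨C, hpos.mono fun i hi => (hV i).bddUncorr_J hK hH hi hs (hm i)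
        fun j ω => (V i).backStat_le (hC i) k j ω⟩

end Chain

/-! ### Lipschitz bounds for the survival probabilities -/

section Lipschitz

theorem ennreal_pow_le_pow_add {r r' ε : ℝ≥0∞} (hr : r ≤ 1) (hr' : r' ≤ 1) (h : r ≤ r' + ε)
    (k : ℕ) : r ^ k ≤ r' ^ k + k * ε := by
  induction k with
  | zero => simp
  | succ k ih =>
    calc r ^ (k + 1) ≤ (r' ^ k + k * ε) * r := by rw [pow_succ]; gcongr
      _ = r' ^ k * r + k * ε * r := add_mul _ _ _
      _ ≤ r' ^ k * (r' + ε) + k * ε * 1 := by gcongr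
      _ = r' ^ (k + 1) + r' ^ k * ε + k * ε := by ring
      _ ≤ r' ^ (k + 1) + 1 * ε + k * ε := by gcongr; exact pow_le_one₀ zero_le hr'
      _ = r' ^ (k + 1) + (k + 1 : ℕ) * ε := by push_cast; ring

/-- The distance of two elements of `[0, ∞]`. -/
def absDiff (y z : ℝ≥0∞) : ℝ≥0∞ := (y - z) + (z - y)

theorem le_add_absDiff (y z : ℝ≥0∞) : y ≤ z + absDiff y z :=
  le_add_tsub.trans (by unfold absDiff; gcongr; exact le_self_add)

theorem absDiff_comm (y z : ℝ≥0∞) : absDiff y z = absDiff z y := add_comm _ _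

theorem one_sub_div_pow_le (σ : ℝ≥0) (k : ℕ) (y z : ℝ≥0∞) :
    (1 - y / σ) ^ k ≤ (1 - z / σ) ^ k + k * (absDiff y z / σ) := by
  refine ennreal_pow_le_pow_add tsub_le_self tsub_le_self ?_ k
  rw [tsub_le_iff_right, add_assoc, ← ENNReal.add_div]
  refine (le_tsub_add : (1 : ℝ≥0∞) ≤ 1 - z / σ + z / σ).trans ?_
  gcongr
  rw [add_comm, absDiff_comm]
  exact le_add_absDiff z y

/-- The factor `y ≤ σ` absorbs the `1 / σ` in the Lipschitz constant of the power, which gives `k`;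
the factor in front adds `1`. -/
theorem mul_one_sub_div_pow_le {σ : ℝ≥0} (hσ : σ ≠ 0) (k : ℕ) {y z : ℝ≥0∞} (hy : y ≤ σ) :
    y * (1 - y / σ) ^ k ≤ z * (1 - z / σ) ^ k + (k + 1 : ℕ) * absDiff y z := by
  calc y * (1 - y / σ) ^ k ≤ y * ((1 - z / σ) ^ k + k * (absDiff y z / σ)) := by
        gcongr; exact one_sub_div_pow_le σ k y z
    _ = y * (1 - z / σ) ^ k + k * (y * (absDiff y z / σ)) := by ring
    _ ≤ (z + absDiff y z) * (1 - z / σ) ^ k + k * (σ * (absDiff y z / σ)) := by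
        gcongr; exact le_add_absDiff y z
    _ = z * (1 - z / σ) ^ k + absDiff y z * (1 - z / σ) ^ k + k * absDiff y z := by
        rw [ENNReal.mul_div_cancel (by simpa using hσ) ENNReal.coe_ne_top]; ring
    _ ≤ z * (1 - z / σ) ^ k + absDiff y z * 1 + k * absDiff y z := by
        gcongr; exact pow_le_one₀ zero_le tsub_le_self
    _ = _ := by push_cast; ring

theorem const_mul_one_sub_div_pow_le {σ : ℝ≥0} (hσ : σ ≠ 0) (k : ℕ) (y z : ℝ≥0∞) :
    σ * (1 - y / σ) ^ k ≤ σ * (1 - z / σ) ^ k + k * absDiff y z := by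
  calc σ * (1 - y / σ) ^ k ≤ σ * ((1 - z / σ) ^ k + k * (absDiff y z / σ)) := by
        gcongr; exact one_sub_div_pow_le σ k y z
    _ = σ * (1 - z / σ) ^ k + k * (σ * (absDiff y z / σ)) := by ring
    _ = _ := by rw [ENNReal.mul_div_cancel (by simpa using hσ) ENNReal.coe_ne_top]

end Lipschitz

/-! ### `L¹` convergence of the particle predictive density -/

section Predictive

variable {Ω : Type*} {H : StateSpaceModel X} {K : AuxFilter X} {ρ₀ : Measure X} {σ : ℝ≥0} {T : ℕ}

/-- The density of the predictive distribution `φ_{s+1|s}`. -/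
def StateSpaceModel.predDensity (H : StateSpaceModel X) (s : ℕ) (x' : X) : ℝ≥0∞ :=
  ∫⁻ x, H.m x x' ∂H.filter s

theorem measurable_m_left (x' : X) : Measurable fun x => (H.m x x' : ℝ≥0∞) :=
  (H.measurable_m.comp measurable_prodMk_right).coe_nnreal_ennreal

theorem measurable_predDensity (hH : H.Regular T σ) {s : ℕ} (hs : s ≤ T) :
    Measurable (H.predDensity s) := by
  have := isProbabilityMeasure_filter hH hs
  exact Measurable.lintegral_prod_left' (μ := H.filter s)
    (f := fun z : X × X => (H.m z.1 z.2 : ℝ≥0∞)) H.measurable_m.coe_nnreal_ennreal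

theorem predDensity_le (hH : H.Regular T σ) {s : ℕ} (hs : s ≤ T) (x' : X) :
    H.predDensity s x' ≤ σ := by
  have := isProbabilityMeasure_filter hH hs
  exact lintegral_le_of_le fun x => ENNReal.coe_le_coe.2 (hH.m_le x x')

theorem lintegral_predDensity (hH : H.Regular T σ) {s : ℕ} (hs : s ≤ T) :
    ∫⁻ x', H.predDensity s x' ∂H.ν = 1 := by
  have := isProbabilityMeasure_filter hH hs
  unfold StateSpaceModel.predDensity
  rw [lintegral_lintegral_swap (f := fun x' x => (H.m x x' : ℝ≥0∞))
    (H.measurable_m.coe_nnreal_ennreal.comp measurable_swap).aemeasurable]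
  simp [H.lintegral_m]

/-- The particle approximation of the predictive density, as a function of the weights, of the
particles and of the new particle. -/
def mixDensity {N : ℕ} (H : StateSpaceModel X)
    (z : ((Fin N → ℝ≥0) × (Fin N → X)) × X) : ℝ≥0∞ :=
  ∑ i, (normWeight z.1.1 i : ℝ≥0∞) * H.m (z.1.2 i) z.2

theorem measurable_mixDensity {N : ℕ} : Measurable (mixDensity (N := N) H) := by
  refine Finset.measurable_sum _ fun i _ => ?_
  have h1 : Measurable fun z : ((Fin N → ℝ≥0) × (Fin N → X)) × X => z.1.1 := by fun_prop
  have h2 : Measurable fun z : ((Fin N → ℝ≥0) × (Fin N → X)) × X => (z.1.2 i, z.2) := by fun_prop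
  exact ((measurable_normWeight i).comp h1).coe_nnreal_ennreal.mul
    (H.measurable_m.comp h2).coe_nnreal_ennreal

/-- The weights and the particles at time `t`. -/
def Vars.cloud {N : ℕ} (V : Vars X Ω N) (H : StateSpaceModel X) (K : AuxFilter X)
    (ρ₀ : Measure X) (t : ℕ) (ω : Ω) : (Fin N → ℝ≥0) × (Fin N → X) :=
  (fun i => V.weight H K ρ₀ t i ω, fun i => V.ξ t i ω)

theorem Vars.measurable_cloud {N : ℕ} (V : Vars X Ω N) (t : ℕ) :
    Measurable[V.forwardσ H K ρ₀ t] (V.cloud H K ρ₀ t) := by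
  have h1 := V.measurable_weights_forwardσ (H := H) (K := K) (ρ₀ := ρ₀) (le_refl t)
  have h2 := V.measurable_ξs_forwardσ (H := H) (K := K) (ρ₀ := ρ₀) (le_refl t)
  let _ := V.forwardσ H K ρ₀ t
  exact h1.prodMk h2

theorem Vars.predDensity_le (hH : H.Regular T σ) {N : ℕ} (V : Vars X Ω N) (t : ℕ) (ω : Ω)
    (x' : X) : V.predDensity H K ρ₀ t ω x' ≤ σ := by
  rcases Nat.eq_zero_or_pos N with rfl | hN
  · simp [Vars.predDensity, Vars.selfNorm]
  · rw [← selfNorm_const (H := H) (K := K) (ρ₀ := ρ₀) V hN (t := t) (ω := ω) (σ : ℝ≥0∞)]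
    exact selfNorm_mono _ fun i => ENNReal.coe_le_coe.2 (hH.m_le _ _)

theorem Vars.measurable_predDensity_right {N : ℕ} (V : Vars X Ω N) (t : ℕ) (ω : Ω) :
    Measurable (V.predDensity H K ρ₀ t ω) := by
  have h : Measurable fun x' => mixDensity H (V.cloud H K ρ₀ t ω, x') :=
    measurable_mixDensity.comp measurable_prodMk_left
  exact h

theorem Vars.lintegral_predDensity {N : ℕ} (V : Vars X Ω N) (hN : 0 < N) (t : ℕ) (ω : Ω) :
    ∫⁻ x', V.predDensity H K ρ₀ t ω x' ∂H.ν = 1 := by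
  have := lintegral_predDensity_mul (K := K) (ρ₀ := ρ₀) (H := H) V t ω (h := fun _ => 1)
    measurable_const
  simp only [mul_one, H.lintegral_m] at this
  rw [this, selfNorm_const V hN]

theorem Vars.IsRun.measurable_predDensity [MeasurableSpace Ω] {P : Measure Ω} {N : ℕ}
    {V : Vars X Ω N} (hV : V.IsRun H K ρ₀ σ P T) (hK : K.Regular H T) (t : ℕ) :
    Measurable fun z : Ω × X => V.predDensity H K ρ₀ t z.1 z.2 := by
  have h := (V.measurable_cloud (H := H) (K := K) (ρ₀ := ρ₀) t).mono (hV.forwardσ_le hK t) le_rfl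
  have h1 : Measurable fun z : Ω × X => (V.cloud H K ρ₀ t z.1, z.2) :=
    (h.comp measurable_fst).prodMk measurable_snd
  have h2 : Measurable fun z : Ω × X => mixDensity H (V.cloud H K ρ₀ t z.1, z.2) :=
    measurable_mixDensity.comp h1
  exact h2

theorem measurable_absDiff : Measurable fun z : ℝ≥0∞ × ℝ≥0∞ => absDiff z.1 z.2 :=
  (measurable_fst.sub measurable_snd).add (measurable_snd.sub measurable_fst)

/-- Two densities with the same finite integral. -/
theorem lintegral_absDiff {μ : Measure X} {q r : X → ℝ≥0∞} (hq : Measurable q) (hr : Measurable r)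
    (h : ∫⁻ x, q x ∂μ = ∫⁻ x, r x ∂μ) (hfin : ∫⁻ x, r x ∂μ ≠ ⊤) :
    ∫⁻ x, absDiff (q x) (r x) ∂μ = 2 * ∫⁻ x, (r x - q x) ∂μ := by
  -- Both sides are the integral of `max (q x) (r x)`; the common finite integral then cancels, so
  -- the two one-sided differences have equal integrals.
  have e : ∫⁻ x, r x ∂μ + ∫⁻ x, (q x - r x) ∂μ = ∫⁻ x, r x ∂μ + ∫⁻ x, (r x - q x) ∂μ := by
    nth_rewrite 2 [← h]
    rw [← lintegral_add_left hr, ← lintegral_add_left hq]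
    refine lintegral_congr fun x => ?_
    rw [add_tsub_eq_max, add_tsub_eq_max, max_comm]
  have e' := (ENNReal.add_right_inj hfin).1 e
  have hqr : Measurable fun x => q x - r x := hq.sub hr
  unfold absDiff
  rw [lintegral_add_left hqr, e', two_mul]

variable [MeasurableSpace Ω] {P : Measure Ω} [IsProbabilityMeasure P]
  {V : (N : ℕ) → Vars X Ω N}

/-- The particle approximation of the predictive density converges in `L¹`. -/
theorem tip_lintegral_absDiff (hH : H.Regular T σ) (hK : K.Regular H T)
    (hV : ∀ N, (V N).IsRun H K ρ₀ σ P T) {s : ℕ} (hs : s ≤ T)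
    (hcons : Consistent P atTop V H K ρ₀ s) :
    TIP P atTop (fun N ω => ∫⁻ x', absDiff ((V N).predDensity H K ρ₀ s ω x')
      (H.predDensity s x') ∂H.ν) 0 := by
  have hq := fun N => (hV N).measurable_predDensity hK s
  have hG := measurable_predDensity hH hs
  have hd : ∀ N, Measurable fun z : Ω × X =>
      H.predDensity s z.2 - (V N).predDensity H K ρ₀ s z.1 z.2 := fun N =>
    (hG.comp measurable_snd).sub (hq N)
  have hm : ∀ N, Measurable fun z : Ω × X =>
      absDiff ((V N).predDensity H K ρ₀ s z.1 z.2) (H.predDensity s z.2) := fun N =>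
    measurable_absDiff.comp ((hq N).prodMk (hG.comp measurable_snd))
  refine TIP.of_lintegral (Eventually.of_forall fun N =>
    (Measurable.lintegral_prod_right' (hm N)).aemeasurable) ?_
  -- Scheffé's argument: as both densities have integral one, only the part where the particle
  -- density is too small matters. That part is dominated by the integrable limit density, and it
  -- tends to zero in mean for each fixed `x'` by consistency for the bounded function `m(·, x')`.
  have key : Tendsto (fun N => 2 * ∫⁻ x', ∫⁻ ω, (H.predDensity s x' -
      (V N).predDensity H K ρ₀ s ω x') ∂P ∂H.ν) atTop (𝓝 (2 * ∫⁻ _, 0 ∂H.ν)) := by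
    refine ENNReal.Tendsto.const_mul ?_ (Or.inr (by simp))
    refine tendsto_lintegral_filter_of_dominated_convergence (H.predDensity s)
      (Eventually.of_forall fun N => Measurable.lintegral_prod_left' (hd N))
      (Eventually.of_forall fun N => ae_of_all _ fun x' =>
        lintegral_le_of_le fun ω => tsub_le_self)
      (by rw [lintegral_predDensity hH hs]; exact ENNReal.one_ne_top)
      (ae_of_all _ fun x' => ?_)
    have hcont : ContinuousAt (fun y => H.predDensity s x' - y) (H.predDensity s x') :=
      (ENNReal.continuous_sub_left (ne_top_of_le_ne_top ENNReal.coe_ne_top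
        (predDensity_le hH hs x'))).continuousAt
    have htip := (hcons.tip_selfNorm (fun x => H.m x x') (measurable_m_left x')
      ⟨σ, fun x => ENNReal.coe_le_coe.2 (hH.m_le x x')⟩).map hcont
    refine TIP.tendsto_lintegral (fun N => (hd N).comp measurable_prodMk_right)
      (fun N ω => tsub_le_self.trans (predDensity_le hH hs x')) ?_
    have e : H.predDensity s x' - ∫⁻ x, H.m x x' ∂H.filter s = 0 := tsub_self _
    rwa [e] at htip
  rw [lintegral_zero, mul_zero] at key
  refine key.congr' ?_
  filter_upwards [eventually_gt_atTop 0] with N hN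
  rw [← lintegral_lintegral_swap (hd N).aemeasurable, ← lintegral_const_mul _
    (Measurable.lintegral_prod_right' (hd N))]
  refine lintegral_congr fun ω => ?_
  rw [lintegral_absDiff ((V N).measurable_predDensity_right s ω) hG]
  · rw [(V N).lintegral_predDensity hN, lintegral_predDensity hH hs]
  · rw [lintegral_predDensity hH hs]; exact ENNReal.one_ne_top

/-- Integrals of Lipschitz functions of the predictive density. -/
theorem tip_lintegral_predDensity (hH : H.Regular T σ) (hK : K.Regular H T)
    (hV : ∀ N, (V N).IsRun H K ρ₀ σ P T) {s : ℕ} (hs : s ≤ T)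
    (hcons : Consistent P atTop V H K ρ₀ s) {w : ℝ≥0∞ → ℝ≥0∞} {c : ℕ}
    (hw : ∀ y z : ℝ≥0∞, y ≤ σ → z ≤ σ → w y ≤ w z + c * absDiff y z) {h : X → ℝ≥0∞}
    {C : ℝ≥0} (hC : ∀ x, h x ≤ C) (hfin : ∫⁻ x', w (H.predDensity s x') * h x' ∂H.ν ≠ ⊤) :
    TIP P atTop (fun N ω => ∫⁻ x', w ((V N).predDensity H K ρ₀ s ω x') * h x' ∂H.ν)
      (∫⁻ x', w (H.predDensity s x') * h x' ∂H.ν) := by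
  have hG := measurable_predDensity hH hs
  have h0 := (tip_lintegral_absDiff hH hK hV hs hcons).map (f := fun y => c * C * y)
    (ENNReal.continuous_const_mul (ENNReal.mul_ne_top (ENNReal.natCast_ne_top c)
      ENNReal.coe_ne_top)).continuousAt
  simp only [mul_zero] at h0
  have hb : ∀ (y z : ℝ≥0∞) (x' : X), y ≤ σ → z ≤ σ → w y * h x' ≤ w z * h x' + c * C * absDiff y z := by
    intro y z x' hy hz
    calc w y * h x' ≤ (w z + c * absDiff y z) * h x' := by gcongr; exact hw y z hy hz
      _ = w z * h x' + c * h x' * absDiff y z := by ring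
      _ ≤ _ := by gcongr; exact hC x'
  have hm : ∀ N ω, Measurable fun x' =>
      absDiff ((V N).predDensity H K ρ₀ s ω x') (H.predDensity s x') := fun N ω =>
    measurable_absDiff.comp (((V N).measurable_predDensity_right s ω).prodMk hG)
  refine TIP.of_le_add hfin h0 (fun N ω => ?_) fun N ω => ?_
  · rw [← lintegral_const_mul _ (hm N ω), ← lintegral_add_right _ ((hm N ω).const_mul _)]
    exact lintegral_mono fun x' => hb _ _ _ ((V N).predDensity_le hH s ω x')
      (predDensity_le hH hs x')
  · rw [← lintegral_const_mul _ (hm N ω), ← lintegral_add_right _ ((hm N ω).const_mul _)]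
    refine lintegral_mono fun x' => ?_
    simp only
    rw [absDiff_comm]
    exact hb _ _ _ (predDensity_le hH hs x') ((V N).predDensity_le hH s ω x')

end Predictive

/-! ### Waiting paths and the normalized number of trials -/

section Limit

variable {Ω : Type*} {H : StateSpaceModel X} {K : AuxFilter X} {ρ₀ : Measure X} {σ : ℝ≥0} {T : ℕ}

/-- The indicator that the path `ℓ` is waiting at the beginning of pass `k`. -/
def Vars.waiting {N : ℕ} (V : Vars X Ω N) (H : StateSpaceModel X) (σ : ℝ≥0) (s k : ℕ)
    (ℓ : Fin N) (ω : Ω) : ℝ≥0∞ :=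
  (V.active H σ s ω k : Set (Fin N)).indicator 1 ℓ

theorem Vars.avg_waiting {N : ℕ} (V : Vars X Ω N) (s k : ℕ) (ω : Ω) :
    avg (fun ℓ => V.waiting H σ s k ℓ ω) = (V.active H σ s ω k).card / N := by
  classical
  rw [avg, div_eq_mul_inv, mul_comm]
  congr 1
  simp [Vars.waiting, Set.indicator_apply]

theorem Vars.simCount_div {N : ℕ} (V : Vars X Ω N) (s : ℕ) (ω : Ω) :
    V.simCount H σ s ω / N = ∑' k, avg fun ℓ => V.waiting H σ s k ℓ ω := by
  simp only [Vars.avg_waiting, Vars.simCount, div_eq_mul_inv, ENNReal.tsum_mul_right]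

theorem avg_tsum {N : ℕ} (a : ℕ → Fin N → ℝ≥0∞) :
    avg (fun ℓ => ∑' k, a k ℓ) = ∑' k, avg (a k) := by
  simp only [avg, ENNReal.tsum_mul_left]
  congr 1
  exact (Summable.tsum_finsetSum fun _ _ => ENNReal.summable).symm

/-- With `Φ = 1` only the rejection indicators remain; the statistic then plays no role and is set
to `0`. -/
theorem Vars.atTrial_one {N : ℕ} (V : Vars X Ω N) (s : ℕ) :
    V.atTrial H K ρ₀ σ s (fun _ _ => 0) (fun _ _ => 1) = V.waiting H σ s := by
  ext k ℓ ω
  rw [Vars.atTrial, Vars.prod_rejectFun, mul_one]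
  rfl

theorem Vars.atTrialMean_one {N : ℕ} (V : Vars X Ω N) (s k : ℕ) (ℓ : Fin N) (ω : Ω) :
    V.atTrialMean H K ρ₀ σ s (fun _ _ => 0) (fun _ _ => 1) k ℓ ω =
      (1 - V.predDensity H K ρ₀ s ω (V.ξ (s + 1) (V.J (s + 1) ℓ ω) ω) / σ) ^ k := by
  have := isMarkovKernel_trialKernel (X := X) ℓ.pos
  rw [Vars.atTrialMean, lintegral_one, measure_univ, mul_one]
  rfl

theorem measurable_one_sub_div_pow (σ : ℝ≥0) (k : ℕ) :
    Measurable fun y : ℝ≥0∞ => (1 - y / σ) ^ k :=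
  ((measurable_id.div_const _).const_sub _).pow_const k

/-- The integrand of the limits. -/
def StateSpaceModel.target (H : StateSpaceModel X) (T s : ℕ) (x : X) : ℝ≥0∞ :=
  H.g (s + 1) x * H.backward (T - (s + 1)) (s + 1) x

theorem measurable_target (s : ℕ) : Measurable (H.target T s) :=
  (H.measurable_g _).coe_nnreal_ennreal.mul (measurable_backward _ _)

theorem target_le (hH : H.Regular T σ) {s : ℕ} (hs : s < T) :
    ∃ C : ℝ≥0, ∀ x, H.target T s x ≤ C := by
  obtain ⟨Cg, hCg⟩ := hH.g_le
  obtain ⟨C, hC⟩ := backward_le hH (T - (s + 1)) (s + 1) (by omega)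
  exact ⟨Cg * C, fun x => by
    rw [ENNReal.coe_mul]; exact mul_le_mul' (ENNReal.coe_le_coe.2 (hCg _ hs x)) (hC x)⟩

/-- The limit of the proportion of paths that are waiting at the beginning of pass `k`. -/
def StateSpaceModel.waitingLimit (H : StateSpaceModel X) (σ : ℝ≥0) (T s k : ℕ) : ℝ≥0∞ :=
  (∫⁻ x', H.predDensity s x' * (1 - H.predDensity s x' / σ) ^ k * H.target T s x' ∂H.ν) /
    ∫⁻ x, H.backward (T - s) s x ∂H.filter s

theorem lintegral_waiting_ne_top (hH : H.Regular T σ) {s : ℕ} (hs : s < T) (k : ℕ) :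
    ∫⁻ x', H.predDensity s x' * (1 - H.predDensity s x' / σ) ^ k * H.target T s x' ∂H.ν ≠ ⊤ := by
  obtain ⟨C, hC⟩ := target_le hH hs
  refine ne_top_of_le_ne_top (ENNReal.coe_ne_top (r := C)) ?_
  calc _ ≤ ∫⁻ x', H.predDensity s x' * 1 * C ∂H.ν := by
        gcongr with x'
        · exact pow_le_one₀ zero_le tsub_le_self
        · exact hC x'
    _ = C := by
        simp only [mul_one]
        rw [lintegral_mul_const _ (measurable_predDensity hH hs.le),
          lintegral_predDensity hH hs.le, one_mul]

/-- Pointwise `∑ G (1 - G/σ)^k = G * (σ / G) = σ` where `G > 0`. This is why the limit does not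
contain the predictive density, and where its positivity `ν`-almost everywhere enters. -/
theorem tsum_waitingLimit (hH : H.Regular T σ) {s : ℕ} (hs : s < T)
    (hpos : ∀ᵐ x' ∂H.ν, 0 < H.predDensity s x') :
    ∑' k, H.waitingLimit σ T s k = H.beta σ T s := by
  have hG := measurable_predDensity hH hs.le
  have hσ := hH.σ_ne_zero
  have hm : ∀ k, Measurable fun x' =>
      H.predDensity s x' * (1 - H.predDensity s x' / σ) ^ k * H.target T s x' := fun k =>
    (hG.mul ((measurable_one_sub_div_pow σ k).comp hG)).mul (measurable_target s)
  simp only [StateSpaceModel.waitingLimit, div_eq_mul_inv _ (∫⁻ x, H.backward _ _ x ∂_)]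
  rw [ENNReal.tsum_mul_right, ← lintegral_tsum fun k => (hm k).aemeasurable,
    StateSpaceModel.beta, StateSpaceModel.limitNumerator, div_eq_mul_inv, ← mul_assoc,
    ← lintegral_const_mul _ (show Measurable fun x => (H.g (s + 1) x : ℝ≥0∞) *
      H.backward (T - (s + 1)) (s + 1) x from measurable_target s)]
  congr 1
  refine lintegral_congr_ae ?_
  filter_upwards [hpos] with x' hx'
  have hle := predDensity_le hH hs.le x'
  have hσ' : (σ : ℝ≥0∞) ≠ 0 := by simpa using hσ
  rw [ENNReal.tsum_mul_right, ENNReal.tsum_mul_left, tsum_one_sub_pow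
    (ENNReal.div_le_of_le_mul (by simpa using hle)), ENNReal.inv_div (Or.inl ENNReal.coe_ne_top)
    (Or.inl hσ'), ENNReal.mul_div_cancel hx'.ne' (ne_top_of_le_ne_top ENNReal.coe_ne_top hle)]
  rfl

variable [MeasurableSpace Ω] {P : Measure Ω} [IsProbabilityMeasure P]

/-- The averages over the backward index paths of a function of the particle approximation of the
predictive density at the selected particles. -/
theorem tip_avg_predDensity {ι : Type*} {l : Filter ι} {n : ι → ℕ} {V : (i : ι) → Vars X Ω (n i)}
    (hn : Tendsto n l atTop) (hH : H.Regular T σ) (hK : K.Regular H T)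
    (hV : ∀ i, (V i).IsRun H K ρ₀ σ P T) (hcons : ∀ t ≤ T, Consistent P l V H K ρ₀ t) {s : ℕ}
    (hs : s < T) {θ : ι → ℝ≥0∞ → ℝ≥0∞} (hθ : ∀ i, Measurable (θ i)) {L : ℝ≥0∞} (hL : L ≠ ⊤)
    (hb : L = 0 ∨ ∃ C : ℝ≥0, ∀ i y, θ i y ≤ C)
    (hlim : TIP P l (fun i ω => ∫⁻ x', (V i).predDensity H K ρ₀ s ω x' *
      (H.g (s + 1) x' * (H.backward (T - (s + 1)) (s + 1) x' *
        θ i ((V i).predDensity H K ρ₀ s ω x'))) ∂H.ν)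
      (L * ∫⁻ x, H.backward (T - s) s x ∂H.filter s)) :
    TIP P l (fun i ω => avg fun ℓ => θ i ((V i).predDensity H K ρ₀ s ω
      ((V i).ξ (s + 1) ((V i).J (s + 1) ℓ ω) ω))) L := by
  have hF : ∀ i, Measurable fun z : ((Fin (n i) → ℝ≥0) × (Fin (n i) → X)) × X =>
      θ i (mixDensity H z) := fun i => (hθ i).comp measurable_mixDensity
  have hsucc := (hcons s hs.le).tip_selfNorm_succ hn hH hK hV hs
    (fun i => (V i).measurable_cloud s) hF hL (hb.imp_right fun ⟨C, hC⟩ => ⟨C, fun i z => hC i _⟩)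
    hlim
  have hS : ∀ i j, Measurable[(V i).forwardσ H K ρ₀ (s + 1)] fun ω =>
      θ i (mixDensity H ((V i).cloud H K ρ₀ s ω, (V i).ξ (s + 1) j ω)) := by
    intro i j
    have h1 := ((V i).measurable_cloud (H := H) (K := K) (ρ₀ := ρ₀) s).mono
      ((V i).forwardσ_mono (Nat.le_succ s)) le_rfl
    have h2 := (V i).measurable_ξ_forwardσ (H := H) (K := K) (ρ₀ := ρ₀) (le_refl (s + 1)) j
    let _ := (V i).forwardσ H K ρ₀ (s + 1)
    have h3 : Measurable fun ω => ((V i).cloud H K ρ₀ s ω, (V i).ξ (s + 1) j ω) := h1.prodMk h2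
    exact (hF i).comp h3
  -- The statistic lives at time `r = s + 1` already, so no backward step is applied (`k = 0`).
  exact tip_avg_backStat hn hH hK hV hcons hS hL
    (hb.imp_right fun ⟨C, hC⟩ => ⟨C, fun i j ω => hC i _⟩) hsucc (T - (s + 1)) 0 (by omega)

variable {V : (N : ℕ) → Vars X Ω N}

/-- The conditional mean of the indicator of waiting is a bounded function of the particle density
at the selected particle. Its average tends to the integral of the Lipschitz function `y (1 -
y/σ)^k` of the limit density against `target`, normalized. -/
theorem tip_avg_waiting (hH : H.Regular T σ) (hK : K.Regular H T)
    (hV : ∀ N, (V N).IsRun H K ρ₀ σ P T) (hcons : ∀ t ≤ T, Consistent P atTop V H K ρ₀ t) {s : ℕ}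
    (hs : s < T) (k : ℕ) :
    TIP P atTop (fun N ω => avg fun ℓ => (V N).waiting H σ s k ℓ ω) (H.waitingLimit σ T s k) := by
  have hpos : ∀ᶠ N : ℕ in atTop, 0 < N := eventually_gt_atTop 0
  obtain ⟨C, hC⟩ := target_le hH hs
  obtain ⟨hf0, hf1⟩ := lintegral_backward hH hs.le
  have hfin := lintegral_waiting_ne_top hH hs k
  have hL : H.waitingLimit σ T s k ≠ ⊤ := ENNReal.div_ne_top hfin hf0
  have hdens := tip_lintegral_predDensity hH hK hV hs.le (hcons s hs.le)
    (w := fun y => y * (1 - y / σ) ^ k)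
    (fun y z hy _ => mul_one_sub_div_pow_le hH.σ_ne_zero k hy) hC hfin
  have hmean := tip_avg_predDensity (θ := fun _ y => (1 - y / σ) ^ k) tendsto_id hH hK hV hcons hs
    (fun _ => measurable_one_sub_div_pow σ k) hL
    (Or.inr ⟨1, fun _ y => by simpa using pow_le_one₀ zero_le tsub_le_self⟩) (by
      rw [StateSpaceModel.waitingLimit, ENNReal.div_mul_cancel hf0 hf1]
      convert hdens using 5
      unfold StateSpaceModel.target
      ring)
  have hcm := fun N (hN : 0 < N) => (hV N).condMean_atTrial hK hH hN hs (f := fun _ _ => 0)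
    (fun _ => measurable_const) (Φ := fun _ _ => 1) (fun _ => measurable_const) k
  simp only [← Vars.atTrialMean_one] at hmean
  simp only [← Vars.atTrial_one (K := K) (ρ₀ := ρ₀)]
  refine TIP.of_condMean tendsto_id (fun N => (hV N).backwardσ_le hK (s + 1)) hL (hpos.mono hcm)
    (Or.inr ⟨1, hpos.mono fun N hN => ⟨fun ℓ => ae_of_all _ fun ω => ?_,
      fun ℓ => ae_of_all _ fun ω => ?_, fun ℓ ℓ' hℓ => ?_⟩⟩) hmean
  · rw [Vars.atTrial_one]
    exact Set.indicator_le_self' (fun _ _ => zero_le) _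
  · rw [Vars.atTrialMean_one]
    simpa using pow_le_one₀ zero_le tsub_le_self
  · exact (hV N).lintegral_atTrial_mul hK hH hN hs (fun _ => measurable_const)
      (fun _ => measurable_const) k k hℓ

/-- Dominated convergence with dominating function `σ * target`: the base of the power is strictly
below `1` wherever the predictive density is positive. -/
theorem tendsto_lintegral_tail (hH : H.Regular T σ) {s : ℕ} (hs : s < T)
    (hpos : ∀ᵐ x' ∂H.ν, 0 < H.predDensity s x') (hfin : ∫⁻ x', H.target T s x' ∂H.ν ≠ ⊤) :
    Tendsto (fun k : ℕ => ∫⁻ x', σ * (1 - H.predDensity s x' / σ) ^ k * H.target T s x' ∂H.ν)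
      atTop (𝓝 0) := by
  have hG := measurable_predDensity hH hs.le
  obtain ⟨C, hC⟩ := target_le hH hs
  rw [← lintegral_zero (μ := H.ν)]
  refine tendsto_lintegral_of_dominated_convergence (fun x' => σ * H.target T s x')
    (fun k => (((measurable_one_sub_div_pow σ k).comp hG).const_mul _).mul (measurable_target s))
    (fun k => ae_of_all _ fun x' => ?_) ?_ ?_
  · calc (σ : ℝ≥0∞) * (1 - H.predDensity s x' / σ) ^ k * H.target T s x'
        ≤ σ * 1 * H.target T s x' := by
          gcongr
          exact pow_le_one₀ zero_le tsub_le_self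
      _ = _ := by rw [mul_one]
  · rw [lintegral_const_mul _ (measurable_target s)]
    exact ENNReal.mul_ne_top ENNReal.coe_ne_top hfin
  · filter_upwards [hpos] with x' hx'
    have hlt : 1 - H.predDensity s x' / σ < 1 := ENNReal.sub_lt_self ENNReal.one_ne_top one_ne_zero
      (ENNReal.div_ne_zero.2 ⟨hx'.ne', ENNReal.coe_ne_top⟩)
    have h0 := ENNReal.tendsto_pow_atTop_nhds_zero_of_lt_one hlt
    have h1 := ENNReal.Tendsto.const_mul (a := (σ : ℝ≥0∞) * H.target T s x') h0
      (Or.inr (ENNReal.mul_ne_top ENNReal.coe_ne_top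
        (ne_top_of_le_ne_top ENNReal.coe_ne_top (hC x'))))
    rw [mul_zero] at h1
    refine h1.congr fun k => by ring

theorem tendsto_snd_curry : Tendsto (Prod.snd : ℕ × ℕ → ℕ) (atTop.curry atTop) atTop :=
  fun _ hs => eventually_curry_iff.2 (Eventually.of_forall fun _ => hs)

/-- The paths that are still waiting after many passes can be neglected. -/
theorem tip_avg_waiting_tail (hH : H.Regular T σ) (hK : K.Regular H T)
    (hV : ∀ N, (V N).IsRun H K ρ₀ σ P T) (hcons : ∀ t ≤ T, Consistent P atTop V H K ρ₀ t) {s : ℕ}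
    (hs : s < T) (hpos : ∀ᵐ x' ∂H.ν, 0 < H.predDensity s x')
    (hfin : ∫⁻ x', H.target T s x' ∂H.ν ≠ ⊤) :
    TIP P (atTop.curry atTop) (fun (p : ℕ × ℕ) ω =>
      ∑' k, avg fun ℓ => (V p.2).waiting H σ s (k + p.1) ℓ ω) 0 := by
  have hn := tendsto_snd_curry
  have hposN : ∀ᶠ p : ℕ × ℕ in atTop.curry atTop, 0 < p.2 := hn.eventually_gt_atTop 0
  obtain ⟨C, hC⟩ := target_le hH hs
  obtain ⟨hf0, hf1⟩ := lintegral_backward hH hs.le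
  have hσ' : (σ : ℝ≥0∞) ≠ 0 := by simpa using hH.σ_ne_zero
  have hcons' : ∀ t ≤ T, Consistent P (atTop.curry atTop) (fun p : ℕ × ℕ => V p.2) H K ρ₀ t :=
    fun t ht => ⟨fun f hf hb => ((hcons t ht).tip_selfNorm f hf hb).comp hn,
      (hcons t ht).tip_weight.imp fun d hd => ⟨hd.1, hd.2.comp hn⟩⟩
  have hdens : TIP P (atTop.curry atTop) (fun (p : ℕ × ℕ) ω => ∫⁻ x',
      σ * (1 - (V p.2).predDensity H K ρ₀ s ω x' / σ) ^ p.1 * H.target T s x' ∂H.ν) 0 := by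
    refine TIP.curry (fun k => ?_) (tendsto_lintegral_tail hH hs hpos hfin)
    refine tip_lintegral_predDensity hH hK hV hs.le (hcons s hs.le) (c := k)
      (w := fun y => σ * (1 - y / σ) ^ k)
      (fun y z _ _ => const_mul_one_sub_div_pow_le hH.σ_ne_zero k y z) hC ?_
    refine ne_top_of_le_ne_top (ENNReal.mul_ne_top (ENNReal.coe_ne_top (r := σ)) hfin) ?_
    rw [← lintegral_const_mul _ (measurable_target s)]
    refine lintegral_mono fun x' => ?_
    calc _ ≤ (σ : ℝ≥0∞) * 1 * H.target T s x' := by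
          gcongr
          exact pow_le_one₀ zero_le tsub_le_self
      _ = _ := by rw [mul_one]
  -- This `θ` sums the survival probabilities from pass `p.1` on and is unbounded as `y → 0`; hence
  -- the branch `L = 0` of the weak law.
  have hmean := tip_avg_predDensity (V := fun p : ℕ × ℕ => V p.2)
    (θ := fun p y => ∑' k, (1 - y / σ) ^ (k + p.1)) hn hH hK (fun p => hV p.2) hcons' hs
    (fun p => Measurable.tsum fun k => measurable_one_sub_div_pow σ _) (L := 0) ENNReal.zero_ne_top
    (Or.inl rfl) (by
      rw [zero_mul]
      refine hdens.zero_of_le (Eventually.of_forall fun p => ae_of_all _ fun ω =>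
        lintegral_mono fun x' => ?_)
      have hle := (V p.2).predDensity_le (K := K) (ρ₀ := ρ₀) hH s ω x'
      set y := (V p.2).predDensity H K ρ₀ s ω x'
      simp only [pow_add]
      rw [ENNReal.tsum_mul_right, tsum_one_sub_pow
        (ENNReal.div_le_of_le_mul (by simpa using hle)), ENNReal.inv_div
        (Or.inl ENNReal.coe_ne_top) (Or.inl hσ')]
      -- Only `y * (σ / y) ≤ σ` is needed; it also covers `y = 0`, where `σ / y` is infinite and the
      -- product is `0`.
      calc _ = y * (σ / y) * (1 - y / σ) ^ p.1 * H.target T s x' := by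
            unfold StateSpaceModel.target; ring
        _ ≤ _ := by gcongr; exact ENNReal.mul_div_le)
  simp only [← avg_tsum]
  simp only [← Vars.atTrialMean_one] at hmean
  simp only [← Vars.atTrial_one (K := K) (ρ₀ := ρ₀)]
  exact TIP.of_condMean hn (fun p => (hV p.2).backwardσ_le hK (s + 1)) ENNReal.zero_ne_top
    (hposN.mono fun p hp => (hV p.2).condMean_tsum_atTrial hK hH hp hs (f := fun _ _ => 0)
      (fun _ => measurable_const) (Φ := fun _ _ => 1) (fun _ => measurable_const) p.1)
    (Or.inl rfl) hmean

/-- The convergence of the normalized number of trials. -/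
theorem tip_simCount (hH : H.Regular T σ) (hK : K.Regular H T)
    (hV : ∀ N, (V N).IsRun H K ρ₀ σ P T) [IsProbabilityMeasure ρ₀] (hρ : H.χ ≪ ρ₀)
    (hρb : ∃ C : ℝ≥0, ∀ᵐ x ∂ρ₀, H.χ.rnDeriv ρ₀ x * H.g 0 x ≤ C) {s : ℕ} (hs : s < T)
    (hpos : ∀ᵐ x' ∂H.ν, 0 < H.predDensity s x') :
    TIP P atTop (fun N ω => (V N).simCount H σ s ω / N) (H.beta σ T s) := by
  have hcons : ∀ t ≤ T, Consistent P atTop V H K ρ₀ t := fun t ht =>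
    consistent tendsto_id hH hK hρ hρb hV ht
  have hsum : TIP P (atTop.curry atTop) (fun (p : ℕ × ℕ) ω => ∑ k ∈ Finset.range p.1,
      avg fun ℓ => (V p.2).waiting H σ s k ℓ ω) (H.beta σ T s) := by
    refine TIP.curry (fun m => TIP.sum (tip_avg_waiting hH hK hV hcons hs) m) ?_
    rw [← tsum_waitingLimit hH hs hpos]
    exact ENNReal.tendsto_nat_tsum _
  -- A cut-off `p.1` is introduced as an outer index, so that the sum can be split into `p.1` passes
  -- and a tail.
  refine TIP.of_curry ?_
  simp only [Vars.simCount_div]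
  -- An infinite limit needs only the partial sums as lower bounds. In the finite case `target` is
  -- integrable, because `σ ≠ 0` and the denominator of `beta` is finite, and the tail is
  -- negligible.
  by_cases hβ : H.beta σ T s = ⊤
  · rw [hβ] at hsum ⊢
    exact hsum.top_of_le fun p ω => ENNReal.sum_le_tsum _
  · have hfin : ∫⁻ x', H.target T s x' ∂H.ν ≠ ⊤ := by
      intro htop
      refine hβ ?_
      rw [StateSpaceModel.beta, show H.limitNumerator T s = ⊤ from htop,
        ENNReal.top_div_of_ne_top (lintegral_backward hH hs.le).2,
        ENNReal.mul_top (by simpa using hH.σ_ne_zero)]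
    have h := hsum.map₂ (tip_avg_waiting_tail hH hK hV hcons hs hpos hfin) (f := fun y z => y + z)
      continuous_add.continuousAt
    simp only [add_zero] at h
    convert h using 3 with p ω
    exact (Summable.sum_add_tsum_nat_add' ENNReal.summable).symm

end Limit

/-! ### The bootstrap and the fully adapted filters -/

section Instances

variable {H : StateSpaceModel X} {σ : ℝ≥0} {T : ℕ}

theorem regular_bootstrap (hH : H.Regular T σ) : (bootstrap H).Regular H T where
  measurable_adj _ := measurable_const
  measurable_prop _ := H.measurable_m
  adj_pos _ _ _ := one_pos
  adj_le := ⟨1, fun _ _ _ => le_rfl⟩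
  lintegral_prop _ _ x := H.lintegral_m x
  prop_eq_zero _ _ _ _ := Iff.rfl
  weight_le := by
    obtain ⟨C, hC⟩ := hH.g_le
    refine ⟨C, fun t ht x x' => ?_⟩
    simp only [bootstrap, one_mul]
    refine div_le_of_le_mul₀ zero_le zero_le ?_
    rw [mul_comm]
    gcongr
    exact hC _ ht x'

theorem coe_adj_fullyAdapted (hH : H.Regular T σ) {t : ℕ} (ht : t < T) (x : X) :
    ((fullyAdapted H).adj (t + 1) x : ℝ≥0∞) = ∫⁻ x', H.m x x' * H.g (t + 1) x' ∂H.ν := by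
  obtain ⟨C, hC⟩ := hH.g_le
  have h := lookAhead_le (f := fun _ => 1) (C' := 1) (hC (t + 1) ht) (by simp) x
  simp only [StateSpaceModel.lookAhead, mul_one] at h
  exact ENNReal.coe_toNNReal (ne_top_of_le_ne_top ENNReal.coe_ne_top h)

theorem adj_fullyAdapted_pos (hH : H.Regular T σ) {t : ℕ} (ht : t < T) (x : X) :
    0 < (fullyAdapted H).adj (t + 1) x := by
  have h := lookAhead_ne_zero (f := fun _ => 1) measurable_const (hH.g_pos (t + 1) ht)
    (fun _ => one_ne_zero) x
  simp only [StateSpaceModel.lookAhead, mul_one] at h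
  rw [← coe_adj_fullyAdapted hH ht x] at h
  exact pos_iff_ne_zero.2 (by simpa using h)

theorem regular_fullyAdapted (hH : H.Regular T σ) : (fullyAdapted H).Regular H T where
  measurable_adj t := by
    have h := measurable_lookAhead (H := H) (t := t) (f := fun _ => 1) measurable_const
    unfold StateSpaceModel.lookAhead at h
    simp only [mul_one] at h
    exact h.ennreal_toNNReal
  measurable_prop t := by
    have h := measurable_lookAhead (H := H) (t := t) (f := fun _ => 1) measurable_const
    unfold StateSpaceModel.lookAhead at h
    simp only [mul_one] at h
    exact (H.measurable_m.mul ((H.measurable_g _).comp measurable_snd)).div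
      (h.ennreal_toNNReal.comp measurable_fst)
  adj_pos _ ht x := adj_fullyAdapted_pos hH ht x
  adj_le := by
    obtain ⟨C, hC⟩ := hH.g_le
    refine ⟨C * 1, fun t ht x => ?_⟩
    have h := lookAhead_le (f := fun _ => 1) (C' := 1) (hC (t + 1) ht) (by simp) x
    simp only [StateSpaceModel.lookAhead, mul_one (H.g _ _ : ℝ≥0∞)] at h
    rw [← coe_adj_fullyAdapted hH ht x] at h
    exact_mod_cast h
  lintegral_prop t ht x := by
    have hpos := adj_fullyAdapted_pos hH ht x
    have e : ∀ x', ((fullyAdapted H).prop (t + 1) x x' : ℝ≥0∞) =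
        H.m x x' * H.g (t + 1) x' * ((fullyAdapted H).adj (t + 1) x : ℝ≥0∞)⁻¹ := fun x' => by
      rw [← ENNReal.coe_mul, ← div_eq_mul_inv, ← ENNReal.coe_div hpos.ne']
      rfl
    have hm : Measurable fun x' => (H.m x x' : ℝ≥0∞) * H.g (t + 1) x' :=
      (measurable_m_right x).mul (H.measurable_g _).coe_nnreal_ennreal
    simp only [e]
    rw [lintegral_mul_const _ hm, ← coe_adj_fullyAdapted hH ht x]
    exact ENNReal.mul_inv_cancel (by simpa using hpos.ne') ENNReal.coe_ne_top
  prop_eq_zero t ht x x' := by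
    have hpos := adj_fullyAdapted_pos hH ht x
    change H.m x x' * H.g (t + 1) x' / (fullyAdapted H).adj (t + 1) x = 0 ↔ _
    simp [hpos.ne', (hH.g_pos (t + 1) ht x').ne']
  weight_le := by
    -- The importance weight is a quotient `a / a`: `1`, or `0` where `m` vanishes.
    refine ⟨1, fun t ht x x' => ?_⟩
    have hpos := adj_fullyAdapted_pos hH ht x
    have e : (fullyAdapted H).adj (t + 1) x * (fullyAdapted H).prop (t + 1) x x' =
        H.m x x' * H.g (t + 1) x' := mul_div_cancel₀ _ hpos.ne'
    rw [e]
    exact div_self_le_one _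

end Instances

/-! ### Equality and finiteness of the limits -/

section Constants

variable {H : StateSpaceModel X} {σ : ℝ≥0} {T : ℕ}

/-- Bayes' formula. The predictive distribution is the pushed unnormalized filter up to the factor
`1 / γ_{s-1}(1)`, which cancels on normalization. -/
theorem filter_eq (hH : H.Regular T σ) {s : ℕ} (hs : s ≤ T) :
    H.filter s = (∫⁻ x, (H.g s x : ℝ≥0∞) ∂H.predictive s)⁻¹ •
      (H.predictive s).withDensity fun x => (H.g s x : ℝ≥0∞) := by
  cases s with
  | zero =>
    rw [← setLIntegral_univ, ← withDensity_apply _ MeasurableSet.univ]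
    rfl
  | succ s =>
    have hs' : s < T := hs
    obtain ⟨h0, h1⟩ := unnormFilter_univ hH hs'.le
    have hc : (H.unnormFilter s Set.univ)⁻¹ ≠ ⊤ := ENNReal.inv_ne_top.2 h0
    have hc0 : (H.unnormFilter s Set.univ)⁻¹ ≠ 0 := ENNReal.inv_ne_zero.2 h1
    have hm : Measurable fun x' => ∫⁻ x, (H.m x x' : ℝ≥0∞) ∂H.unnormFilter s := by
      have : IsFiniteMeasure (H.unnormFilter s) := ⟨h1.lt_top⟩
      exact Measurable.lintegral_prod_left' (μ := H.unnormFilter s)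
        (f := fun z : X × X => (H.m z.1 z.2 : ℝ≥0∞)) H.measurable_m.coe_nnreal_ennreal
    have hg : Measurable fun x => (H.g (s + 1) x : ℝ≥0∞) := (H.measurable_g _).coe_nnreal_ennreal
    have hpush : H.predictive (s + 1) =
        (H.unnormFilter s Set.univ)⁻¹ • H.push (H.unnormFilter s) := by
      simp only [StateSpaceModel.predictive, StateSpaceModel.push, StateSpaceModel.filter,
        lintegral_smul_measure, smul_eq_mul]
      exact withDensity_smul _ hm
    have hu : H.unnormFilter (s + 1) Set.univ =
        ∫⁻ x, (H.g (s + 1) x : ℝ≥0∞) ∂H.push (H.unnormFilter s) := by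
      rw [← setLIntegral_univ, ← withDensity_apply _ MeasurableSet.univ]
      rfl
    rw [hpush, lintegral_smul_measure, withDensity_smul_measure, smul_smul, smul_eq_mul, ← hu,
      ENNReal.mul_inv (Or.inl hc0) (Or.inl hc), mul_right_comm,
      ENNReal.inv_mul_cancel hc0 hc, one_mul]
    rfl

/-- By Bayes' formula the denominator of `beta` is that of `alpha` divided by `c = φ_{s|s-1}(g_s)`,
and `alpha` carries this `c` in front. That `φ_s` has mass one excludes `c = 0` and `c = ∞`. -/
theorem alpha_eq_beta (hH : H.Regular T σ) {s : ℕ} (hs : s < T) :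
    H.alpha σ T s = H.beta σ T s := by
  have hg : Measurable fun x => (H.g s x : ℝ≥0∞) := (H.measurable_g _).coe_nnreal_ennreal
  have hprob := isProbabilityMeasure_filter hH hs.le
  set c := ∫⁻ x, (H.g s x : ℝ≥0∞) ∂H.predictive s with hc
  have hone : c⁻¹ * c = 1 := by
    have h := hprob.measure_univ
    rw [filter_eq hH hs.le, Measure.smul_apply, withDensity_apply _ MeasurableSet.univ,
      Measure.restrict_univ, smul_eq_mul] at h
    exact h
  have hc0 : c ≠ 0 := by rintro h0; simp [h0] at hone
  have hc1 : c ≠ ⊤ := by rintro h0; simp [h0] at hone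
  rw [StateSpaceModel.alpha, StateSpaceModel.beta, filter_eq hH hs.le, lintegral_smul_measure,
    lintegral_withDensity_eq_lintegral_mul _ hg (measurable_backward _ _), smul_eq_mul, ← hc,
    mul_assoc, div_eq_mul_inv, div_eq_mul_inv, ENNReal.mul_inv (Or.inl (ENNReal.inv_ne_zero.2 hc1))
      (Or.inl (ENNReal.inv_ne_top.2 hc0)), inv_inv]
  simp only [Pi.mul_apply]
  ring

/-- `backward` is bounded, so integrability of `g (s + 1)` makes the numerator finite; the
denominator is positive because the likelihoods are. -/
theorem beta_lt_top (hH : H.Regular T σ) {s : ℕ} (hs : s < T)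
    (hg : ∀ u ≤ T, ∫⁻ x, (H.g u x : ℝ≥0∞) ∂H.ν < ∞) : H.beta σ T s < ∞ := by
  obtain ⟨C, hC⟩ := backward_le hH (T - (s + 1)) (s + 1) (by omega)
  have hle : H.limitNumerator T s ≤ ∫⁻ x, H.g (s + 1) x * C ∂H.ν :=
    lintegral_mono fun x => mul_le_mul' le_rfl (hC x)
  rw [lintegral_mul_const _ (H.measurable_g _).coe_nnreal_ennreal] at hle
  exact ENNReal.mul_lt_top ENNReal.coe_lt_top (ENNReal.div_lt_top
    (ne_top_of_le_ne_top (ENNReal.mul_ne_top (hg _ hs).ne ENNReal.coe_ne_top) hle)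
    (lintegral_backward hH hs.le).1)

end Constants

end FFBSi

end

theorem mainTheorem8 {X : Type*} [TopologicalSpace X] [PolishSpace X] [MeasurableSpace X]
    [BorelSpace X] (H : FFBSi.StateSpaceModel X) (T : ℕ) (σ : ℝ≥0)
    (hm : ∀ x x', H.m x x' ≤ σ)
    (hg_pos : ∀ t ≤ T, ∀ x, 0 < H.g t x)
    (hg_bdd : ∃ C : ℝ≥0, ∀ t ≤ T, ∀ x, H.g t x ≤ C)
    (s : ℕ) (hs : s < T) :
    ((∀ᵐ x' ∂H.ν, 0 < ∫⁻ x, (H.m x x' : ℝ≥0∞) ∂H.filter s) →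
      ∀ (ρ₀ : Measure X), IsProbabilityMeasure ρ₀ → H.χ ≪ ρ₀ →
      (∃ C : ℝ≥0, ∀ᵐ x ∂ρ₀, H.χ.rnDeriv ρ₀ x * H.g 0 x ≤ C) →
      ∀ {Ω : Type*} [MeasurableSpace Ω] (P : Measure Ω), IsProbabilityMeasure P →
      ∀ V : (N : ℕ) → FFBSi.Vars X Ω N,
        ((∀ N, (V N).IsRun H (FFBSi.bootstrap H) ρ₀ σ P T) →
          FFBSi.TendstoInProb P (fun N ω => (V N).simCount H σ s ω / N) (H.alpha σ T s)) ∧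
        ((∀ N, (V N).IsRun H (FFBSi.fullyAdapted H) ρ₀ σ P T) →
          FFBSi.TendstoInProb P (fun N ω => (V N).simCount H σ s ω / N) (H.beta σ T s))) ∧
    ((∀ u ≤ T, ∫⁻ x, (H.g u x : ℝ≥0∞) ∂H.ν < ∞) →
      H.alpha σ T s < ∞ ∧ H.beta σ T s < ∞) := by
  have hH : H.Regular T σ := ⟨hm, hg_pos, hg_bdd⟩
  refine ⟨fun hpos ρ₀ _ hρ hρb Ω _ P _ V => ⟨fun hV => ?_, fun hV => ?_⟩, fun hg => ?_⟩
  · rw [FFBSi.alpha_eq_beta hH hs]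
    exact FFBSi.tip_simCount hH (FFBSi.regular_bootstrap hH) hV hρ hρb hs hpos
  · exact FFBSi.tip_simCount hH (FFBSi.regular_fullyAdapted hH) hV hρ hρb hs hpos
  · rw [FFBSi.alpha_eq_beta hH hs]
    exact ⟨FFBSi.beta_lt_top hH hs hg, FFBSi.beta_lt_top hH hs hg⟩
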